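/- Let $d\in\{2,3\}$, let $D\subset\mathbb R^d$ be bounded and open, $T>0$, $\rho>0$. Let $f:[0,\infty)\to\mathbb R$ be smooth (up to $0$), concave, positive on $(0,\infty)$, with $\lim_{r\to0^+}f(r)/r=f'(0)$ and $\lim_{r\to\infty}f(r)<\infty$; let $J$ be measurable with $0\le J\le M$ on $[0,1]$ for some $M$ and $J(r)=0$ for $r>1$. Write $e_\xi=\xi/|\xi|$ and let $\omega_d$ be the volume of the unit ball. For $\epsilon>0$ and $w:\mathbb R^d\to\mathbb R^d$ put $S(y,x;w)=\frac{w(y)-w(x)}{|y-x|}\cdot e_{y-x}$ and $$-\boldsymbol\nabla PD^\epsilon(w)(x)=\frac{4}{\epsilon^{d+1}\omega_d}\int_{|y-x|<\epsilon}J\!\left(\tfrac{|y-x|}{\epsilon}\right)f'\!\left(|y-x|\,S(y,x;w)^2\right)S(y,x;w)\,e_{y-x}\,dy .$$ Let $\mathcal Ew=(\nabla w+\nabla w^T)/2$ and $$\bar{\mathbb C}=\frac{2f'(0)}{\omega_d}\int_{|\xi|<1}J(|\xi|)\,e_\xi\otimes e_\xi\otimes e_\xi\otimes e_\xi\,|\xi|\,d\xi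 .$$ Let $b:[0,T]\times D\to\mathbb R^d$, let $D'\subset D$ with $\operatorname{dist}(\partial D',\partial D)>0$, and let $u_0,v_0:\mathbb R^d\to\mathbb R^d$ vanish outside $D'$. Let $u$, of class $C^2$ on $[0,T]\times\overline D$, satisfy $\rho\ddot u=\nabla\cdot\bar{\mathbb C}\mathcal Eu+b$ in $[0,T]\times D$, $u=0$ on $[0,T]\times\partial D$, and $u(0,\cdot)=u_0$, $\dot u(0,\cdot)=v_0$ in $D$. For every $C_1$ there are constants $C_2,C_3>0$ such that the following holds for every $\epsilon$ with $0<\epsilon<\operatorname{dist}(\partial D',\partial D)$. Let $u^\epsilon$ be $C^2$ in time on $[0,T]$ at each point of $D$ and satisfy $u^\epsilon(t,x)=0$ whenever $t\in[0,T]$ and $\operatorname{dist}(x,\partial D)\le\epsilon$, $\rho\ddot u^\epsilon=-\boldsymbol\nabla PD^\epsilon(u^\epsilon)+b$ for $t\in[0,T]$ and $x\in D$ with $\operatorname{dist}(x,\partial D)>\epsilon$, and $u^\epsilon(0,\cdot)=u_0$, $\dot u^\epsilon(0,\cdot)=v_0$ in $D$. Suppose $u^\epsilon(t)\in C^4(D;\mathbb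 R^d)$ for all $t\in[0,T]$ and $|\nabla^4u^\epsilon(t,x)|\le C_1$ on $[0,T]\times D$. Then $e^\epsilon:=u^\epsilon-u$ satisfies (all integrands being integrable) $$\sup_{t\in[0,T]}\left\{\int_D\rho|\dot e^\epsilon(t,x)|^2dx+\int_D\mathcal Ee^\epsilon(t,x)\cdot\bar{\mathbb C}\,\mathcal Ee^\epsilon(t,x)\,dx\right\}\le C_2\epsilon^2$$ and $$\sup_{t\in[0,T]}\|e^\epsilon(t)\|_{H^1(D;\mathbb R^d)}\le C_3\,\epsilon .$$ -/

import Mathlib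

open MeasureTheory Set Filter Topology
open scoped ContDiff

noncomputable section

namespace Peridynamics

/-- Euclidean space `ℝ^d`. -/
abbrev Vec (d : ℕ) : Type := EuclideanSpace ℝ (Fin d)

/-- The derivative `f'` of a function given on `[0, ∞)` (one-sided at `0`). -/
def halfLineDeriv (f : ℝ → ℝ) (r : ℝ) : ℝ := derivWithin f (Ici 0) r

/-- Admissible potential functions `f : [0, ∞) → ℝ`: smooth up to `0`, positive, concave,
with `f(r)/r → f'(0)` as `r → 0⁺` and a finite limit at infinity. -/
structure IsPotential (f : ℝ → ℝ) : Prop where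
  smooth : ContDiffOn ℝ ∞ f (Ici 0)
  pos : ∀ r, 0 < r → 0 < f r
  concave : ConcaveOn ℝ (Ici 0) f
  slope_zero : Tendsto (fun r => f r / r) (𝓝[>] 0) (𝓝 (halfLineDeriv f 0))
  limit_infty : ∃ fInf : ℝ, Tendsto f atTop (𝓝 fInf)

/-- Influence functions `J`: measurable, `0 ≤ J ≤ M` on `[0, 1]`, zero beyond `1`. -/
structure IsInfluence (J : ℝ → ℝ) : Prop where
  measurable : Measurable J
  bounded : ∃ M : ℝ, ∀ r ∈ Icc (0 : ℝ) 1, 0 ≤ J r ∧ J r ≤ M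
  zero_outside : ∀ r, 1 < r → J r = 0

/-- The volume `ω_d` of the unit ball of `ℝ^d`. -/
def unitBallVolume (d : ℕ) : ℝ := (volume (Metric.ball (0 : Vec d) 1)).toReal

/-- The unit vector `e_ξ = ξ / |ξ|`. -/
def unitDir {d : ℕ} (ξ : Vec d) : Vec d := ‖ξ‖⁻¹ • ξ

/-- The bond strain `S(y, x; u) = (u(y) - u(x)) / |y - x| · e_{y - x}`. -/
def bondStrain {d : ℕ} (u : Vec d → Vec d) (y x : Vec d) : ℝ :=
  inner ℝ (u y - u x) (unitDir (y - x)) / ‖y - x‖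

/-- The nonlinear nonlocal force `-∇PD^ε(u)(x)`. -/
def nonlocalForce {d : ℕ} (f J : ℝ → ℝ) (ε : ℝ) (u : Vec d → Vec d) (x : Vec d) : Vec d :=
  (4 / (ε ^ (d + 1) * unitBallVolume d)) •
    ∫ y in Metric.ball x ε,
      (J (‖y - x‖ / ε) * halfLineDeriv f (‖y - x‖ * bondStrain u y x ^ 2) *
        bondStrain u y x) • unitDir (y - x)

/-- The elasticity tensor
`C̄ = (2 f'(0) / ω_d) ∫_{|ξ| < 1} J(|ξ|) e_ξ ⊗ e_ξ ⊗ e_ξ ⊗ e_ξ |ξ| dξ`. -/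
def elasticTensor (d : ℕ) (f J : ℝ → ℝ) (i j k l : Fin d) : ℝ :=
  2 * halfLineDeriv f 0 / unitBallVolume d *
    ∫ ξ in Metric.ball (0 : Vec d) 1,
      J ‖ξ‖ * (unitDir ξ i * unitDir ξ j * unitDir ξ k * unitDir ξ l) * ‖ξ‖

/-- The `j`-th partial derivative of a map on `ℝ^d`. -/
def partialDeriv {d : ℕ} {F : Type*} [NormedAddCommGroup F] [NormedSpace ℝ F]
    (j : Fin d) (w : Vec d → F) (x : Vec d) : F :=
  fderiv ℝ w x (EuclideanSpace.single j 1)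

/-- The strain tensor `𝓔w = (∇w + ∇wᵀ) / 2`. -/
def strain {d : ℕ} (w : Vec d → Vec d) (x : Vec d) (i j : Fin d) : ℝ :=
  (partialDeriv j w x i + partialDeriv i w x j) / 2

/-- The stress `C̄ 𝓔w`. -/
def stress {d : ℕ} (f J : ℝ → ℝ) (w : Vec d → Vec d) (x : Vec d) (i j : Fin d) : ℝ :=
  ∑ k, ∑ l, elasticTensor d f J i j k l * strain w x k l

/-- The local elastic force `∇ · C̄ 𝓔w`. -/
def elasticForce {d : ℕ} (f J : ℝ → ℝ) (w : Vec d → Vec d) (x : Vec d) : Vec d :=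
  WithLp.toLp 2 fun i => ∑ j, partialDeriv j (fun z => stress f J w z i j) x

/-- The elastic energy density `𝓔w · C̄ 𝓔w`. -/
def elasticDensity {d : ℕ} (f J : ℝ → ℝ) (w : Vec d → Vec d) (x : Vec d) : ℝ :=
  ∑ i, ∑ j, strain w x i j * stress f J w x i j

/-- The squared Euclidean (Frobenius) norm `|∇w|²`. -/
def gradSq {d : ℕ} (w : Vec d → Vec d) (x : Vec d) : ℝ :=
  ∑ j, ‖partialDeriv j w x‖ ^ 2

/-- The `H¹(D; ℝ^d)` norm. -/
def hOneNorm {d : ℕ} (D : Set (Vec d)) (w : Vec d → Vec d) : ℝ :=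
  Real.sqrt ((∫ x in D, ‖w x‖ ^ 2) + ∫ x in D, gradSq w x)

/-- The velocity `∂_t w(t, x)` of a field given for times in `[0, T]`. -/
def velocity {d : ℕ} (T : ℝ) (w : ℝ → Vec d → Vec d) (t : ℝ) (x : Vec d) : Vec d :=
  derivWithin (fun s => w s x) (Icc 0 T) t

/-- The acceleration `∂_t² w(t, x)` of a field given for times in `[0, T]`. -/
def acceleration {d : ℕ} (T : ℝ) (w : ℝ → Vec d → Vec d) (t : ℝ) (x : Vec d) : Vec d :=
  derivWithin (fun s => velocity T w s x) (Icc 0 T) t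

/-- The distance of two sets, in `[0, ∞]`. -/
def setDist {d : ℕ} (A B : Set (Vec d)) : ENNReal :=
  ⨅ x ∈ A, ⨅ y ∈ B, edist x y

/-- `u` is a classical solution, of class `C²` on `[0, T] × D̄`, of
`ρ ∂_t² u = ∇ · C̄ 𝓔u + b` in `[0, T] × D` with `u = 0` on `∂D` and initial data `u₀`, `v₀`. -/
structure IsElastodynamicSolution {d : ℕ} (f J : ℝ → ℝ) (D : Set (Vec d)) (T ρ : ℝ)
    (b : ℝ → Vec d → Vec d) (u₀ v₀ : Vec d → Vec d) (u : ℝ → Vec d → Vec d) : Prop where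
  regular : ContDiffOn ℝ 2 (fun p : ℝ × Vec d => u p.1 p.2) (Icc 0 T ×ˢ closure D)
  equation : ∀ t ∈ Icc 0 T, ∀ x ∈ D,
    ρ • acceleration T u t x = elasticForce f J (u t) x + b t x
  boundary : ∀ t ∈ Icc 0 T, ∀ x ∈ frontier D, u t x = 0
  initial : ∀ x ∈ D, u 0 x = u₀ x
  initial_velocity : ∀ x ∈ D, velocity T u 0 x = v₀ x

/-- `w` is a solution, twice continuously differentiable in time, of
`ρ ∂_t² w = -∇PD^ε(w) + b` with the nonlocal boundary condition `w = 0` on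
`{x : dist(x, ∂D) ≤ ε}` and initial data `u₀`, `v₀`.  The equation is required only at the
points of `D` at which `w` is not prescribed by the boundary condition. -/
structure IsPeridynamicSolution {d : ℕ} (f J : ℝ → ℝ) (D : Set (Vec d)) (T ρ ε : ℝ)
    (b : ℝ → Vec d → Vec d) (u₀ v₀ : Vec d → Vec d) (w : ℝ → Vec d → Vec d) : Prop where
  regular : ∀ x ∈ D, ContDiffOn ℝ 2 (fun t => w t x) (Icc 0 T)
  equation : ∀ t ∈ Icc 0 T, ∀ x ∈ D, ε < Metric.infDist x (frontier D) →
    ρ • acceleration T w t x = nonlocalForce f J ε (w t) x + b t x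
  boundary : ∀ t ∈ Icc 0 T, ∀ x, Metric.infDist x (frontier D) ≤ ε → w t x = 0
  initial : ∀ x ∈ D, w 0 x = u₀ x
  initial_velocity : ∀ x ∈ D, velocity T w 0 x = v₀ x

end Peridynamics

end

/-! Write L for the operator w ↦ ∇·C̄𝓔w. The error e = uε - u solves ρë = Le + r. Off the collar
dist(x, ∂D) ≤ ε, the residual r is the gap between the nonlocal and the elastic force of uε. Pairing
the bonds ξ and -ξ turns the nonlocal force into a second difference; Taylor's formula and f'(s) =
f'(0) + O(s) make the gap O(ε), uniformly over fields with the bounds of `BoundedDerivs`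
(`exists_norm_nonlocalForce_sub_elasticForce_le`). For uε these bounds follow from the one on the
fourth derivative: the zero extension of uε is flat at ∂D, so lower derivatives are controlled by
successive mean value estimates from a boundary point (`CollarField.norm_iteratedFDeriv_le`). An
energy argument with Grönwall's inequality (`RegularMotion.energy_le`) turns a residual O(ε) into an
energy O(ε²).

The collar is the obstacle. There uε = 0, its equation is not imposed, and r is merely bounded; its
power is at most a constant times a bound l for |∂ₜu| on the collar, so the energy is at most Q(ε² +
l) (`energy_error_le`). That l = O(ε²) comes from a dichotomy (`exists_collar_decay`). If admissible
uε exist for arbitrarily small ε, then |u| ≤ Mε in the collar and Landau's inequality in time give l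
= O(√ε), hence uε → u in L² along small ε; since |uε| ≤ |C| dist⁴, the limit u inherits this decay
(`norm_le_infDist_pow_four`), and a second use of Landau's inequality gives l = O(ε²). If none exist
below some ε₀, only ε ≥ ε₀ matters, and there uniform bounds suffice.

Since J is radial, C̄ is isotropic with both Lamé constants equal to some β ≥ 0, and the elastic
density is β times `pairing`. Integration by parts yields Green's formula and Korn's inequality
(`integral_gradSq_le`). No regularity of ∂D is needed, because zero extensions of the fields
concerned are Lipschitz with gradient vanishing almost everywhere off D. When β = 0 the energy does
not see ∇e; but then J(|ξ|) = 0 almost everywhere in the ball, e vanishes off the collar, and the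
decay of uε and u bounds ∇e inside it. -/

namespace Peridynamics

/-! ### Lipschitz bounds for zero extensions -/

section ZeroExtension

variable {E F : Type*} [NormedAddCommGroup E] [NormedSpace ℝ E]
  [NormedAddCommGroup F] [NormedSpace ℝ F]

/-- A continuous function vanishing off an open set `D`, with gradient bounded by `M` on `D`, is
controlled by `M` times the distance to any point outside `D`. -/
lemma norm_le_mul_norm_sub_of_zero_off {g : E → F} {D : Set E} {M : ℝ} (hD : IsOpen D)
    (hc : Continuous g) (h0 : ∀ x, x ∉ D → g x = 0) (hd : DifferentiableOn ℝ g D)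
    (hM : ∀ x ∈ D, ‖fderiv ℝ g x‖ ≤ M) {x y : E} (hx : x ∈ D) (hy : y ∉ D) :
    ‖g x‖ ≤ M * ‖y - x‖ := by
  have hM0 : 0 ≤ M := (norm_nonneg _).trans (hM x hx)
  let γ : ℝ → E := fun s => x + s • (y - x)
  have hγ : Continuous γ := by fun_prop
  have hK : IsCompact (Icc (0 : ℝ) 1 ∩ γ ⁻¹' Dᶜ) :=
    isCompact_Icc.inter_right (hD.isClosed_compl.preimage hγ)
  -- The first parameter at which the segment from x to y leaves D: g vanishes there, and before it
  -- the segment stays where the gradient bound holds.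
  obtain ⟨s₀, ⟨hs₀, hs₀D⟩, hmin⟩ := hK.exists_isLeast ⟨1, by simp, by simpa [γ] using hy⟩
  have hin : ∀ s ∈ Ico (0 : ℝ) s₀, γ s ∈ D := by
    intro s hs
    by_contra hns
    exact absurd (hmin ⟨⟨hs.1, hs.2.le.trans hs₀.2⟩, hns⟩) (not_le.2 hs.2)
  have key := norm_image_sub_le_of_norm_deriv_right_le_segment (f := g ∘ γ)
    (f' := fun s => fderiv ℝ g (γ s) (y - x)) (a := 0) (b := s₀) (C := M * ‖y - x‖)
    (hc.comp hγ).continuousOn ?_ ?_ s₀ ⟨hs₀.1, le_rfl⟩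
  · have h1 : g (γ s₀) = 0 := h0 _ hs₀D
    have h2 : γ 0 = x := by simp [γ]
    simp only [Function.comp_apply, h1, h2, zero_sub, norm_neg, sub_zero] at key
    refine key.trans ?_
    exact mul_le_of_le_one_right (by positivity) hs₀.2
  · intro s hs
    have h1 : HasFDerivAt g (fderiv ℝ g (γ s)) (γ s) :=
      (hd.differentiableAt (hD.mem_nhds (hin s hs))).hasFDerivAt
    have h2 : HasDerivAt γ (y - x) s := by
      simpa [γ] using ((hasDerivAt_id s).smul_const (y - x)).const_add x
    exact (h1.comp_hasDerivAt s h2).hasDerivWithinAt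
  · intro s hs
    exact (ContinuousLinearMap.le_opNorm _ _).trans
      (mul_le_mul_of_nonneg_right (hM _ (hin s hs)) (norm_nonneg _))

/-- A continuous function vanishing off an open set, with gradient bounded there, is Lipschitz. -/
lemma lipschitzWith_of_zero_off {g : E → F} {D : Set E} {M : NNReal} (hD : IsOpen D)
    (hc : Continuous g) (h0 : ∀ x, x ∉ D → g x = 0) (hd : DifferentiableOn ℝ g D)
    (hM : ∀ x ∈ D, ‖fderiv ℝ g x‖ ≤ M) : LipschitzWith M g := by
  refine LipschitzWith.of_dist_le_mul fun x y => ?_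
  rw [dist_eq_norm, dist_eq_norm]
  have hout := @norm_le_mul_norm_sub_of_zero_off E F _ _ _ _ g D M hD hc h0 hd hM
  by_cases hx : x ∈ D <;> by_cases hy : y ∈ D
  · by_cases hseg : segment ℝ x y ⊆ D
    · have := (convex_segment x y).norm_image_sub_le_of_norm_fderiv_le (𝕜 := ℝ) (f := g) (C := M)
        (fun z hz => hd.differentiableAt (hD.mem_nhds (hseg hz))) (fun z hz => hM z (hseg hz))
        (right_mem_segment ℝ x y) (left_mem_segment ℝ x y)
      exact this
    -- Both values are compared with g z = 0 at a point z of the segment; the two lengths add up to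
    -- the distance from x to y, so no constant is lost.
    · obtain ⟨z, hz, hzD⟩ := not_subset.1 hseg
      have h1 := hout hx hzD
      have h2 := hout hy hzD
      have h3 : ‖x - z‖ + ‖z - y‖ = ‖x - y‖ := by
        simpa [dist_eq_norm] using dist_add_dist_of_mem_segment hz
      rw [norm_sub_rev x z] at h3
      calc ‖g x - g y‖ ≤ ‖g x‖ + ‖g y‖ := norm_sub_le _ _
        _ ≤ M * ‖z - x‖ + M * ‖z - y‖ := add_le_add h1 h2
        _ = M * ‖x - y‖ := by rw [← h3]; ring
  · rw [h0 y hy, sub_zero, norm_sub_rev]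
    exact hout hx hy
  · rw [h0 x hx, zero_sub, norm_neg]
    exact hout hy hx
  · rw [h0 x hx, h0 y hy]; simp; positivity

end ZeroExtension

/-! ### Integration by parts without boundary regularity -/

section IntegrationByParts

variable {d : ℕ}

/-- The derivative of a Lipschitz function vanishes almost everywhere on a measurable set on which
the function is zero. -/
lemma ae_fderiv_eq_zero_of_zero_on {g : Vec d → ℝ} {C : NNReal} (hg : LipschitzWith C g)
    {s : Set (Vec d)} (hs : MeasurableSet s) (h0 : ∀ x ∈ s, g x = 0) :
    ∀ᵐ x ∂(volume.restrict s), fderiv ℝ g x = 0 := by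
  rcases subsingleton_or_nontrivial (Vec d) with hsub | hnt
  · exact Eventually.of_forall fun x => Subsingleton.elim _ _
  obtain ⟨e, he⟩ := exists_ne (0 : Vec d)
  set N : Set (Vec d) := {x | DifferentiableAt ℝ g x}
  have hN : MeasurableSet N := measurableSet_of_differentiableAt ℝ g
  have hNae : ∀ᵐ x ∂(volume : Measure (Vec d)), x ∈ N := hg.ae_differentiableAt
  -- The almost everywhere derivative estimate for approximately linear maps concerns maps of a
  -- space into itself, so g is multiplied by a fixed vector e ≠ 0. On `s ∩ N` the map G is zero,
  -- hence approximated by 0 with constant 0.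
  let G : Vec d → Vec d := fun x => g x • e
  have happ : ApproximatesLinearOn G (0 : Vec d →L[ℝ] Vec d) (s ∩ N) 0 := by
    intro x hx y hy
    simp [G, h0 x hx.1, h0 y hy.1]
  have key := happ.norm_fderiv_sub_le volume (hs.inter hN)
    (fun x => (fderiv ℝ g x).smulRight e)
    (fun x hx => (hx.2.hasFDerivAt.smul_const e).hasFDerivWithinAt)
  rw [ae_restrict_iff' (hs.inter hN)] at key
  rw [ae_restrict_iff' hs]
  filter_upwards [key, hNae] with x hx hxN hxs
  have h1 := hx ⟨hxs, hxN⟩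
  rw [sub_zero, nonpos_iff_eq_zero, nnnorm_eq_zero] at h1
  ext v
  have h2 := congrArg (fun A : Vec d →L[ℝ] Vec d => A v) h1
  simp only [ContinuousLinearMap.smulRight_apply, zero_apply,
    smul_eq_zero, he, or_false] at h2
  simpa using h2

/-- The zero extension is Lipschitz with compact support, so integrating by parts against the
constant 1 makes the integral over the whole space vanish. The gradient is zero almost everywhere
off D, even if ∂D has positive measure, so only the integral over D remains. -/
lemma setIntegral_fderiv_eq_zero {g : Vec d → ℝ} {D : Set (Vec d)} {M : ℝ} (hD : IsOpen D)
    (hDb : Bornology.IsBounded D) (hc : Continuous g) (h0 : ∀ x, x ∉ D → g x = 0)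
    (hd : DifferentiableOn ℝ g D) (hM : ∀ x ∈ D, ‖fderiv ℝ g x‖ ≤ M) (v : Vec d) :
    ∫ x in D, fderiv ℝ g x v = 0 := by
  have hlip : LipschitzWith (max M 0).toNNReal g :=
    lipschitzWith_of_zero_off hD hc h0 hd fun x hx => by
      rw [Real.coe_toNNReal _ (le_max_right _ _)]
      exact (hM x hx).trans (le_max_left _ _)
  have hcs : HasCompactSupport g := by
    refine HasCompactSupport.intro hDb.isCompact_closure fun x hx => h0 x fun hxD => hx ?_
    exact subset_closure hxD
  have h1 : ∫ x, lineDeriv ℝ g x v = 0 := by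
    have := LipschitzWith.integral_lineDeriv_mul_eq (μ := volume) (LipschitzWith.const' (1 : ℝ)
      : LipschitzWith 0 (fun _ : Vec d => (1 : ℝ))) hlip hcs (-v)
    simpa [lineDeriv] using this.symm
  have h2 : ∀ᵐ x : Vec d, lineDeriv ℝ g x v = D.indicator (fun x => fderiv ℝ g x v) x := by
    have h3 := ae_fderiv_eq_zero_of_zero_on hlip hD.measurableSet.compl (fun x hx => h0 x hx)
    rw [ae_restrict_iff' hD.measurableSet.compl] at h3
    filter_upwards [h3, hlip.ae_differentiableAt] with x hx hdx
    rw [hdx.lineDeriv_eq_fderiv]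
    by_cases hxD : x ∈ D
    · rw [indicator_of_mem hxD]
    · rw [indicator_of_notMem hxD, hx hxD]; rfl
  rw [integral_congr_ae h2, integral_indicator hD.measurableSet] at h1
  exact h1

/-- A function which is continuous and bounded on a bounded open set is integrable there. -/
lemma integrableOn_of_continuousOn_of_bound {F : Type*} [NormedAddCommGroup F]
    {D : Set (Vec d)} (hD : IsOpen D)
    (hDb : Bornology.IsBounded D) {g : Vec d → F} {M : ℝ} (hg : ContinuousOn g D)
    (hM : ∀ x ∈ D, ‖g x‖ ≤ M) : IntegrableOn g D := by
  refine IntegrableOn.of_bound hDb.measure_lt_top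
    (hg.aestronglyMeasurable hD.measurableSet) M ?_
  exact (ae_restrict_iff' hD.measurableSet).2 (Eventually.of_forall hM)

/-- Integration by parts on a bounded open set without any boundary regularity. -/
lemma setIntegral_fderiv_mul {φ σ : Vec d → ℝ} {D : Set (Vec d)} {M : ℝ} (hD : IsOpen D)
    (hDb : Bornology.IsBounded D) (hφc : Continuous φ) (hφ0 : ∀ x, x ∉ D → φ x = 0)
    (hφ : ContDiffOn ℝ 1 φ D) (hσ : ContDiffOn ℝ 1 σ D)
    (hφ' : ∀ x ∈ D, ‖fderiv ℝ φ x‖ ≤ M) (hσb : ∀ x ∈ D, ‖σ x‖ ≤ M)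
    (hσ' : ∀ x ∈ D, ‖fderiv ℝ σ x‖ ≤ M) (v : Vec d) :
    ∫ x in D, fderiv ℝ φ x v * σ x = - ∫ x in D, φ x * fderiv ℝ σ x v := by
  rcases D.eq_empty_or_nonempty with rfl | ⟨x₀, hx₀⟩
  · simp
  have hM0 : 0 ≤ M := (norm_nonneg _).trans (hσb x₀ hx₀)
  obtain ⟨B, hB⟩ : ∃ B, ∀ x ∈ D, ‖φ x‖ ≤ B := by
    obtain ⟨B, hB⟩ := (hDb.isCompact_closure.image hφc).isBounded.exists_norm_le
    exact ⟨B, fun x hx => hB _ ⟨x, subset_closure hx, rfl⟩⟩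
  have hB0 : 0 ≤ B := (norm_nonneg _).trans (hB x₀ hx₀)
  have hφd : ∀ x ∈ D, DifferentiableAt ℝ φ x := fun x hx =>
    (hφ.differentiableOn one_ne_zero).differentiableAt (hD.mem_nhds hx)
  have hσd : ∀ x ∈ D, DifferentiableAt ℝ σ x := fun x hx =>
    (hσ.differentiableOn one_ne_zero).differentiableAt (hD.mem_nhds hx)
  have hφ'c : ContinuousOn (fun x => fderiv ℝ φ x v) D :=
    (hφ.continuousOn_fderiv_of_isOpen hD le_rfl).clm_apply continuousOn_const
  have hσ'c : ContinuousOn (fun x => fderiv ℝ σ x v) D :=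
    (hσ.continuousOn_fderiv_of_isOpen hD le_rfl).clm_apply continuousOn_const
  have hfd : ∀ x ∈ D, fderiv ℝ (fun x => φ x * σ x) x
      = φ x • fderiv ℝ σ x + σ x • fderiv ℝ φ x := fun x hx =>
    fderiv_fun_mul (hφd x hx) (hσd x hx)
  have hzero := setIntegral_fderiv_eq_zero (g := fun x => φ x * σ x) (M := B * M + M * M) hD hDb
    ?_ ?_ ?_ ?_ v
  · have hsum : ∀ x ∈ D, fderiv ℝ (fun x => φ x * σ x) x v
        = fderiv ℝ φ x v * σ x + φ x * fderiv ℝ σ x v := by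
      intro x hx
      rw [hfd x hx]
      simp only [add_apply, smul_apply, smul_eq_mul]
      ring
    rw [setIntegral_congr_fun hD.measurableSet hsum, integral_add] at hzero
    · linarith
    · refine integrableOn_of_continuousOn_of_bound (M := (M * ‖v‖) * M) hD hDb
        (hφ'c.mul hσ.continuousOn) fun x hx => ?_
      rw [norm_mul]
      exact mul_le_mul (((fderiv ℝ φ x).le_opNorm v).trans
        (mul_le_mul_of_nonneg_right (hφ' x hx) (norm_nonneg _))) (hσb x hx) (norm_nonneg _)
        (by positivity)
    · refine integrableOn_of_continuousOn_of_bound (M := B * (M * ‖v‖)) hD hDb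
        (hφ.continuousOn.mul hσ'c) fun x hx => ?_
      rw [norm_mul]
      exact mul_le_mul (hB x hx) (((fderiv ℝ σ x).le_opNorm v).trans
        (mul_le_mul_of_nonneg_right (hσ' x hx) (norm_nonneg _))) (norm_nonneg _) hB0
  -- Nothing is known of σ outside D. At a point outside D continuity of φσ comes from |φσ| ≤ M|φ|,
  -- which holds everywhere because φ vanishes off D.
  · rw [continuous_iff_continuousAt]
    intro x
    by_cases hx : x ∈ D
    · exact hφc.continuousAt.mul (hσd x hx).continuousAt
    · have hbd : ∀ y, ‖φ y * σ y‖ ≤ ‖φ y‖ * M := by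
        intro y
        by_cases hy : y ∈ D
        · rw [norm_mul]; exact mul_le_mul_of_nonneg_left (hσb y hy) (norm_nonneg _)
        · simp [hφ0 y hy]
      have hlim : Tendsto (fun y => ‖φ y‖ * M) (𝓝 x) (𝓝 0) := by
        have := (hφc.norm.tendsto x).mul_const M
        simpa [hφ0 x hx] using this
      unfold ContinuousAt
      simp only [hφ0 x hx, zero_mul]
      exact squeeze_zero_norm hbd hlim
  · intro x hx; simp [hφ0 x hx]
  · intro x hx
    exact ((hφd x hx).mul (hσd x hx)).differentiableWithinAt
  · intro x hx
    rw [hfd x hx]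
    refine (norm_add_le _ _).trans (add_le_add ?_ ?_) <;> rw [norm_smul]
    · exact mul_le_mul (hB x hx) (hσ' x hx) (norm_nonneg _) hB0
    · exact mul_le_mul (hσb x hx) (hφ' x hx) (norm_nonneg _) hM0

end IntegrationByParts

end Peridynamics

namespace Peridynamics

/-! ### The potential at the origin -/

section Potential

variable {f : ℝ → ℝ}

lemma IsPotential.apply_zero (hf : IsPotential f) : f 0 = 0 := by
  have h1 : Tendsto f (𝓝[>] 0) (𝓝 (f 0)) :=
    (hf.smooth.continuousOn 0 self_mem_Ici).mono_left (nhdsWithin_mono _ Ioi_subset_Ici_self)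
  have h2 : Tendsto (fun r => f r / r * r) (𝓝[>] 0) (𝓝 (halfLineDeriv f 0 * 0)) :=
    hf.slope_zero.mul (tendsto_id.mono_left nhdsWithin_le_nhds)
  rw [mul_zero] at h2
  refine tendsto_nhds_unique h1 (h2.congr' ?_)
  filter_upwards [self_mem_nhdsWithin] with r hr
  exact div_mul_cancel₀ _ (ne_of_gt hr)

/-- Concavity and f(0) = 0 give f(r)/r ≥ f(1) > 0 for 0 < r ≤ 1. -/
lemma IsPotential.halfLineDeriv_zero_pos (hf : IsPotential f) : 0 < halfLineDeriv f 0 := by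
  refine (hf.pos 1 one_pos).trans_le (ge_of_tendsto hf.slope_zero ?_)
  filter_upwards [Ioc_mem_nhdsGT (zero_lt_one' ℝ)] with r hr
  have h := hf.concave.2 (show (0 : ℝ) ∈ Ici 0 from self_mem_Ici)
    (show (1 : ℝ) ∈ Ici 0 from zero_le_one (α := ℝ)) (sub_nonneg.2 hr.2) hr.1.le (sub_add_cancel 1 r)
  simp only [hf.apply_zero, smul_eq_mul, mul_zero, mul_one, zero_add] at h
  rw [le_div_iff₀ hr.1]
  linarith

end Potential

/-! ### Isotropy of the elasticity tensor -/

section Isotropy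

variable {d : ℕ}

lemma measurable_unitDir : Measurable (unitDir : Vec d → Vec d) := by
  unfold unitDir
  fun_prop

lemma norm_unitDir_le (ξ : Vec d) : ‖unitDir ξ‖ ≤ 1 := by
  unfold unitDir
  rw [norm_smul, norm_inv, norm_norm]
  exact inv_mul_le_one

lemma norm_unitDir {ξ : Vec d} (h : ξ ≠ 0) : ‖unitDir ξ‖ = 1 := by
  unfold unitDir
  rw [norm_smul, norm_inv, norm_norm, inv_mul_cancel₀ (norm_ne_zero_iff.2 h)]

lemma unitDir_neg (ξ : Vec d) : unitDir (-ξ) = - unitDir ξ := by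
  simp [unitDir]

lemma unitDir_smul {r : ℝ} (hr : 0 < r) (ξ : Vec d) : unitDir (r • ξ) = unitDir ξ := by
  simp only [unitDir, norm_smul, Real.norm_eq_abs, abs_of_pos hr, smul_smul]
  congr 1
  field_simp

lemma norm_smul_unitDir (ξ : Vec d) : ‖ξ‖ • unitDir ξ = ξ := by
  by_cases h : ξ = 0
  · simp [h]
  · rw [unitDir, smul_smul, mul_inv_cancel₀ (norm_ne_zero_iff.2 h), one_smul]

lemma abs_inner_unitDir_le (ξ v : Vec d) : |inner ℝ (unitDir ξ) v| ≤ ‖v‖ :=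
  (abs_real_inner_le_norm _ _).trans
    (mul_le_of_le_one_left (norm_nonneg _) (norm_unitDir_le ξ))

/-- The quartic moment `∫ J(|ξ|) |ξ| (e_ξ · v)⁴ dξ` over the unit ball. -/
noncomputable def quarticMoment (J : ℝ → ℝ) (v : Vec d) : ℝ :=
  ∫ ξ in Metric.ball (0 : Vec d) 1, J ‖ξ‖ * inner ℝ (unitDir ξ) v ^ 4 * ‖ξ‖

variable {J : ℝ → ℝ}

lemma IsInfluence.exists_bound (hJ : IsInfluence J) :
    ∃ M : ℝ, 0 ≤ M ∧ ∀ r, 0 ≤ r → 0 ≤ J r ∧ J r ≤ M := by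
  obtain ⟨M, hM⟩ := hJ.bounded
  refine ⟨max M 0, le_max_right _ _, fun r hr => ?_⟩
  rcases le_or_gt r 1 with h | h
  · exact ⟨(hM r ⟨hr, h⟩).1, (hM r ⟨hr, h⟩).2.trans (le_max_left _ _)⟩
  · rw [hJ.zero_outside r h]; exact ⟨le_rfl, le_max_right _ _⟩

lemma integrableOn_quarticMoment (hJ : IsInfluence J) (v : Vec d) :
    IntegrableOn (fun ξ : Vec d => J ‖ξ‖ * inner ℝ (unitDir ξ) v ^ 4 * ‖ξ‖)
      (Metric.ball 0 1) := by
  obtain ⟨M, hM0, hM⟩ := hJ.exists_bound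
  refine IntegrableOn.of_bound (C := M * ‖v‖ ^ 4 * 1) measure_ball_lt_top ?_ ?_
  · have hJm := hJ.measurable
    have hu : Measurable (unitDir : Vec d → Vec d) := measurable_unitDir
    exact (((hJm.comp measurable_norm).mul ((hu.inner measurable_const).pow_const 4)).mul
      measurable_norm).aestronglyMeasurable
  · refine (ae_restrict_iff' measurableSet_ball).2 (Eventually.of_forall fun ξ hξ => ?_)
    rw [norm_mul, norm_mul, norm_pow, norm_norm, Real.norm_eq_abs, Real.norm_eq_abs,
      abs_of_nonneg (hM _ (norm_nonneg _)).1]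
    have h1 := abs_inner_unitDir_le ξ v
    have h2 := (hM ‖ξ‖ (norm_nonneg _)).2
    have h3 : ‖ξ‖ ≤ 1 := (mem_ball_zero_iff.1 hξ).le
    gcongr

lemma quarticMoment_isometry (J : ℝ → ℝ) (R : Vec d ≃ₗᵢ[ℝ] Vec d) (v : Vec d) :
    quarticMoment J (R v) = quarticMoment J v := by
  unfold quarticMoment
  have hmp := R.measurePreserving
  have hemb : MeasurableEmbedding R := R.toHomeomorph.measurableEmbedding
  have h := hmp.setIntegral_preimage_emb hemb
    (fun ξ : Vec d => J ‖ξ‖ * inner ℝ (unitDir ξ) (R v) ^ 4 * ‖ξ‖) (Metric.ball 0 1)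
  rw [← h]
  have hpre : R ⁻¹' Metric.ball 0 1 = Metric.ball 0 1 := by
    ext ξ; simp
  rw [hpre]
  refine integral_congr_ae (Eventually.of_forall fun ξ => ?_)
  have : unitDir (R ξ) = R (unitDir ξ) := by simp [unitDir]
  simp [this]

/-- The moment is invariant under isometries, as J(|ξ|)|ξ| is radial, and homogeneous of degree
four. The reflection exchanging the equally long vectors ‖v‖e and v reduces v to ‖v‖e. -/
lemma quarticMoment_eq (J : ℝ → ℝ) {e : Vec d} (he : ‖e‖ = 1) (v : Vec d) :
    quarticMoment J v = quarticMoment J e * ‖v‖ ^ 4 := by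
  have hn : ‖‖v‖ • e‖ = ‖v‖ := by rw [norm_smul, he, norm_norm, mul_one]
  have h1 := quarticMoment_isometry J (Submodule.reflection (Submodule.span ℝ {‖v‖ • e - v})ᗮ)
    (‖v‖ • e)
  rw [Submodule.reflection_sub hn] at h1
  rw [h1]
  unfold quarticMoment
  rw [← integral_mul_const]
  refine integral_congr_ae (Eventually.of_forall fun ξ => ?_)
  simp only [inner_smul_right]
  ring

/-- Polarization: the sum over signs of s t r (A + sB + tC + rG)⁴ is 8 · 4! · ABCG = 192 ABCG. The
quartic moments are a multiple of ‖·‖⁴, and polarizing ‖·‖⁴ in the same way leaves 64 times the sum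
of the three pairings, whence the factor 1/3. -/
lemma integral_moment_eq (hJ : IsInfluence J) {e : Vec d} (he : ‖e‖ = 1) (a b c g : Vec d) :
    ∫ ξ in Metric.ball (0 : Vec d) 1, J ‖ξ‖ * (inner ℝ (unitDir ξ) a * inner ℝ (unitDir ξ) b *
        inner ℝ (unitDir ξ) c * inner ℝ (unitDir ξ) g) * ‖ξ‖
      = quarticMoment J e / 3 * (inner ℝ a b * inner ℝ c g + inner ℝ a c * inner ℝ b g
        + inner ℝ a g * inner ℝ b c) := by
  have hI := fun v : Vec d => integrableOn_quarticMoment hJ v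
  let p : ℝ → ℝ → ℝ → Vec d := fun s t r => a + s • b + t • c + r • g
  have key : ∫ ξ in Metric.ball (0 : Vec d) 1, J ‖ξ‖ * (inner ℝ (unitDir ξ) a *
      inner ℝ (unitDir ξ) b * inner ℝ (unitDir ξ) c * inner ℝ (unitDir ξ) g) * ‖ξ‖
      = (quarticMoment J (p 1 1 1) - quarticMoment J (p 1 1 (-1))
        - quarticMoment J (p 1 (-1) 1) + quarticMoment J (p 1 (-1) (-1))
        - quarticMoment J (p (-1) 1 1) + quarticMoment J (p (-1) 1 (-1))
        + quarticMoment J (p (-1) (-1) 1) - quarticMoment J (p (-1) (-1) (-1))) / 192 := by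
    unfold quarticMoment
    rw [← integral_sub' (hI _) (hI _), ← integral_sub' ((hI _).sub (hI _)) (hI _),
      ← integral_add' (((hI _).sub (hI _)).sub (hI _)) (hI _),
      ← integral_sub' ((((hI _).sub (hI _)).sub (hI _)).add (hI _)) (hI _),
      ← integral_add' (((((hI _).sub (hI _)).sub (hI _)).add (hI _)).sub (hI _)) (hI _),
      ← integral_add' ((((((hI _).sub (hI _)).sub (hI _)).add (hI _)).sub (hI _)).add (hI _))
        (hI _),
      ← integral_sub' (((((((hI _).sub (hI _)).sub (hI _)).add (hI _)).sub (hI _)).add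
        (hI _)).add (hI _)) (hI _), ← integral_div]
    refine integral_congr_ae (Eventually.of_forall fun ξ => ?_)
    simp only [Pi.add_apply, Pi.sub_apply, p, inner_add_right, inner_smul_right]
    ring
  have h4 : ∀ s t r : ℝ, ‖p s t r‖ ^ 4 = (‖a‖ ^ 2 + s ^ 2 * ‖b‖ ^ 2 + t ^ 2 * ‖c‖ ^ 2
      + r ^ 2 * ‖g‖ ^ 2 + 2 * (s * inner ℝ a b + t * inner ℝ a c + r * inner ℝ a g
      + s * t * inner ℝ b c + s * r * inner ℝ b g + t * r * inner ℝ c g)) ^ 2 := by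
    intro s t r
    have h2 : ‖p s t r‖ ^ 2 = ‖a‖ ^ 2 + s ^ 2 * ‖b‖ ^ 2 + t ^ 2 * ‖c‖ ^ 2
      + r ^ 2 * ‖g‖ ^ 2 + 2 * (s * inner ℝ a b + t * inner ℝ a c + r * inner ℝ a g
      + s * t * inner ℝ b c + s * r * inner ℝ b g + t * r * inner ℝ c g) := by
      simp only [p, norm_add_sq_real, inner_add_left, inner_smul_left, inner_smul_right, norm_smul,
        conj_trivial, mul_pow, Real.norm_eq_abs, sq_abs]
      ring
    rw [← h2]; ring
  rw [key]
  have hq : ∀ s t r : ℝ, quarticMoment J (p s t r) = quarticMoment J e * ‖p s t r‖ ^ 4 :=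
    fun s t r => quarticMoment_eq J he _
  rw [hq, hq, hq, hq, hq, hq, hq, hq]
  simp only [h4]
  ring

/-- The elasticity tensor is isotropic with both Lamé constants equal to some `β ≥ 0`, and `β`
vanishes only if the influence function does. -/
lemma exists_elasticTensor_eq (hd : 0 < d) {f : ℝ → ℝ} (hf : IsPotential f)
    (hJ : IsInfluence J) :
    ∃ β : ℝ, 0 ≤ β ∧
      (∀ i j k l : Fin d, elasticTensor d f J i j k l =
        β * ((if i = j then 1 else 0) * (if k = l then 1 else 0)
          + (if i = k then 1 else 0) * (if j = l then 1 else 0)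
          + (if i = l then 1 else 0) * (if j = k then 1 else 0))) ∧
      (β = 0 → ∀ᵐ ξ : Vec d ∂(volume.restrict (Metric.ball 0 1)), J ‖ξ‖ = 0) := by
  have hω : 0 < unitBallVolume d :=
    ENNReal.toReal_pos (Metric.measure_ball_pos volume _ one_pos).ne' measure_ball_lt_top.ne
  have hf0 := hf.halfLineDeriv_zero_pos
  have hbasis : ∀ i : Fin d, ‖(EuclideanSpace.single i (1 : ℝ) : Vec d)‖ = 1 := fun i => by simp
  obtain ⟨M, -, hM⟩ := hJ.exists_bound
  have hnn : ∀ (v ξ : Vec d), 0 ≤ J ‖ξ‖ * inner ℝ (unitDir ξ) v ^ 4 * ‖ξ‖ := fun v ξ =>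
    mul_nonneg (mul_nonneg (hM _ (norm_nonneg _)).1 (by positivity)) (norm_nonneg _)
  set κ := quarticMoment J (EuclideanSpace.single (⟨0, hd⟩ : Fin d) (1 : ℝ) : Vec d) with hκ
  have hκ0 : 0 ≤ κ := integral_nonneg (hnn _)
  refine ⟨2 * halfLineDeriv f 0 / unitBallVolume d * (κ / 3), by positivity, ?_, ?_⟩
  · intro i j k l
    have h := integral_moment_eq hJ (hbasis ⟨0, hd⟩) (EuclideanSpace.single i 1)
      (EuclideanSpace.single j 1) (EuclideanSpace.single k 1) (EuclideanSpace.single l 1)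
    have hs : ∀ i j : Fin d, inner ℝ (EuclideanSpace.single i (1 : ℝ) : Vec d)
        (EuclideanSpace.single j 1) = if i = j then 1 else 0 := fun i j => by
      rw [EuclideanSpace.inner_single_left]; simp [PiLp.single_apply]
    have hu : ∀ (ξ : Vec d) (i : Fin d),
        inner ℝ (unitDir ξ) (EuclideanSpace.single i 1) = unitDir ξ i := fun ξ i => by
      simp [EuclideanSpace.inner_single_right]
    simp only [hs, hu] at h
    rw [elasticTensor, h, mul_assoc]
  -- Since f'(0) > 0, β = 0 forces κ = 0, hence all moments along the coordinate axes vanish. Their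
  -- integrands are nonnegative, so almost everywhere J(|ξ|) times each coordinate of the direction
  -- is zero, and a unit vector has a nonzero coordinate.
  · intro h0
    have hκz : κ = 0 := by
      have : 2 * halfLineDeriv f 0 / unitBallVolume d ≠ 0 := by positivity
      rcases mul_eq_zero.1 h0 with h | h
      · exact absurd h this
      · linarith
    have hall : ∀ i : Fin d, ∀ᵐ ξ : Vec d ∂(volume.restrict (Metric.ball 0 1)),
        J ‖ξ‖ * inner ℝ (unitDir ξ) (EuclideanSpace.single i (1 : ℝ) : Vec d) ^ 4 * ‖ξ‖ = 0 := by
      intro i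
      have h1 := quarticMoment_eq J (hbasis ⟨0, hd⟩) (EuclideanSpace.single i (1 : ℝ) : Vec d)
      rw [← hκ, hκz, zero_mul, quarticMoment, integral_eq_zero_iff_of_nonneg (hnn _)
        (integrableOn_quarticMoment hJ _)] at h1
      exact h1
    have : Nonempty (Fin d) := ⟨⟨0, hd⟩⟩
    have hne : ∀ᵐ ξ : Vec d ∂(volume.restrict (Metric.ball 0 1)), ξ ≠ 0 :=
      ae_restrict_of_ae (by simp [ae_iff])
    filter_upwards [ae_all_iff.2 hall, hne] with ξ hξ hξ0
    by_contra hJξ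
    have hz : unitDir ξ = 0 := by
      ext i
      have := hξ i
      simp only [mul_eq_zero, hJξ, norm_eq_zero, hξ0, or_false, false_or] at this
      simpa [EuclideanSpace.inner_single_right] using this
    have := norm_unitDir hξ0
    rw [hz, norm_zero] at this
    exact zero_ne_one this

end Isotropy

end Peridynamics

/-! ### Elastic force and energy density in components -/

namespace Peridynamics

variable {d : ℕ}

/-- The `k`-th component of `∂_a ∂_b v`. -/
noncomputable def secondPartial (a b : Fin d) (v : Vec d → Vec d) (x : Vec d) (k : Fin d) : ℝ :=
  fderiv ℝ (fderiv ℝ v) x (EuclideanSpace.single a 1) (EuclideanSpace.single b 1) k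

lemma norm_apply_le (v : Vec d) (i : Fin d) : |v i| ≤ ‖v‖ := by
  simpa using PiLp.norm_apply_le v i

lemma abs_partialDeriv_le (v : Vec d → Vec d) (x : Vec d) (i j : Fin d) :
    |partialDeriv j v x i| ≤ ‖fderiv ℝ v x‖ := by
  refine (norm_apply_le _ _).trans ((ContinuousLinearMap.le_opNorm _ _).trans ?_)
  simp

lemma abs_secondPartial_le (v : Vec d → Vec d) (x : Vec d) (a b k : Fin d) :
    |secondPartial a b v x k| ≤ ‖fderiv ℝ (fderiv ℝ v) x‖ := by
  refine (norm_apply_le _ _).trans ((ContinuousLinearMap.le_opNorm _ _).trans ?_)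
  have := (fderiv ℝ (fderiv ℝ v) x).le_opNorm (EuclideanSpace.single a 1)
  simpa using this

section Pointwise

variable {v : Vec d → Vec d} {x : Vec d}

lemma secondPartial_comm (hv : ContDiffAt ℝ 2 v x) (a b k : Fin d) :
    secondPartial a b v x k = secondPartial b a v x k := by
  have h := hv.isSymmSndFDerivAt (by simp)
  unfold secondPartial
  rw [h]

lemma ContDiffAt.differentiableAt_fderiv (hv : ContDiffAt ℝ 2 v x) :
    DifferentiableAt ℝ (fderiv ℝ v) x :=
  (hv.fderiv_right (m := 1) (by norm_num)).differentiableAt one_ne_zero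

lemma hasFDerivAt_partialDeriv (hv : ContDiffAt ℝ 2 v x) (l k : Fin d) :
    HasFDerivAt (fun z => partialDeriv l v z k)
      ((EuclideanSpace.proj k : Vec d →L[ℝ] ℝ).comp
        ((fderiv ℝ (fderiv ℝ v) x).flip (EuclideanSpace.single l 1))) x := by
  have h1 := (ContDiffAt.differentiableAt_fderiv hv).hasFDerivAt
  have h2 : HasFDerivAt (fun z => fderiv ℝ v z (EuclideanSpace.single l 1))
      ((fderiv ℝ (fderiv ℝ v) x).flip (EuclideanSpace.single l 1)) x := by
    have := h1.clm_apply (hasFDerivAt_const (EuclideanSpace.single l (1 : ℝ) : Vec d) x)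
    simpa using this
  exact (EuclideanSpace.proj k : Vec d →L[ℝ] ℝ).hasFDerivAt.comp x h2

lemma hasFDerivAt_strain (hv : ContDiffAt ℝ 2 v x) (k l : Fin d) :
    HasFDerivAt (fun z => strain v z k l)
      ((2 : ℝ)⁻¹ • ((EuclideanSpace.proj k : Vec d →L[ℝ] ℝ).comp
        ((fderiv ℝ (fderiv ℝ v) x).flip (EuclideanSpace.single l 1)) +
        (EuclideanSpace.proj l : Vec d →L[ℝ] ℝ).comp
        ((fderiv ℝ (fderiv ℝ v) x).flip (EuclideanSpace.single k 1)))) x := by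
  have := ((hasFDerivAt_partialDeriv hv l k).add (hasFDerivAt_partialDeriv hv k l)).const_mul
    (2 : ℝ)⁻¹
  refine this.congr_of_eventuallyEq (Eventually.of_forall fun z => ?_)
  simp only [strain, Pi.add_apply]
  ring

lemma elasticTensor_symm (f J : ℝ → ℝ) (i j k l : Fin d) :
    elasticTensor d f J i j k l = elasticTensor d f J i j l k := by
  unfold elasticTensor
  congr 1
  refine integral_congr_ae (Eventually.of_forall fun ξ => ?_)
  ring

/-- Symmetry of the tensor in its last two indices merges the two halves of the symmetrized
gradient. -/
lemma elasticForce_apply (f J : ℝ → ℝ) (hv : ContDiffAt ℝ 2 v x) (i : Fin d) :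
    elasticForce f J v x i =
      ∑ j, ∑ k, ∑ l, elasticTensor d f J i j k l * secondPartial j l v x k := by
  simp only [elasticForce]
  refine Finset.sum_congr rfl fun j _ => ?_
  have h : HasFDerivAt (fun z => stress f J v z i j)
      (∑ k, ∑ l, elasticTensor d f J i j k l •
        ((2 : ℝ)⁻¹ • ((EuclideanSpace.proj k : Vec d →L[ℝ] ℝ).comp
        ((fderiv ℝ (fderiv ℝ v) x).flip (EuclideanSpace.single l 1)) +
        (EuclideanSpace.proj l : Vec d →L[ℝ] ℝ).comp
        ((fderiv ℝ (fderiv ℝ v) x).flip (EuclideanSpace.single k 1))))) x := by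
    unfold stress
    exact HasFDerivAt.fun_sum fun k _ => HasFDerivAt.fun_sum fun l _ =>
      (hasFDerivAt_strain hv k l).const_mul _
  rw [partialDeriv, h.fderiv]
  simp only [sum_apply, smul_apply, add_apply, ContinuousLinearMap.comp_apply,
    ContinuousLinearMap.flip_apply, smul_eq_mul]
  change ∑ k, ∑ l, elasticTensor d f J i j k l *
    (2⁻¹ * (secondPartial j l v x k + secondPartial j k v x l)) = _
  have h1 : ∀ k l, elasticTensor d f J i j k l *
      (2⁻¹ * (secondPartial j l v x k + secondPartial j k v x l)) =
      2⁻¹ * (elasticTensor d f J i j k l * secondPartial j l v x k)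
      + 2⁻¹ * (elasticTensor d f J i j l k * secondPartial j k v x l) := by
    intro k l
    rw [elasticTensor_symm f J i j l k]
    ring
  simp only [h1, Finset.sum_add_distrib]
  rw [Finset.sum_comm (f := fun k l => 2⁻¹ * (elasticTensor d f J i j l k *
    secondPartial j k v x l))]
  simp only [← Finset.mul_sum]
  ring

/-- The isotropic elasticity tensor with both Lamé constants equal to `β`. -/
def IsIsotropic (d : ℕ) (f J : ℝ → ℝ) (β : ℝ) : Prop :=
  ∀ i j k l : Fin d, elasticTensor d f J i j k l =
        β * ((if i = j then 1 else 0) * (if k = l then 1 else 0)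
          + (if i = k then 1 else 0) * (if j = l then 1 else 0)
          + (if i = l then 1 else 0) * (if j = k then 1 else 0))

variable {f J : ℝ → ℝ} {β : ℝ}

lemma IsIsotropic.elasticForce_apply (hC : IsIsotropic d f J β) (hv : ContDiffAt ℝ 2 v x)
    (i : Fin d) :
    elasticForce f J v x i = β * ∑ j, (secondPartial i j v x j + secondPartial j j v x i
      + secondPartial j i v x j) := by
  rw [Peridynamics.elasticForce_apply f J hv i]
  simp only [hC i, mul_assoc, ← Finset.mul_sum]
  congr 1
  simp only [add_mul, Finset.sum_add_distrib, ite_mul, one_mul, zero_mul,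
    Finset.sum_ite_eq, Finset.mem_univ, if_true, Finset.sum_ite_irrel,
    Finset.sum_const_zero]

/-- The polarized elastic energy density, up to the factor `β`. -/
noncomputable def pairing (v w : Vec d → Vec d) (x : Vec d) : ℝ :=
  ∑ i, ∑ j, (partialDeriv j w x j * partialDeriv i v x i
    + partialDeriv j w x i * partialDeriv j v x i + partialDeriv j w x i * partialDeriv i v x j)

lemma IsIsotropic.elasticDensity_eq (hC : IsIsotropic d f J β) (v : Vec d → Vec d) (x : Vec d) :
    elasticDensity f J v x = β * pairing v v x := by
  have hs : ∀ i j, stress f J v x i j =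
      β * ((if i = j then ∑ k, strain v x k k else 0) + strain v x i j + strain v x j i) := by
    intro i j
    simp only [stress, hC i j, mul_assoc, ← Finset.mul_sum]
    congr 1
    simp only [add_mul, Finset.sum_add_distrib, ite_mul, one_mul, zero_mul,
      Finset.sum_ite_eq, Finset.mem_univ, if_true, Finset.sum_ite_irrel, Finset.sum_const_zero]
  simp only [elasticDensity, hs, pairing]
  have h2 : ∀ i j, strain v x i j * (β * ((if i = j then ∑ k, strain v x k k else 0)
      + strain v x i j + strain v x j i)) = β * ((if i = j then strain v x i j *
        ∑ k, strain v x k k else 0) + ((2 : ℝ)⁻¹ * (partialDeriv j v x i * partialDeriv j v x i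
          + partialDeriv j v x i * partialDeriv i v x j)
          + 2⁻¹ * (partialDeriv i v x j * partialDeriv i v x j
          + partialDeriv i v x j * partialDeriv j v x i))) := by
    intro i j
    by_cases hij : i = j
    · subst hij; simp only [if_true, strain]; ring
    · simp only [hij, if_false, strain]; ring
  simp only [h2, ← Finset.mul_sum]
  congr 1
  simp only [Finset.sum_add_distrib, Finset.sum_ite_eq, Finset.mem_univ, if_true,
    ← Finset.mul_sum]
  rw [Finset.sum_comm (f := fun i j => partialDeriv i v x j * partialDeriv i v x j),
    Finset.sum_comm (f := fun i j => partialDeriv i v x j * partialDeriv j v x i)]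
  have h3 : ∑ i, strain v x i i * ∑ k, strain v x k k =
      ∑ i, ∑ j, partialDeriv j v x j * partialDeriv i v x i := by
    refine Finset.sum_congr rfl fun i _ => ?_
    rw [Finset.mul_sum]
    refine Finset.sum_congr rfl fun j _ => ?_
    simp only [strain]; ring
  rw [h3]
  ring

lemma pairing_comm (v w : Vec d → Vec d) (x : Vec d) : pairing v w x = pairing w v x := by
  unfold pairing
  simp only [Finset.sum_add_distrib]
  congr 1
  · congr 1
    · rw [Finset.sum_comm]
      exact Finset.sum_congr rfl fun i _ => Finset.sum_congr rfl fun j _ => mul_comm _ _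
    · exact Finset.sum_congr rfl fun i _ => Finset.sum_congr rfl fun j _ => mul_comm _ _
  · rw [Finset.sum_comm]
    exact Finset.sum_congr rfl fun i _ => Finset.sum_congr rfl fun j _ => mul_comm _ _

/-- It is the square of the divergence plus half the squared norm of ∇v + ∇vᵀ. -/
lemma pairing_self_nonneg (v : Vec d → Vec d) (x : Vec d) : 0 ≤ pairing v v x := by
  have h : pairing v v x = (∑ i, partialDeriv i v x i) ^ 2 + 2⁻¹ *
      ∑ i, ∑ j, (partialDeriv j v x i + partialDeriv i v x j) ^ 2 := by
    have h1 : ∀ i j, (partialDeriv j v x i + partialDeriv i v x j) ^ 2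
        = (partialDeriv j v x i * partialDeriv j v x i
          + partialDeriv i v x j * partialDeriv i v x j)
          + 2 * (partialDeriv j v x i * partialDeriv i v x j) := fun i j => by ring
    simp only [h1, pairing, Finset.sum_add_distrib, ← Finset.mul_sum]
    rw [Finset.sum_comm (f := fun i j => partialDeriv i v x j * partialDeriv i v x j), sq,
      Finset.sum_mul_sum]
    have h2 : ∑ i, ∑ j, partialDeriv j v x j * partialDeriv i v x i =
        ∑ i, ∑ j, partialDeriv i v x i * partialDeriv j v x j :=
      Finset.sum_congr rfl fun i _ => Finset.sum_congr rfl fun j _ => mul_comm _ _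
    rw [h2]
    simp only [← Finset.mul_sum]
    ring
  rw [h]
  positivity

end Pointwise

/-! ### Green's formula and Korn's inequality -/

section Dirichlet

/-- A field on a bounded open set which is `C²` with bounded derivatives and whose extension by
zero is continuous. -/
structure DirichletField (D : Set (Vec d)) (v : Vec d → Vec d) : Prop where
  continuous : Continuous v
  zero_off : ∀ x, x ∉ D → v x = 0
  contDiffOn : ContDiffOn ℝ 2 v D
  bound : ∃ M, ∀ x ∈ D, ‖fderiv ℝ v x‖ ≤ M ∧ ‖fderiv ℝ (fderiv ℝ v) x‖ ≤ M

variable {D : Set (Vec d)} {v w : Vec d → Vec d}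

lemma DirichletField.contDiffAt (hv : DirichletField D v) (hD : IsOpen D) {x : Vec d}
    (hx : x ∈ D) : ContDiffAt ℝ 2 v x :=
  hv.contDiffOn.contDiffAt (hD.mem_nhds hx)

lemma continuousOn_fderiv_fderiv (hD : IsOpen D) (hv : ContDiffOn ℝ 2 v D) :
    ContinuousOn (fderiv ℝ (fderiv ℝ v)) D :=
  (hv.fderiv_of_isOpen hD (m := 1) (by norm_num)).continuousOn_fderiv_of_isOpen hD le_rfl

lemma continuousOn_partialDeriv (hD : IsOpen D) (hv : ContDiffOn ℝ 2 v D) (j i : Fin d) :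
    ContinuousOn (fun x => partialDeriv j v x i) D := by
  have h := (hv.continuousOn_fderiv_of_isOpen hD (by norm_num)).clm_apply
    (continuousOn_const (c := (EuclideanSpace.single j (1 : ℝ) : Vec d)))
  exact (EuclideanSpace.proj i : Vec d →L[ℝ] ℝ).continuous.comp_continuousOn h

lemma continuousOn_secondPartial (hD : IsOpen D) (hv : ContDiffOn ℝ 2 v D) (a b k : Fin d) :
    ContinuousOn (fun x => secondPartial a b v x k) D := by
  have h := ((continuousOn_fderiv_fderiv hD hv).clm_apply
    (continuousOn_const (c := (EuclideanSpace.single a (1 : ℝ) : Vec d)))).clm_apply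
    (continuousOn_const (c := (EuclideanSpace.single b (1 : ℝ) : Vec d)))
  exact (EuclideanSpace.proj k : Vec d →L[ℝ] ℝ).continuous.comp_continuousOn h

lemma DirichletField.exists_bound (hv : DirichletField D v) (hDb : Bornology.IsBounded D) :
    ∃ M, 0 ≤ M ∧ ∀ x ∈ D, ‖v x‖ ≤ M ∧ ‖fderiv ℝ v x‖ ≤ M ∧ ‖fderiv ℝ (fderiv ℝ v) x‖ ≤ M := by
  obtain ⟨M, hM⟩ := hv.bound
  obtain ⟨B, hB⟩ := (hDb.isCompact_closure.image hv.continuous).isBounded.exists_norm_le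
  refine ⟨max (max M B) 0, le_max_right _ _, fun x hx => ⟨?_, ?_, ?_⟩⟩
  · exact (hB _ ⟨x, subset_closure hx, rfl⟩).trans ((le_max_right _ _).trans (le_max_left _ _))
  · exact (hM x hx).1.trans ((le_max_left _ _).trans (le_max_left _ _))
  · exact (hM x hx).2.trans ((le_max_left _ _).trans (le_max_left _ _))

lemma integrableOn_partialDeriv_mul (hD : IsOpen D) (hDb : Bornology.IsBounded D)
    (hv : DirichletField D v) (hw : DirichletField D w) (a b k l : Fin d) :
    IntegrableOn (fun x => partialDeriv a w x k * partialDeriv b v x l) D := by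
  obtain ⟨M, hM0, hM⟩ := hv.exists_bound hDb
  obtain ⟨N, hN0, hN⟩ := hw.exists_bound hDb
  refine integrableOn_of_continuousOn_of_bound (M := N * M) hD hDb
    ((continuousOn_partialDeriv hD hw.contDiffOn a k).mul
      (continuousOn_partialDeriv hD hv.contDiffOn b l)) fun x hx => ?_
  rw [norm_mul]
  exact mul_le_mul ((abs_partialDeriv_le w x k a).trans (hN x hx).2.1)
    ((abs_partialDeriv_le v x l b).trans (hM x hx).2.1) (norm_nonneg _) hN0

lemma integrableOn_mul_secondPartial (hD : IsOpen D) (hDb : Bornology.IsBounded D)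
    (hv : DirichletField D v) (hw : DirichletField D w) (a b k l : Fin d) :
    IntegrableOn (fun x => w x k * secondPartial a b v x l) D := by
  obtain ⟨M, hM0, hM⟩ := hv.exists_bound hDb
  obtain ⟨N, hN0, hN⟩ := hw.exists_bound hDb
  refine integrableOn_of_continuousOn_of_bound (M := N * M) hD hDb
    (((EuclideanSpace.proj k : Vec d →L[ℝ] ℝ).continuous.comp hw.continuous).continuousOn.mul
      (continuousOn_secondPartial hD hv.contDiffOn a b l)) fun x hx => ?_
  rw [norm_mul]
  exact mul_le_mul ((norm_apply_le _ k).trans (hN x hx).1)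
    ((abs_secondPartial_le v x a b l).trans (hM x hx).2.2) (norm_nonneg _) hN0

lemma integral_partialDeriv_mul (hD : IsOpen D) (hDb : Bornology.IsBounded D)
    (hv : DirichletField D v) (hw : DirichletField D w) (a b k l : Fin d) :
    ∫ x in D, partialDeriv a w x k * partialDeriv b v x l
      = - ∫ x in D, w x k * secondPartial a b v x l := by
  obtain ⟨M, hM0, hM⟩ := hv.exists_bound hDb
  obtain ⟨N, hN0, hN⟩ := hw.exists_bound hDb
  let π : Fin d → Vec d →L[ℝ] ℝ := fun i => EuclideanSpace.proj i
  have hπ : ∀ (i : Fin d) (y : Vec d), ‖π i y‖ ≤ ‖y‖ := fun i y => norm_apply_le y i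
  have hwd : ∀ x ∈ D, HasFDerivAt (fun z => w z k) ((π k).comp (fderiv ℝ w x)) x := fun x hx =>
    (π k).hasFDerivAt.comp x ((hw.contDiffAt hD hx).differentiableAt two_ne_zero).hasFDerivAt
  have hvd := fun x (hx : x ∈ D) => hasFDerivAt_partialDeriv (hv.contDiffAt hD hx) b l
  have hw1 : ContDiffOn ℝ 1 (fun z => w z k) D :=
    (π k).contDiff.comp_contDiffOn (hw.contDiffOn.of_le (by norm_num))
  have hv1 : ContDiffOn ℝ 1 (fun z => partialDeriv b v z l) D :=
    (π l).contDiff.comp_contDiffOn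
      ((hv.contDiffOn.fderiv_of_isOpen hD (m := 1) (by norm_num)).clm_apply contDiffOn_const)
  have key := setIntegral_fderiv_mul (φ := fun z => w z k) (σ := fun z => partialDeriv b v z l)
    (M := max M N) hD hDb ((π k).continuous.comp hw.continuous)
    (fun x hx => by simp [hw.zero_off x hx]) hw1 hv1 ?_ ?_ ?_ (EuclideanSpace.single a 1)
  · refine Eq.trans (setIntegral_congr_fun hD.measurableSet fun x hx => ?_)
      (key.trans (congrArg Neg.neg (setIntegral_congr_fun hD.measurableSet fun x hx => ?_)))
    · simp only [(hwd x hx).fderiv]; rfl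
    · simp only [(hvd x hx).fderiv]; rfl
  · intro x hx
    rw [(hwd x hx).fderiv]
    refine ContinuousLinearMap.opNorm_le_bound _ (hM0.trans (le_max_left _ _)) fun y => ?_
    refine (hπ k _).trans (((fderiv ℝ w x).le_opNorm y).trans ?_)
    exact mul_le_mul_of_nonneg_right ((hN x hx).2.1.trans (le_max_right _ _)) (norm_nonneg _)
  · intro x hx
    exact (abs_partialDeriv_le v x l b).trans ((hM x hx).2.1.trans (le_max_left _ _))
  · intro x hx
    rw [(hvd x hx).fderiv]
    refine ContinuousLinearMap.opNorm_le_bound _ (hM0.trans (le_max_left _ _)) fun y => ?_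
    refine (hπ l _).trans (((fderiv ℝ (fderiv ℝ v) x y).le_opNorm _).trans ?_)
    have h1 := (fderiv ℝ (fderiv ℝ v) x).le_opNorm y
    have h2 : ‖(EuclideanSpace.single b (1 : ℝ) : Vec d)‖ = 1 := by simp
    rw [h2, mul_one]
    exact h1.trans
      (mul_le_mul_of_nonneg_right ((hM x hx).2.2.trans (le_max_left _ _)) (norm_nonneg _))

lemma integral_sum_sum_add {F G H : Fin d → Fin d → Vec d → ℝ}
    (hF : ∀ i j, IntegrableOn (F i j) D) (hG : ∀ i j, IntegrableOn (G i j) D)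
    (hH : ∀ i j, IntegrableOn (H i j) D) :
    ∫ x in D, ∑ i, ∑ j, (F i j x + G i j x + H i j x) =
      ∑ i, ∑ j, ((∫ x in D, F i j x) + (∫ x in D, G i j x) + ∫ x in D, H i j x) := by
  have hI : ∀ i j, IntegrableOn (fun x => F i j x + G i j x + H i j x) D := fun i j =>
    ((hF i j).add (hG i j)).add (hH i j)
  rw [integral_finsetSum _ fun i _ => integrable_finsetSum _ fun j _ => hI i j]
  refine Finset.sum_congr rfl fun i _ => ?_
  rw [integral_finsetSum _ fun j _ => hI i j]
  refine Finset.sum_congr rfl fun j _ => ?_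
  have hFG : IntegrableOn (fun x => F i j x + G i j x) D := (hF i j).add (hG i j)
  rw [integral_add hFG (hH i j), integral_add (hF i j) (hG i j)]

lemma integrableOn_pairing (hD : IsOpen D) (hDb : Bornology.IsBounded D)
    (hv : DirichletField D v) (hw : DirichletField D w) : IntegrableOn (pairing v w) D := by
  have hI := integrableOn_partialDeriv_mul hD hDb hv hw
  exact integrable_finsetSum _ fun i _ => integrable_finsetSum _ fun j _ =>
    ((hI j i j i).add (hI j j i i)).add (hI j i i j)

/-- Green's formula for the isotropic elastic energy. -/
lemma IsIsotropic.integral_pairing {f J : ℝ → ℝ} {β : ℝ} (hC : IsIsotropic d f J β)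
    (hD : IsOpen D) (hDb : Bornology.IsBounded D)
    (hv : DirichletField D v) (hw : DirichletField D w) :
    β * ∫ x in D, pairing v w x = - ∫ x in D, inner ℝ (elasticForce f J v x) (w x) := by
  have hI := integrableOn_partialDeriv_mul hD hDb hv hw
  have hK := integrableOn_mul_secondPartial hD hDb hv hw
  have h1 : ∫ x in D, pairing v w x = - ∑ i, ∑ j, ((∫ x in D, w x i * secondPartial i j v x j)
      + (∫ x in D, w x i * secondPartial j j v x i)
      + ∫ x in D, w x i * secondPartial j i v x j) := by
    unfold pairing
    rw [integral_sum_sum_add (fun i j => hI j i j i) (fun i j => hI j j i i)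
      (fun i j => hI j i i j)]
    simp only [integral_partialDeriv_mul hD hDb hv hw, Finset.sum_add_distrib,
      Finset.sum_neg_distrib]
    rw [Finset.sum_comm (f := fun i j => ∫ x in D, w x j * secondPartial j i v x i)]
    ring
  have h3 : ∫ x in D, inner ℝ (elasticForce f J v x) (w x) =
      ∫ x in D, β * ∑ i, ∑ j, (w x i * secondPartial i j v x j + w x i * secondPartial j j v x i
        + w x i * secondPartial j i v x j) := by
    refine setIntegral_congr_fun hD.measurableSet fun x hx => ?_
    simp only [PiLp.inner_apply, hC.elasticForce_apply (hv.contDiffAt hD hx)]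
    rw [Finset.mul_sum]
    refine Finset.sum_congr rfl fun i _ => ?_
    simp only [RCLike.inner_apply, conj_trivial, Finset.mul_sum]
    refine Finset.sum_congr rfl fun j _ => ?_
    ring
  rw [h3, integral_const_mul, h1, integral_sum_sum_add (fun i j => hK i j i j)
    (fun i j => hK j j i i) (fun i j => hK j i i j), mul_neg]

lemma gradSq_eq (v : Vec d → Vec d) (x : Vec d) :
    gradSq v x = ∑ i, ∑ j, partialDeriv j v x i * partialDeriv j v x i := by
  rw [Finset.sum_comm]
  refine Finset.sum_congr rfl fun j _ => ?_
  rw [EuclideanSpace.real_norm_sq_eq]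
  exact Finset.sum_congr rfl fun i _ => sq _

lemma integrableOn_gradSq (hD : IsOpen D) (hDb : Bornology.IsBounded D)
    (hv : DirichletField D v) : IntegrableOn (gradSq v) D := by
  have hI := integrableOn_partialDeriv_mul hD hDb hv hv
  have h : gradSq v = fun x => ∑ i, ∑ j, partialDeriv j v x i * partialDeriv j v x i :=
    funext (gradSq_eq v)
  rw [h]
  exact integrable_finsetSum _ fun i _ => integrable_finsetSum _ fun j _ => hI j j i i

/-- Korn's inequality for fields vanishing on the boundary. -/
lemma integral_gradSq_le (hD : IsOpen D) (hDb : Bornology.IsBounded D)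
    (hv : DirichletField D v) : ∫ x in D, gradSq v x ≤ ∫ x in D, pairing v v x := by
  have hI := integrableOn_partialDeriv_mul hD hDb hv hv
  -- Two integrations by parts and the symmetry of second derivatives interchange the derivatives.
  -- The mixed products thus integrate to the squared divergence, and `pairing v v` to |∇v|² + 2
  -- (div v)².
  have hsw : ∀ i j, ∫ x in D, partialDeriv j v x i * partialDeriv i v x j =
      ∫ x in D, partialDeriv j v x j * partialDeriv i v x i := by
    intro i j
    rw [integral_partialDeriv_mul hD hDb hv hv,
      setIntegral_congr_fun (g := fun x => partialDeriv i v x i * partialDeriv j v x j)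
        hD.measurableSet (fun x _ => mul_comm _ _), integral_partialDeriv_mul hD hDb hv hv]
    congr 1
    refine setIntegral_congr_fun hD.measurableSet fun x hx => ?_
    simp only [secondPartial_comm (hv.contDiffAt hD hx) i j]
  have h1 : ∫ x in D, pairing v v x = (∫ x in D, gradSq v x) +
      2 * ∫ x in D, (∑ i, partialDeriv i v x i) ^ 2 := by
    have hdiv : ∀ x, (∑ i, partialDeriv i v x i) ^ 2 =
        ∑ i, ∑ j, partialDeriv j v x j * partialDeriv i v x i := fun x => by
      rw [sq, Finset.sum_mul_sum, Finset.sum_comm]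
    have hs : ∀ (F : Fin d → Fin d → Vec d → ℝ), (∀ i j, IntegrableOn (F i j) D) →
        ∫ x in D, ∑ i, ∑ j, F i j x = ∑ i, ∑ j, ∫ x in D, F i j x := fun F hF => by
      rw [integral_finsetSum _ fun i _ => integrable_finsetSum _ fun j _ => hF i j]
      exact Finset.sum_congr rfl fun i _ => integral_finsetSum _ fun j _ => hF i j
    simp only [hdiv, gradSq_eq, pairing]
    rw [hs _ fun i j => hI j j i i, hs _ fun i j => hI j i j i,
      integral_sum_sum_add (fun i j => hI j i j i) (fun i j => hI j j i i)
        (fun i j => hI j i i j)]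
    simp only [Finset.sum_add_distrib]
    rw [Finset.sum_congr rfl fun i _ => Finset.sum_congr rfl fun j _ => hsw i j]
    ring
  have h2 : 0 ≤ ∫ x in D, (∑ i, partialDeriv i v x i) ^ 2 :=
    integral_nonneg fun x => sq_nonneg _
  linarith

end Dirichlet

end Peridynamics

namespace Peridynamics

variable {d : ℕ}

/-! ### Taylor's formula for second differences -/

section SecondDifference

variable {E F : Type*} [NormedAddCommGroup E] [NormedSpace ℝ E]
  [NormedAddCommGroup F] [NormedSpace ℝ F]

/-- Taylor's formula for symmetric second differences. -/
lemma norm_second_difference_sub_le {w : E → F} {B : ℝ} (hB : 0 ≤ B) (hw : ContDiff ℝ 2 w)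
    (hlip : ∀ y y', ‖fderiv ℝ (fderiv ℝ w) y - fderiv ℝ (fderiv ℝ w) y'‖ ≤ B * ‖y - y'‖)
    (x z : E) :
    ‖w (x + z) + w (x - z) - (2 : ℝ) • w x - fderiv ℝ (fderiv ℝ w) x z z‖ ≤ 2 * B * ‖z‖ ^ 3 := by
  have hw1 : Differentiable ℝ w := hw.differentiable two_ne_zero
  have hw2 : Differentiable ℝ (fderiv ℝ w) :=
    (hw.fderiv_right (m := 1) (by norm_num)).differentiable one_ne_zero
  set H := fderiv ℝ (fderiv ℝ w) with hH
  have hp : ∀ s : ℝ, HasDerivAt (fun s : ℝ => x + s • z) z s := fun s => by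
    simpa using ((hasDerivAt_id s).smul_const z).const_add x
  have hm : ∀ s : ℝ, HasDerivAt (fun s : ℝ => x - s • z) (-z) s := fun s => by
    simpa using ((hasDerivAt_id s).smul_const z).const_sub x
  have hG : ∀ y, HasFDerivAt (fun y => fderiv ℝ w y z) ((H y).flip z) y := fun y => by
    have := (hw2 y).hasFDerivAt.clm_apply (hasFDerivAt_const z y)
    simpa using this
  -- q and q₁ = q' vanish at 0, and q₂ = q'' is bounded by 2B‖z‖³ through the Lipschitz bound on the
  -- second derivative. Applying the mean value inequality twice carries this bound to q(1).
  let q : ℝ → F := fun s => w (x + s • z) + w (x - s • z) - (2 : ℝ) • w x - s ^ 2 • H x z z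
  let q₁ : ℝ → F := fun s =>
    fderiv ℝ w (x + s • z) z - fderiv ℝ w (x - s • z) z - (2 * s) • H x z z
  let q₂ : ℝ → F := fun s =>
    H (x + s • z) z z + H (x - s • z) z z - (2 : ℝ) • H x z z
  have hq : ∀ s, HasDerivAt q (q₁ s) s := by
    intro s
    have h1 := (hw1 (x + s • z)).hasFDerivAt.comp_hasDerivAt s (hp s)
    have h2 := (hw1 (x - s • z)).hasFDerivAt.comp_hasDerivAt s (hm s)
    have h3 := ((hasDerivAt_pow 2 s).smul_const (H x z z))
    have := ((h1.add h2).sub_const ((2 : ℝ) • w x)).sub h3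
    refine this.congr_deriv ?_
    simp [q₁, sub_eq_add_neg]
  have hq₁ : ∀ s, HasDerivAt q₁ (q₂ s) s := by
    intro s
    have h1 := (hG (x + s • z)).comp_hasDerivAt s (hp s)
    have h2 := (hG (x - s • z)).comp_hasDerivAt s (hm s)
    have h3 := (((hasDerivAt_id s).const_mul (2 : ℝ)).smul_const (H x z z))
    have := (h1.sub h2).sub h3
    refine this.congr_deriv ?_
    simp [q₂]
  have hb2 : ∀ s ∈ Ico (0 : ℝ) 1, ‖q₂ s‖ ≤ 2 * B * ‖z‖ ^ 3 := by
    intro s hs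
    have e1 : q₂ s = (H (x + s • z) - H x) z z + (H (x - s • z) - H x) z z := by
      simp only [q₂, sub_apply, two_smul]; abel
    have h0 : ∀ y, ‖y - x‖ ≤ ‖z‖ → ‖(H y - H x) z z‖ ≤ B * ‖z‖ ^ 3 := by
      intro y hy
      calc ‖(H y - H x) z z‖ ≤ ‖(H y - H x) z‖ * ‖z‖ := ContinuousLinearMap.le_opNorm _ _
        _ ≤ (‖H y - H x‖ * ‖z‖) * ‖z‖ := by
          gcongr; exact ContinuousLinearMap.le_opNorm _ _
        _ ≤ (B * ‖z‖ * ‖z‖) * ‖z‖ := by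
          gcongr; exact (hlip y x).trans (by gcongr)
        _ = B * ‖z‖ ^ 3 := by ring
    have hsz : ‖s • z‖ ≤ ‖z‖ := by
      rw [norm_smul, Real.norm_of_nonneg hs.1]
      exact mul_le_of_le_one_left (norm_nonneg _) hs.2.le
    rw [e1]
    refine (norm_add_le _ _).trans ?_
    have h1 := h0 (x + s • z) (by simpa using hsz)
    have h2 := h0 (x - s • z) (by simpa using hsz)
    linarith
  have hb1 : ∀ s ∈ Ico (0 : ℝ) 1, ‖q₁ s‖ ≤ 2 * B * ‖z‖ ^ 3 := by
    intro s hs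
    have h := norm_image_sub_le_of_norm_deriv_le_segment' (a := 0) (b := 1)
      (fun s _ => (hq₁ s).hasDerivWithinAt) hb2 s ⟨hs.1, hs.2.le⟩
    have h0 : q₁ 0 = 0 := by simp [q₁]
    rw [h0, sub_zero, sub_zero] at h
    exact h.trans (mul_le_of_le_one_right (by positivity) hs.2.le)
  have h := norm_image_sub_le_of_norm_deriv_le_segment_01'
    (fun s _ => (hq s).hasDerivWithinAt) hb1
  have h0 : q 0 = 0 := by simp [q, two_smul]
  rw [h0, sub_zero] at h
  simpa [q] using h

end SecondDifference

/-! ### Uniform bounds on the fields and on f' -/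

section Bounds

/-- Fields with first and second derivatives bounded by `B` and second derivative
`B`-Lipschitz. -/
structure BoundedDerivs (B : ℝ) (w : Vec d → Vec d) : Prop where
  contDiff : ContDiff ℝ 2 w
  fderiv_le : ∀ x, ‖fderiv ℝ w x‖ ≤ B
  fderiv_fderiv_le : ∀ x, ‖fderiv ℝ (fderiv ℝ w) x‖ ≤ B
  lipschitz : ∀ y y', ‖fderiv ℝ (fderiv ℝ w) y - fderiv ℝ (fderiv ℝ w) y'‖ ≤ B * ‖y - y'‖

lemma BoundedDerivs.nonneg {B : ℝ} {w : Vec d → Vec d} (hw : BoundedDerivs B w) : 0 ≤ B :=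
  (norm_nonneg _).trans (hw.fderiv_le 0)

lemma contDiffOn_halfLineDeriv {f : ℝ → ℝ} (hf : IsPotential f) :
    ContDiffOn ℝ 1 (halfLineDeriv f) (Ici 0) :=
  hf.smooth.derivWithin (uniqueDiffOn_Ici 0) (by
    norm_num
    exact WithTop.coe_le_coe.2 (le_top : (2 : ℕ∞) ≤ ⊤))

lemma exists_lipschitz_halfLineDeriv {f : ℝ → ℝ} (hf : IsPotential f) (A : ℝ) :
    ∃ L, 0 ≤ L ∧ ∀ a ∈ Icc 0 A, ∀ b ∈ Icc 0 A,
      |halfLineDeriv f a - halfLineDeriv f b| ≤ L * |a - b| := by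
  -- For A ≤ 0 the interval has at most one point, so there are no unique derivatives within it.
  rcases le_or_gt A 0 with hA | hA
  · refine ⟨0, le_rfl, fun a ha b hb => ?_⟩
    have h1 : a = 0 := le_antisymm (ha.2.trans hA) ha.1
    have h2 : b = 0 := le_antisymm (hb.2.trans hA) hb.1
    simp [h1, h2]
  have hc : ContDiffOn ℝ 1 (halfLineDeriv f) (Icc 0 A) :=
    (contDiffOn_halfLineDeriv hf).mono Icc_subset_Ici_self
  have hu := uniqueDiffOn_Icc hA
  obtain ⟨L, hL⟩ := (isCompact_Icc.image_of_continuousOn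
    (hc.continuousOn_derivWithin hu le_rfl)).isBounded.exists_norm_le
  refine ⟨max L 0, le_max_right _ _, fun a ha b hb => ?_⟩
  have h := (convex_Icc 0 A).norm_image_sub_le_of_norm_derivWithin_le (C := max L 0)
    (hc.differentiableOn one_ne_zero)
    (fun x hx => (hL _ (mem_image_of_mem _ hx)).trans (le_max_left _ _)) hb ha
  simpa using h

lemma fderiv_fderiv_unitDir_eq (w : Vec d → Vec d) (x e : Vec d) :
    inner ℝ (fderiv ℝ (fderiv ℝ w) x e e) e =
      ∑ j, ∑ k, ∑ l, e j * e k * e l * secondPartial j l w x k := by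
  have hexp : e = ∑ j, e j • (EuclideanSpace.single j (1 : ℝ) : Vec d) := by
    ext i; simp [Finset.sum_apply, Pi.single_apply]
  have hH : fderiv ℝ (fderiv ℝ w) x e e = ∑ j, ∑ l, (e j * e l) •
      fderiv ℝ (fderiv ℝ w) x (EuclideanSpace.single j 1) (EuclideanSpace.single l 1) := by
    conv_lhs => rw [hexp]
    simp only [map_sum, map_smul, sum_apply, smul_apply, Finset.smul_sum, smul_smul]
    rw [Finset.sum_comm]
    exact Finset.sum_congr rfl fun j _ => Finset.sum_congr rfl fun l _ => by rw [mul_comm]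
  rw [hH]
  simp only [PiLp.inner_apply, WithLp.ofLp_sum, Finset.sum_apply, PiLp.smul_apply, smul_eq_mul,
    RCLike.inner_apply, conj_trivial, Finset.mul_sum]
  rw [Finset.sum_comm]
  refine Finset.sum_congr rfl fun j _ => Finset.sum_congr rfl fun k _ =>
    Finset.sum_congr rfl fun l _ => ?_
  unfold secondPartial
  ring

end Bounds

/-! ### The elastic force as an integral over bonds -/

section ElasticForce

variable {f J : ℝ → ℝ}

lemma integrableOn_moment (hJ : IsInfluence J) {F : Type*} [NormedAddCommGroup F]
    {G : Vec d → F} {C : ℝ} (hG : AEStronglyMeasurable G (volume.restrict (Metric.ball 0 1)))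
    [NormedSpace ℝ F] (hC : ∀ ξ ∈ Metric.ball (0 : Vec d) 1, ‖G ξ‖ ≤ C) :
    IntegrableOn (fun ξ : Vec d => J ‖ξ‖ • G ξ) (Metric.ball 0 1) := by
  obtain ⟨M, hM0, hM⟩ := hJ.exists_bound
  refine IntegrableOn.of_bound (C := M * C) measure_ball_lt_top ?_ ?_
  · exact (hJ.measurable.comp measurable_norm).aestronglyMeasurable.smul hG
  · refine (ae_restrict_iff' measurableSet_ball).2 (Eventually.of_forall fun ξ hξ => ?_)
    rw [norm_smul, Real.norm_eq_abs, abs_of_nonneg (hM _ (norm_nonneg _)).1]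
    exact mul_le_mul (hM _ (norm_nonneg _)).2 (hC ξ hξ) (norm_nonneg _) hM0

lemma integrableOn_elastic (hJ : IsInfluence J) (w : Vec d → Vec d) (x : Vec d) :
    IntegrableOn (fun ξ : Vec d => J ‖ξ‖ • (‖ξ‖ * inner ℝ
        (fderiv ℝ (fderiv ℝ w) x (unitDir ξ) (unitDir ξ)) (unitDir ξ)) • unitDir ξ)
      (Metric.ball 0 1) := by
  have hu : Measurable (unitDir : Vec d → Vec d) := measurable_unitDir
  have hcont : Continuous fun e : Vec d => inner ℝ (fderiv ℝ (fderiv ℝ w) x e e) e := by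
    fun_prop
  refine integrableOn_moment (C := ‖fderiv ℝ (fderiv ℝ w) x‖) hJ
    (Measurable.aestronglyMeasurable ?_) fun ξ hξ => ?_
  · exact (measurable_norm.mul (hcont.measurable.comp hu)).smul hu
  · have h1 := norm_unitDir_le ξ
    have h3 : ‖ξ‖ ≤ 1 := (mem_ball_zero_iff.1 hξ).le
    rw [norm_smul, norm_mul, norm_norm]
    have h2 : ‖inner ℝ (fderiv ℝ (fderiv ℝ w) x (unitDir ξ) (unitDir ξ)) (unitDir ξ)‖
        ≤ ‖fderiv ℝ (fderiv ℝ w) x‖ := by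
      calc _ ≤ ‖fderiv ℝ (fderiv ℝ w) x (unitDir ξ) (unitDir ξ)‖ * ‖unitDir ξ‖ :=
            norm_inner_le_norm _ _
        _ ≤ ‖fderiv ℝ (fderiv ℝ w) x‖ * ‖unitDir ξ‖ * ‖unitDir ξ‖ * ‖unitDir ξ‖ := by
            gcongr; exact ContinuousLinearMap.le_opNorm₂ _ _ _
        _ ≤ ‖fderiv ℝ (fderiv ℝ w) x‖ * 1 * 1 * 1 := by gcongr
        _ = _ := by ring
    calc _ ≤ 1 * ‖fderiv ℝ (fderiv ℝ w) x‖ * 1 := by gcongr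
      _ = _ := by ring

/-- Contracting the integral formula of C̄ with the second derivatives of w puts the elastic force
in the form to which the nonlocal force is compared, direction by direction. -/
lemma elasticForce_eq_integral (hJ : IsInfluence J) {w : Vec d → Vec d} {x : Vec d}
    (hw : ContDiffAt ℝ 2 w x) :
    elasticForce f J w x = (2 * halfLineDeriv f 0 / unitBallVolume d) •
      ∫ ξ in Metric.ball (0 : Vec d) 1, J ‖ξ‖ • (‖ξ‖ * inner ℝ
        (fderiv ℝ (fderiv ℝ w) x (unitDir ξ) (unitDir ξ)) (unitDir ξ)) • unitDir ξ := by
  ext i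
  rw [elasticForce_apply f J hw i]
  have hproj : (∫ ξ in Metric.ball (0 : Vec d) 1, J ‖ξ‖ • (‖ξ‖ * inner ℝ
        (fderiv ℝ (fderiv ℝ w) x (unitDir ξ) (unitDir ξ)) (unitDir ξ)) • unitDir ξ) i
      = ∫ ξ in Metric.ball (0 : Vec d) 1, (J ‖ξ‖ • (‖ξ‖ * inner ℝ
        (fderiv ℝ (fderiv ℝ w) x (unitDir ξ) (unitDir ξ)) (unitDir ξ)) • unitDir ξ) i :=
    ((EuclideanSpace.proj i : Vec d →L[ℝ] ℝ).integral_comp_comm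
      (integrableOn_elastic hJ w x)).symm
  rw [PiLp.smul_apply, hproj, smul_eq_mul]
  simp only [elasticTensor, mul_assoc, ← Finset.mul_sum]
  congr 1
  have hu : Measurable (unitDir : Vec d → Vec d) := measurable_unitDir
  have hui : ∀ i : Fin d, Measurable fun ξ : Vec d => unitDir ξ i := fun i =>
    (EuclideanSpace.proj i : Vec d →L[ℝ] ℝ).continuous.measurable.comp hu
  have hI : ∀ j k l : Fin d, IntegrableOn (fun ξ : Vec d => J ‖ξ‖ * (unitDir ξ i * (unitDir ξ j *
      (unitDir ξ k * unitDir ξ l)) * ‖ξ‖) * secondPartial j l w x k) (Metric.ball 0 1) := by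
    intro j k l
    have hc : ∀ (ξ : Vec d) (i : Fin d), |unitDir ξ i| ≤ 1 := fun ξ i =>
      (norm_apply_le _ _).trans (norm_unitDir_le ξ)
    refine Integrable.mul_const ?_ _
    refine integrableOn_moment (C := 1 * (1 * (1 * 1)) * 1) hJ (Measurable.aestronglyMeasurable
      (((hui i).mul ((hui j).mul ((hui k).mul (hui l)))).mul measurable_norm)) fun ξ hξ => ?_
    have h3 : ‖ξ‖ ≤ 1 := (mem_ball_zero_iff.1 hξ).le
    change ‖unitDir ξ i * (unitDir ξ j * (unitDir ξ k * unitDir ξ l)) * ‖ξ‖‖ ≤ _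
    simp only [norm_mul, Real.norm_eq_abs, abs_norm]
    have := hc ξ i
    have := hc ξ j
    have := hc ξ k
    have := hc ξ l
    gcongr
  have hsum : ∀ ξ : Vec d, (J ‖ξ‖ • (‖ξ‖ * inner ℝ
        (fderiv ℝ (fderiv ℝ w) x (unitDir ξ) (unitDir ξ)) (unitDir ξ)) • unitDir ξ) i
      = ∑ j, ∑ k, ∑ l, J ‖ξ‖ * (unitDir ξ i * (unitDir ξ j *
      (unitDir ξ k * unitDir ξ l)) * ‖ξ‖) * secondPartial j l w x k := by
    intro ξ
    rw [fderiv_fderiv_unitDir_eq]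
    simp only [PiLp.smul_apply, smul_eq_mul, Finset.mul_sum, Finset.sum_mul]
    refine Finset.sum_congr rfl fun j _ => Finset.sum_congr rfl fun k _ =>
      Finset.sum_congr rfl fun l _ => ?_
    ring
  simp only [hsum]
  rw [integral_finsetSum _ fun j _ => integrable_finsetSum _ fun k _ =>
    integrable_finsetSum _ fun l _ => hI j k l]
  refine Finset.sum_congr rfl fun j _ => ?_
  rw [integral_finsetSum _ fun k _ => integrable_finsetSum _ fun l _ => hI j k l]
  refine Finset.sum_congr rfl fun k _ => ?_
  rw [integral_finsetSum _ fun l _ => hI j k l]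
  refine Finset.sum_congr rfl fun l _ => ?_
  rw [integral_mul_const]
  simp only [mul_assoc]

end ElasticForce

end Peridynamics

/-! ### Consistency of the nonlocal force -/

namespace Peridynamics

variable {d : ℕ}

lemma unitBallVolume_pos (d : ℕ) : 0 < unitBallVolume d :=
  ENNReal.toReal_pos (Metric.measure_ball_pos volume _ one_pos).ne' measure_ball_lt_top.ne

/-- The scaled bond force density at a point of the unit ball. -/
noncomputable def bondForce (f J : ℝ → ℝ) (ε : ℝ) (w : Vec d → Vec d) (x ξ : Vec d) : Vec d :=
  (J ‖ξ‖ * halfLineDeriv f (ε * ‖ξ‖ * bondStrain w (x + ε • ξ) x ^ 2) *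
    bondStrain w (x + ε • ξ) x) • unitDir ξ

/-- The substitution y = x + εξ contributes εᵈ, so a factor 1/ε survives: for an error of order ε
the symmetrized integrand must be accurate to order ε². -/
lemma nonlocalForce_eq (f J : ℝ → ℝ) {ε : ℝ} (hε : 0 < ε) (w : Vec d → Vec d) (x : Vec d) :
    nonlocalForce f J ε w x = (4 / (ε * unitBallVolume d)) •
      ∫ ξ in Metric.ball (0 : Vec d) 1, bondForce f J ε w x ξ := by
  let h : Vec d → Vec d := fun y =>
    (J (‖y - x‖ / ε) * halfLineDeriv f (‖y - x‖ * bondStrain w y x ^ 2) *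
        bondStrain w y x) • unitDir (y - x)
  have h1 : ∫ y in Metric.ball x ε, h y = ∫ z in Metric.ball (0 : Vec d) ε, h (x + z) := by
    have hpre : (fun z => x + z) ⁻¹' Metric.ball x ε = Metric.ball 0 ε := by
      ext z; simp [dist_eq_norm]
    rw [← hpre]
    exact ((measurePreserving_add_left volume x).setIntegral_preimage_emb
      (measurableEmbedding_addLeft x) h (Metric.ball x ε)).symm
  have h2 : ∫ z in Metric.ball (0 : Vec d) ε, h (x + z) =
      ε ^ d • ∫ ξ in Metric.ball (0 : Vec d) 1, h (x + ε • ξ) := by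
    rw [Measure.setIntegral_comp_smul_of_pos volume (fun z => h (x + z)) _ hε]
    rw [smul_unitBall_of_pos hε, smul_smul, finrank_euclideanSpace_fin,
      mul_inv_cancel₀ (by positivity), one_smul]
  have h3 : ∀ ξ, h (x + ε • ξ) = bondForce f J ε w x ξ := by
    intro ξ
    have e1 : x + ε • ξ - x = ε • ξ := by abel
    have e2 : ‖ε • ξ‖ = ε * ‖ξ‖ := by rw [norm_smul, Real.norm_of_nonneg hε.le]
    simp only [h, bondForce, e1, e2, unitDir_smul hε, mul_div_cancel_left₀ _ hε.ne']
  unfold nonlocalForce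
  change _ • ∫ y in Metric.ball x ε, h y = _
  rw [h1, h2, smul_smul]
  simp only [h3]
  congr 1
  have := unitBallVolume_pos d
  rw [pow_succ]
  field_simp

lemma bondStrain_add (w : Vec d → Vec d) (x z : Vec d) :
    bondStrain w (x + z) x = inner ℝ (w (x + z) - w x) (unitDir z) / ‖z‖ := by
  simp [bondStrain]

section Estimates

variable {f J : ℝ → ℝ} {B : ℝ} {w : Vec d → Vec d}

lemma abs_bondStrain_le (hw : BoundedDerivs B w) (x z : Vec d) :
    |bondStrain w (x + z) x| ≤ B := by
  rw [bondStrain_add, abs_div, abs_norm]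
  refine div_le_of_le_mul₀ (norm_nonneg _) hw.nonneg ?_
  have h1 : ‖w (x + z) - w x‖ ≤ B * ‖z‖ := by
    have := convex_univ.norm_image_sub_le_of_norm_fderiv_le (𝕜 := ℝ) (f := w) (C := B)
      (fun y _ => (hw.contDiff.differentiable two_ne_zero) y) (fun y _ => hw.fderiv_le y)
      (mem_univ x) (mem_univ (x + z))
    simpa using this
  calc _ ≤ ‖w (x + z) - w x‖ * ‖unitDir z‖ := abs_real_inner_le_norm _ _
    _ ≤ (B * ‖z‖) * 1 := mul_le_mul h1 (norm_unitDir_le z) (norm_nonneg _)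
      (mul_nonneg hw.nonneg (norm_nonneg _))
    _ = B * ‖z‖ := mul_one _

/-- The direction changes sign with z, so the difference of the two opposite bond strains is the
symmetric second difference of w tested against the direction, divided by ‖z‖. First order terms
cancel. -/
lemma abs_bondStrain_sub_sub_le (hw : BoundedDerivs B w) (x : Vec d) {z : Vec d} (hz : z ≠ 0) :
    |bondStrain w (x + z) x - bondStrain w (x + -z) x
      - ‖z‖ * inner ℝ (fderiv ℝ (fderiv ℝ w) x (unitDir z) (unitDir z)) (unitDir z)|
      ≤ 2 * B * ‖z‖ ^ 2 := by
  have hn : 0 < ‖z‖ := norm_pos_iff.2 hz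
  have hH : fderiv ℝ (fderiv ℝ w) x z z
      = (‖z‖ * ‖z‖) • fderiv ℝ (fderiv ℝ w) x (unitDir z) (unitDir z) := by
    conv_lhs => rw [← norm_smul_unitDir z]
    simp only [map_smul, smul_apply, smul_smul]
  have key := norm_second_difference_sub_le hw.nonneg hw.contDiff hw.lipschitz x z
  have e : bondStrain w (x + z) x - bondStrain w (x + -z) x
      - ‖z‖ * inner ℝ (fderiv ℝ (fderiv ℝ w) x (unitDir z) (unitDir z)) (unitDir z)
      = inner ℝ (w (x + z) + w (x - z) - (2 : ℝ) • w x - fderiv ℝ (fderiv ℝ w) x z z)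
        (unitDir z) / ‖z‖ := by
    rw [hH, bondStrain_add, bondStrain_add, unitDir_neg, norm_neg, ← sub_eq_add_neg]
    simp only [inner_sub_left, inner_add_left, inner_smul_left, inner_neg_right, conj_trivial]
    field_simp
    ring
  rw [e, abs_div, abs_norm, div_le_iff₀ hn]
  calc _ ≤ ‖w (x + z) + w (x - z) - (2 : ℝ) • w x - fderiv ℝ (fderiv ℝ w) x z z‖ * ‖unitDir z‖ :=
        abs_real_inner_le_norm _ _
    _ ≤ (2 * B * ‖z‖ ^ 3) * 1 := mul_le_mul key (norm_unitDir_le z) (norm_nonneg _)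
      (by have := hw.nonneg; positivity)
    _ = _ := by ring

/-- One of the two products in the splitting has the factors φ(rS²) - φ(0) = O(r) and S - S', the
other has φ(rS²) - φ(rS'²) = O(r|S - S'|). Opposite bonds satisfy S - S' = O(r), so linearizing φ at
0 costs only O(r²). The constant is 3 = 1 + 2. -/
lemma abs_nonlinear_diff_le {φ : ℝ → ℝ} {L r S S' B A : ℝ}
    (hL : ∀ a ∈ Icc 0 A, ∀ b ∈ Icc 0 A, |φ a - φ b| ≤ L * |a - b|) (hL0 : 0 ≤ L)
    (hr : 0 ≤ r) (hA : r * B ^ 2 ≤ A) (hS : |S| ≤ B) (hS' : |S'| ≤ B) :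
    |φ (r * S ^ 2) * S - φ (r * S' ^ 2) * S' - φ 0 * (S - S')| ≤ 3 * L * r * B ^ 2 * |S - S'| := by
  have hB : 0 ≤ B := (abs_nonneg _).trans hS
  have hm : ∀ s : ℝ, |s| ≤ B → r * s ^ 2 ∈ Icc 0 A := fun s hs =>
    ⟨by positivity, (mul_le_mul_of_nonneg_left (by rw [← sq_abs]; gcongr) hr).trans hA⟩
  have h0 : (0 : ℝ) ∈ Icc 0 A := ⟨le_rfl, (by positivity : (0 : ℝ) ≤ r * B ^ 2).trans hA⟩
  have h1 := hL _ (hm S hS) 0 h0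
  have h2 := hL _ (hm S hS) _ (hm S' hS')
  have e : φ (r * S ^ 2) * S - φ (r * S' ^ 2) * S' - φ 0 * (S - S') =
      (φ (r * S ^ 2) - φ 0) * (S - S') + (φ (r * S ^ 2) - φ (r * S' ^ 2)) * S' := by ring
  rw [e]
  refine (abs_add_le _ _).trans ?_
  rw [abs_mul, abs_mul]
  have h3 : |φ (r * S ^ 2) - φ 0| ≤ L * (r * B ^ 2) := by
    refine h1.trans ?_
    rw [sub_zero, abs_of_nonneg (hm S hS).1]
    refine mul_le_mul_of_nonneg_left (mul_le_mul_of_nonneg_left ?_ hr) hL0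
    rw [← sq_abs]; gcongr
  have h4 : |φ (r * S ^ 2) - φ (r * S' ^ 2)| ≤ L * (r * (|S - S'| * (2 * B))) := by
    refine h2.trans ?_
    have e2 : r * S ^ 2 - r * S' ^ 2 = r * ((S - S') * (S + S')) := by ring
    rw [e2, abs_mul, abs_mul, abs_of_nonneg hr]
    have : |S + S'| ≤ 2 * B := (abs_add_le _ _).trans (by linarith)
    gcongr
  calc _ ≤ L * (r * B ^ 2) * |S - S'| + L * (r * (|S - S'| * (2 * B))) * B := by gcongr
    _ = _ := by ring

lemma measurable_bondStrain (hw : BoundedDerivs B w) (ε : ℝ) (x : Vec d) :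
    Measurable fun ξ : Vec d => bondStrain w (x + ε • ξ) x := by
  have hu : Measurable (unitDir : Vec d → Vec d) := measurable_unitDir
  have hwc : Continuous w := hw.contDiff.continuous
  have h1 : Continuous fun ξ : Vec d => w (x + ε • ξ) - w x := by fun_prop
  have h2 : Continuous fun ξ : Vec d => ε • ξ := by fun_prop
  simp only [bondStrain_add]
  exact (h1.measurable.inner (hu.comp h2.measurable)).div h2.measurable.norm

lemma integrableOn_bondForce (hf : IsPotential f) (hJ : IsInfluence J) {ε : ℝ} (hε : 0 < ε)
    (hw : BoundedDerivs B w) (x : Vec d) :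
    IntegrableOn (bondForce f J ε w x) (Metric.ball 0 1) := by
  have hB := hw.nonneg
  obtain ⟨L, hL0, hL⟩ := exists_lipschitz_halfLineDeriv hf (ε * B ^ 2)
  -- The one-sided derivative is continuous only on the half line. Truncation makes it globally
  -- continuous, hence measurable, without changing it at the nonnegative bond arguments.
  have hφ : Continuous fun r => halfLineDeriv f (max r 0) :=
    (contDiffOn_halfLineDeriv hf).continuousOn.comp_continuous (by fun_prop)
      fun r => mem_Ici.2 (le_max_right _ _)
  have hS := measurable_bondStrain hw ε x
  have hnn : ∀ ξ : Vec d, 0 ≤ ε * ‖ξ‖ * bondStrain w (x + ε • ξ) x ^ 2 := fun ξ => by positivity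
  have heq : bondForce f J ε w x = fun ξ => J ‖ξ‖ •
      ((halfLineDeriv f (max (ε * ‖ξ‖ * bondStrain w (x + ε • ξ) x ^ 2) 0) *
        bondStrain w (x + ε • ξ) x) • unitDir ξ) := by
    ext1 ξ
    rw [bondForce, max_eq_left (hnn ξ), smul_smul, mul_assoc]
  rw [heq]
  refine integrableOn_moment (C := (|halfLineDeriv f 0| + L * (ε * B ^ 2)) * B * 1) hJ
    (Measurable.aestronglyMeasurable ?_) fun ξ hξ => ?_
  · exact ((hφ.measurable.comp ((measurable_norm.const_mul ε).mul (hS.pow_const 2))).mul hS).smul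
      measurable_unitDir
  · have hξ1 : ‖ξ‖ ≤ 1 := (mem_ball_zero_iff.1 hξ).le
    have hSB := abs_bondStrain_le hw x (ε • ξ)
    have hS2 : bondStrain w (x + ε • ξ) x ^ 2 ≤ B ^ 2 := by rw [← sq_abs]; gcongr
    have hle : ε * ‖ξ‖ * bondStrain w (x + ε • ξ) x ^ 2 ≤ ε * B ^ 2 := by
      calc _ ≤ ε * 1 * B ^ 2 := by gcongr
        _ = _ := by ring
    rw [max_eq_left (hnn ξ), norm_smul, norm_mul, Real.norm_eq_abs, Real.norm_eq_abs]
    have h1 := hL _ ⟨hnn ξ, hle⟩ 0 ⟨le_rfl, by positivity⟩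
    rw [sub_zero, abs_of_nonneg (hnn ξ)] at h1
    have h2 : |halfLineDeriv f (ε * ‖ξ‖ * bondStrain w (x + ε • ξ) x ^ 2)| ≤
        |halfLineDeriv f 0| + L * (ε * B ^ 2) := by
      have h3 := abs_sub_abs_le_abs_sub
        (halfLineDeriv f (ε * ‖ξ‖ * bondStrain w (x + ε • ξ) x ^ 2)) (halfLineDeriv f 0)
      have h4 := mul_le_mul_of_nonneg_left hle hL0
      linarith
    gcongr
    exact norm_unitDir_le ξ

/-- The nonlocal force approximates the local elastic force to first order in the horizon. -/
theorem exists_norm_nonlocalForce_sub_elasticForce_le (d : ℕ) (hf : IsPotential f)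
    (hJ : IsInfluence J) (hB : 0 ≤ B) (R : ℝ) :
    ∃ K, 0 ≤ K ∧ ∀ ε, 0 < ε → ε ≤ R → ∀ w : Vec d → Vec d, BoundedDerivs B w → ∀ x,
      ‖nonlocalForce f J ε w x - elasticForce f J w x‖ ≤ K * ε := by
  rcases lt_or_ge R 0 with hR | hR
  · exact ⟨0, le_rfl, fun ε h1 h2 => absurd (h1.le.trans h2) (not_le.2 hR)⟩
  obtain ⟨M, hM0, hM⟩ := hJ.exists_bound
  obtain ⟨L, hL0, hL⟩ := exists_lipschitz_halfLineDeriv hf (R * B ^ 2)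
  have hf0 := hf.halfLineDeriv_zero_pos.le
  have hω := unitBallVolume_pos d
  set φ₀ := halfLineDeriv f 0
  -- The first summand is the linearization error with |S - S'| ≤ r(B + 2BR), the second the Taylor
  -- remainder 2Br² multiplied by f'(0).
  let K' : ℝ := 3 * L * B ^ 2 * (B + 2 * B * R) + φ₀ * (2 * B)
  have hK' : 0 ≤ K' := by positivity
  refine ⟨2 * (M * K'), by positivity, fun ε hε hεR w hw x => ?_⟩
  let H : Vec d → ℝ := fun ξ =>
    inner ℝ (fderiv ℝ (fderiv ℝ w) x (unitDir ξ) (unitDir ξ)) (unitDir ξ)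
  let g := bondForce f J ε w x
  let E : Vec d → Vec d := fun ξ => J ‖ξ‖ • (‖ξ‖ * H ξ) • unitDir ξ
  have hgI : IntegrableOn g (Metric.ball 0 1) := integrableOn_bondForce hf hJ hε hw x
  have hEI : IntegrableOn E (Metric.ball 0 1) := integrableOn_elastic hJ w x
  have hpre : (fun ξ : Vec d => -ξ) ⁻¹' Metric.ball 0 1 = Metric.ball 0 1 := by ext ξ; simp
  have hemb : MeasurableEmbedding fun ξ : Vec d => -ξ := (MeasurableEquiv.neg _).measurableEmbedding
  have hmp : MeasurePreserving (fun ξ : Vec d => -ξ) volume volume :=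
    Measure.measurePreserving_neg volume
  have hneg : ∫ ξ in Metric.ball (0 : Vec d) 1, g (-ξ) = ∫ ξ in Metric.ball (0 : Vec d) 1, g ξ := by
    have := hmp.setIntegral_preimage_emb hemb g (Metric.ball 0 1)
    rwa [hpre] at this
  have hgI' : IntegrableOn (fun ξ => g (-ξ)) (Metric.ball 0 1) := by
    have := (hmp.integrableOn_comp_preimage hemb (f := g) (s := Metric.ball 0 1)).2 hgI
    rwa [hpre] at this
  -- Adding the opposite bonds ξ and -ξ leaves the elastic integrand times f'(0)ε up to O(ε²). The
  -- center ξ = 0 is separate, since it has no direction; every term is zero there.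
  have hpt : ∀ ξ ∈ Metric.ball (0 : Vec d) 1,
      ‖g ξ + g (-ξ) - (φ₀ * ε) • E ξ‖ ≤ M * K' * ε ^ 2 := by
    intro ξ hξ
    have hξ1 : ‖ξ‖ ≤ 1 := (mem_ball_zero_iff.1 hξ).le
    by_cases hξ0 : ξ = 0
    · have : ‖g ξ + g (-ξ) - (φ₀ * ε) • E ξ‖ = 0 := by
        simp [hξ0, g, bondForce, E, unitDir]
      rw [this]; positivity
    set S := bondStrain w (x + ε • ξ) x with hSdef
    set S' := bondStrain w (x + -(ε • ξ)) x with hS'def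
    have hz : ε • ξ ≠ 0 := smul_ne_zero hε.ne' hξ0
    set r := ε * ‖ξ‖ with hr
    have hr0 : 0 ≤ r := by positivity
    have hrε : r ≤ ε := mul_le_of_le_one_right hε.le hξ1
    have hrz : ‖ε • ξ‖ = r := by rw [norm_smul, Real.norm_of_nonneg hε.le]
    have e1 : g ξ + g (-ξ) - (φ₀ * ε) • E ξ = (J ‖ξ‖ * (halfLineDeriv f (r * S ^ 2) * S
        - halfLineDeriv f (r * S' ^ 2) * S' - φ₀ * (r * H ξ))) • unitDir ξ := by
      simp only [g, bondForce, E, norm_neg, unitDir_neg, smul_neg, smul_smul, ← hSdef, ← hS'def,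
        ← hr]
      rw [← sub_eq_add_neg, ← sub_smul, ← sub_smul, hr]
      congr 1
      ring
    have hS := abs_bondStrain_le hw x (ε • ξ)
    have hS' := abs_bondStrain_le hw x (-(ε • ξ))
    have h1 := abs_nonlinear_diff_le hL hL0 hr0
      (mul_le_mul_of_nonneg_right (hrε.trans hεR) (sq_nonneg B)) hS hS'
    have h2 := abs_bondStrain_sub_sub_le hw x hz
    rw [hrz, unitDir_smul hε] at h2
    change |S - S' - r * H ξ| ≤ _ at h2
    have hHB : |H ξ| ≤ B := by
      have hu := norm_unitDir_le ξ
      calc |H ξ| ≤ ‖fderiv ℝ (fderiv ℝ w) x (unitDir ξ) (unitDir ξ)‖ * ‖unitDir ξ‖ :=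
            abs_real_inner_le_norm _ _
        _ ≤ ‖fderiv ℝ (fderiv ℝ w) x‖ * ‖unitDir ξ‖ * ‖unitDir ξ‖ * ‖unitDir ξ‖ := by
            gcongr; exact ContinuousLinearMap.le_opNorm₂ _ _ _
        _ ≤ B * 1 * 1 * 1 := by gcongr; exact hw.fderiv_fderiv_le x
        _ = B := by ring
    have h3 : |S - S'| ≤ r * (B + 2 * B * R) := by
      have h4 : |S - S'| ≤ |S - S' - r * H ξ| + |r * H ξ| := by
        have := abs_add_le (S - S' - r * H ξ) (r * H ξ)
        simpa using this
      have h5 : |r * H ξ| ≤ r * B := by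
        rw [abs_mul, abs_of_nonneg hr0]; gcongr
      have h6 : 2 * B * r ^ 2 ≤ r * (2 * B * R) := by
        have : r * (2 * B * r) ≤ r * (2 * B * R) := by
          gcongr; exact hrε.trans hεR
        linarith [this]
      linarith
    have h7 : |halfLineDeriv f (r * S ^ 2) * S - halfLineDeriv f (r * S' ^ 2) * S'
        - φ₀ * (r * H ξ)| ≤ K' * r ^ 2 := by
      have e2 : halfLineDeriv f (r * S ^ 2) * S - halfLineDeriv f (r * S' ^ 2) * S'
          - φ₀ * (r * H ξ) = (halfLineDeriv f (r * S ^ 2) * S - halfLineDeriv f (r * S' ^ 2) * S'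
          - φ₀ * (S - S')) + φ₀ * (S - S' - r * H ξ) := by ring
      rw [e2]
      refine (abs_add_le _ _).trans ?_
      rw [abs_mul φ₀, abs_of_nonneg hf0]
      calc _ ≤ 3 * L * r * B ^ 2 * (r * (B + 2 * B * R)) + φ₀ * (2 * B * r ^ 2) := by
            refine add_le_add (h1.trans ?_) ?_ <;> gcongr
        _ = K' * r ^ 2 := by ring
    rw [e1, norm_smul, norm_mul, Real.norm_eq_abs, Real.norm_eq_abs,
      abs_of_nonneg (hM _ (norm_nonneg _)).1]
    calc _ ≤ M * (K' * r ^ 2) * 1 := by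
          have h8 := (hM ‖ξ‖ (norm_nonneg _)).2
          have h9 := norm_unitDir_le ξ
          gcongr
      _ ≤ M * (K' * ε ^ 2) * 1 := by gcongr
      _ = _ := by ring
  have hint : ‖∫ ξ in Metric.ball (0 : Vec d) 1, (g ξ + g (-ξ) - (φ₀ * ε) • E ξ)‖ ≤
      M * K' * ε ^ 2 * unitBallVolume d :=
    norm_setIntegral_le_of_norm_le_const measure_ball_lt_top hpt
  have hgg : IntegrableOn (fun ξ => g ξ + g (-ξ)) (Metric.ball 0 1) := hgI.add hgI'
  have hEI' : IntegrableOn (fun ξ => (φ₀ * ε) • E ξ) (Metric.ball 0 1) := hEI.smul (φ₀ * ε)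
  rw [integral_sub hgg hEI', integral_add hgI hgI', hneg,
    integral_smul] at hint
  -- By reflection the symmetrized integral is twice the original one, so the prefactor 4/(εω)
  -- becomes 2/(εω).
  have hfin : nonlocalForce f J ε w x - elasticForce f J w x = (2 / (ε * unitBallVolume d)) •
      ((∫ ξ in Metric.ball (0 : Vec d) 1, g ξ) + (∫ ξ in Metric.ball (0 : Vec d) 1, g ξ)
        - (φ₀ * ε) • ∫ ξ in Metric.ball (0 : Vec d) 1, E ξ) := by
    rw [nonlocalForce_eq f J hε, elasticForce_eq_integral hJ hw.contDiff.contDiffAt]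
    change (4 / (ε * unitBallVolume d)) • (∫ ξ in Metric.ball (0 : Vec d) 1, g ξ) -
      (2 * φ₀ / unitBallVolume d) • (∫ ξ in Metric.ball (0 : Vec d) 1, E ξ) = _
    rw [← two_smul ℝ (∫ ξ in Metric.ball (0 : Vec d) 1, g ξ), smul_sub, smul_smul, smul_smul]
    congr 2
    · ring
    · field_simp
  rw [hfin, norm_smul, Real.norm_of_nonneg (by positivity)]
  calc _ ≤ 2 / (ε * unitBallVolume d) * (M * K' * ε ^ 2 * unitBallVolume d) := by gcongr
    _ = 2 * (M * K') * ε := by field_simp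

/-- If the influence function vanishes, so does the nonlocal force. -/
lemma nonlocalForce_eq_zero {ε : ℝ} (hε : 0 < ε)
    (h : ∀ᵐ ξ : Vec d ∂(volume.restrict (Metric.ball 0 1)), J ‖ξ‖ = 0) (w : Vec d → Vec d)
    (x : Vec d) : nonlocalForce f J ε w x = 0 := by
  rw [nonlocalForce_eq f J hε, integral_eq_zero_of_ae, smul_zero]
  filter_upwards [h] with ξ hξ
  simp [bondForce, hξ]

end Estimates

end Peridynamics

/-! ### Fields vanishing in a collar of the boundary -/

namespace Peridynamics

variable {d : ℕ} {D : Set (Vec d)}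

/-- In positive dimension a nonempty bounded set is not the whole space, so its frontier is
nonempty; it is compact, so the distance is attained. -/
lemma exists_frontier_infDist_eq (hd : 0 < d) (hDb : Bornology.IsBounded D) {x : Vec d}
    (hx : x ∈ D) : ∃ p ∈ frontier D, Metric.infDist x (frontier D) = ‖x - p‖ := by
  have hne : Nonempty (Fin d) := ⟨⟨0, hd⟩⟩
  have h1 : (frontier D).Nonempty := by
    rw [nonempty_frontier_iff]
    refine ⟨⟨x, hx⟩, ?_⟩
    rintro rfl
    exact NormedSpace.unbounded_univ ℝ (Vec d) hDb
  have h2 : IsCompact (frontier D) :=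
    hDb.isCompact_closure.of_isClosed_subset isClosed_frontier frontier_subset_closure
  obtain ⟨p, hp, he⟩ := h2.exists_infDist_eq_dist h1 x
  exact ⟨p, hp, by rw [he, dist_eq_norm]⟩

/-- Fields that are `C⁴` in `D` with fourth derivative bounded by `C` and that vanish on the
`ε`-neighbourhood of the boundary. -/
structure CollarField (D : Set (Vec d)) (C ε : ℝ) (g : Vec d → Vec d) : Prop where
  contDiffOn : ContDiffOn ℝ 4 g D
  bound : ∀ x ∈ D, ‖iteratedFDeriv ℝ 4 g x‖ ≤ C
  collar : ∀ x, Metric.infDist x (frontier D) ≤ ε → g x = 0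

variable {C ε : ℝ} {g : Vec d → Vec d}

/-- A frontier point has a neighbourhood in the collar, where g itself is zero; an exterior point
has one that misses D. -/
lemma CollarField.eventuallyEq_zero (hg : CollarField D C ε g) (hD : IsOpen D) (hε : 0 < ε)
    {x : Vec d} (hx : x ∉ D) : D.indicator g =ᶠ[𝓝 x] fun _ => 0 := by
  by_cases hxc : x ∈ closure D
  · have hxf : x ∈ frontier D := ⟨hxc, by rwa [hD.interior_eq]⟩
    have h1 : ∀ᶠ y in 𝓝 x, Metric.infDist y (frontier D) < ε :=
      (Metric.continuous_infDist_pt (frontier D)).continuousAt.eventually_lt_const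
        (by simpa only [Metric.infDist_zero_of_mem hxf] using hε)
    filter_upwards [h1] with y hy
    by_cases hyD : y ∈ D
    · rw [indicator_of_mem hyD, hg.collar y hy.le]
    · rw [indicator_of_notMem hyD]
  · filter_upwards [isClosed_closure.isOpen_compl.mem_nhds hxc] with y hy
    rw [indicator_of_notMem fun h => hy (subset_closure h)]

lemma indicator_eventuallyEq (hD : IsOpen D) (g : Vec d → Vec d) {x : Vec d} (hx : x ∈ D) :
    D.indicator g =ᶠ[𝓝 x] g := by
  filter_upwards [hD.mem_nhds hx] with y hy
  rw [indicator_of_mem hy]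

lemma CollarField.contDiff (hg : CollarField D C ε g) (hD : IsOpen D) (hε : 0 < ε) :
    ContDiff ℝ 4 (D.indicator g) := by
  rw [contDiff_iff_contDiffAt]
  intro x
  by_cases hx : x ∈ D
  · exact (hg.contDiffOn.contDiffAt (hD.mem_nhds hx)).congr_of_eventuallyEq
      (indicator_eventuallyEq hD g hx)
  · exact contDiffAt_const.congr_of_eventuallyEq (hg.eventuallyEq_zero hD hε hx)

lemma CollarField.iteratedFDeriv_eq_zero (hg : CollarField D C ε g) (hD : IsOpen D) (hε : 0 < ε)
    {x : Vec d} (hx : x ∉ D) (k : ℕ) : iteratedFDeriv ℝ k (D.indicator g) x = 0 := by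
  rw [((hg.eventuallyEq_zero hD hε hx).iteratedFDeriv ℝ k).eq_of_nhds]
  have := iteratedFDeriv_fun_zero (𝕜 := ℝ) (E := Vec d) (F := Vec d) (n := k)
  exact congrFun this x

/-- Descending induction from the fourth derivative: at p all derivatives of the zero extension
vanish, so a bound on one order gives the next lower order with one more factor ‖x - p‖. The
extension is globally smooth, so the mean value inequality applies on a full ball about p, whatever
the shape of D. -/
lemma CollarField.norm_iteratedFDeriv_le (hg : CollarField D C ε g) (hD : IsOpen D) (hε : 0 < ε)
    {p : Vec d} (hp : p ∈ frontier D) {m k : ℕ} (hmk : m + k = 4) (x : Vec d) :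
    ‖iteratedFDeriv ℝ k (D.indicator g) x‖ ≤ |C| * ‖x - p‖ ^ m := by
  have hpD : p ∉ D := fun h => by
    rw [frontier, hD.interior_eq] at hp
    exact hp.2 h
  induction m generalizing k x with
  | zero =>
    obtain rfl : k = 4 := by omega
    rw [pow_zero, mul_one]
    by_cases hx : x ∈ D
    · rw [((indicator_eventuallyEq hD g hx).iteratedFDeriv ℝ 4).eq_of_nhds]
      exact (hg.bound x hx).trans (le_abs_self C)
    · rw [hg.iteratedFDeriv_eq_zero hD hε hx, norm_zero]
      exact abs_nonneg C
  | succ m ih =>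
    have hw := hg.contDiff hD hε
    have hdiff : Differentiable ℝ (iteratedFDeriv ℝ k (D.indicator g)) :=
      hw.differentiable_iteratedFDeriv (by exact_mod_cast (by omega : k < 4))
    have h := (convex_closedBall p ‖x - p‖).norm_image_sub_le_of_norm_fderiv_le (𝕜 := ℝ)
      (f := iteratedFDeriv ℝ k (D.indicator g)) (C := |C| * ‖x - p‖ ^ m)
      (fun y _ => hdiff y) (fun y hy => ?_) (Metric.mem_closedBall_self (norm_nonneg _))
      (show x ∈ Metric.closedBall p ‖x - p‖ by simp [dist_eq_norm])
    · rw [hg.iteratedFDeriv_eq_zero hD hε hpD, sub_zero] at h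
      rw [pow_succ, ← mul_assoc]
      exact h
    · rw [norm_fderiv_iteratedFDeriv]
      refine (ih (by omega) y).trans ?_
      rw [Metric.mem_closedBall, dist_eq_norm] at hy
      gcongr

lemma norm_fderiv_fderiv_eq (w : Vec d → Vec d) (x : Vec d) :
    ‖fderiv ℝ (fderiv ℝ w) x‖ = ‖iteratedFDeriv ℝ 2 w x‖ := by
  rw [← norm_iteratedFDeriv_one, norm_iteratedFDeriv_fderiv]

lemma norm_fderiv_fderiv_sub_le {E F : Type*} [NormedAddCommGroup E] [NormedSpace ℝ E]
    [NormedAddCommGroup F] [NormedSpace ℝ F] {w : E → F} {B : ℝ} (hw : ContDiff ℝ 3 w)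
    (hB : ∀ x, ‖iteratedFDeriv ℝ 3 w x‖ ≤ B) (y y' : E) :
    ‖fderiv ℝ (fderiv ℝ w) y - fderiv ℝ (fderiv ℝ w) y'‖ ≤ B * ‖y - y'‖ := by
  have hd : Differentiable ℝ (fderiv ℝ (fderiv ℝ w)) :=
    ((hw.fderiv_right (m := 2) (by norm_num)).fderiv_right (m := 1)
      (by norm_num)).differentiable one_ne_zero
  refine convex_univ.norm_image_sub_le_of_norm_fderiv_le (𝕜 := ℝ)
    (f := fderiv ℝ (fderiv ℝ w)) (C := B) (fun z _ => hd z) (fun z _ => ?_) (mem_univ _)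
    (mem_univ _)
  rw [← norm_iteratedFDeriv_one, norm_iteratedFDeriv_fderiv, norm_iteratedFDeriv_fderiv]
  exact hB z

lemma CollarField.norm_le (hg : CollarField D C ε g) (hD : IsOpen D) (hε : 0 < ε)
    {p : Vec d} (hp : p ∈ frontier D) (x : Vec d) :
    ‖D.indicator g x‖ ≤ |C| * ‖x - p‖ ^ 4 := by
  have := hg.norm_iteratedFDeriv_le hD hε hp (m := 4) (k := 0) rfl x
  rwa [norm_iteratedFDeriv_zero] at this

lemma CollarField.norm_fderiv_le (hg : CollarField D C ε g) (hD : IsOpen D) (hε : 0 < ε)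
    {p : Vec d} (hp : p ∈ frontier D) (x : Vec d) :
    ‖fderiv ℝ (D.indicator g) x‖ ≤ |C| * ‖x - p‖ ^ 3 := by
  have := hg.norm_iteratedFDeriv_le hD hε hp (m := 3) (k := 1) rfl x
  rwa [norm_iteratedFDeriv_one] at this

/-- A bound for all the derivatives of fields with fourth derivative bounded by `C` that vanish
near the boundary of a set of diameter at most `R`. -/
noncomputable def collarBound (C R : ℝ) : ℝ := |C| * R ^ 4 + |C| * R ^ 3 + |C| * R ^ 2 + |C| * R

/-- The bound depends on C and the size of D but not on ε; this uniformity is what the consistency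
estimate requires. -/
lemma CollarField.boundedDerivs (hd : 0 < d) (hg : CollarField D C ε g) (hD : IsOpen D)
    (hDb : Bornology.IsBounded D) (hε : 0 < ε) {R : ℝ} (hR0 : 0 ≤ R)
    (hR : ∀ x ∈ D, ∀ p ∈ frontier D, ‖x - p‖ ≤ R) :
    BoundedDerivs (collarBound C R) (D.indicator g) ∧
      ∀ x, ‖D.indicator g x‖ ≤ collarBound C R := by
  have hw := hg.contDiff hD hε
  have hall : ∀ x, ∀ m k, m + k = 4 →
      ‖iteratedFDeriv ℝ k (D.indicator g) x‖ ≤ |C| * R ^ m := by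
    intro x m k hmk
    by_cases hx : x ∈ D
    · obtain ⟨p, hp, -⟩ := exists_frontier_infDist_eq hd hDb hx
      refine (hg.norm_iteratedFDeriv_le hD hε hp hmk x).trans ?_
      have := hR x hx p hp
      gcongr
    · rw [hg.iteratedFDeriv_eq_zero hD hε hx, norm_zero]
      positivity
  have h1 : 0 ≤ |C| * R := by positivity
  have h2 : 0 ≤ |C| * R ^ 2 := by positivity
  have h3 : 0 ≤ |C| * R ^ 3 := by positivity
  have h4 : 0 ≤ |C| * R ^ 4 := by positivity
  refine ⟨⟨hw.of_le (by norm_num), fun x => ?_, fun x => ?_, fun y y' => ?_⟩, fun x => ?_⟩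
  · have := hall x 3 1 rfl
    rw [norm_iteratedFDeriv_one] at this
    rw [collarBound]; linarith
  · have := hall x 2 2 rfl
    rw [← norm_fderiv_fderiv_eq] at this
    rw [collarBound]; linarith
  · refine norm_fderiv_fderiv_sub_le (hw.of_le (by norm_num)) (fun z => ?_) y y'
    have := hall z 1 3 rfl
    rw [pow_one] at this
    rw [collarBound]; linarith
  · have := hall x 4 0 rfl
    rw [norm_iteratedFDeriv_zero] at this
    rw [collarBound]; linarith

end Peridynamics

/-! ### Derivative bounds up to an irregular boundary -/

namespace Peridynamics

section CompactBounds

variable {E F : Type*} [NormedAddCommGroup E] [NormedSpace ℝ E]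
  [NormedAddCommGroup F] [NormedSpace ℝ F]

/-- The first two derivatives of a function of class `C²` on a compact set are bounded on every
subset with unique differentials. -/
lemma exists_bound_fderivWithin {U : E → F} {K S : Set E} (hK : IsCompact K) (hSK : S ⊆ K)
    (hS : UniqueDiffOn ℝ S) (hU : ContDiffOn ℝ 2 U K) :
    ∃ M, ∀ z ∈ S, ‖fderivWithin ℝ U S z‖ ≤ M ∧
      ‖fderivWithin ℝ (fderivWithin ℝ U S) S z‖ ≤ M := by
  let P : Set E → Prop := fun A => ∃ M, ∀ z ∈ A ∩ S, ‖fderivWithin ℝ U S z‖ ≤ M ∧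
      ‖fderivWithin ℝ (fderivWithin ℝ U S) S z‖ ≤ M
  suffices h : P K by
    obtain ⟨M, hM⟩ := h
    exact ⟨M, fun z hz => hM z ⟨hSK hz, hz⟩⟩
  -- By compactness it suffices to bound the derivatives near each point of K.
  refine hK.induction_on (p := P) ⟨0, fun z hz => absurd hz.1 (notMem_empty z)⟩ ?_ ?_ ?_
  · rintro A B hAB ⟨M, hM⟩
    exact ⟨M, fun z hz => hM z ⟨hAB hz.1, hz.2⟩⟩
  · rintro A B ⟨M, hM⟩ ⟨N, hN⟩
    refine ⟨max M N, ?_⟩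
    rintro z ⟨hz | hz, hzS⟩
    · exact ⟨(hM z ⟨hz, hzS⟩).1.trans (le_max_left _ _),
        (hM z ⟨hz, hzS⟩).2.trans (le_max_left _ _)⟩
    · exact ⟨(hN z ⟨hz, hzS⟩).1.trans (le_max_right _ _),
        (hN z ⟨hz, hzS⟩).2.trans (le_max_right _ _)⟩
  · intro z hz
    -- Derivatives within K need not be unique, as K may be the closure of an irregular domain. The
    -- local Taylor series p provided by the C² hypothesis is bounded near z by continuity, and on S
    -- it agrees with the true derivatives, which are unique there.
    obtain ⟨u, hu, p, hp⟩ := (contDiffWithinAt_nat (n := 2)).1 (by exact_mod_cast hU z hz)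
    rw [insert_eq_of_mem hz] at hu
    have hzu : z ∈ u := mem_of_mem_nhdsWithin hz hu
    have hbd : ∀ m : ℕ, m ≤ 2 → ∀ᶠ y in 𝓝[K] z, ‖p y m‖ < ‖p z m‖ + 1 := by
      intro m hm
      have hc : ContinuousWithinAt (fun y => p y m) u z :=
        hp.cont m (by exact_mod_cast hm) z hzu
      have h1 : ∀ᶠ y in 𝓝[u] z, ‖p y m‖ < ‖p z m‖ + 1 :=
        hc.norm.eventually_lt_const (lt_add_one _)
      exact nhdsWithin_le_of_mem hu h1
    have hev := (hbd 1 one_le_two).and ((hbd 2 le_rfl).and hu)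
    obtain ⟨V, hVo, hzV, hV⟩ := mem_nhdsWithin.1 hev
    refine ⟨V ∩ K, by rw [inter_comm]; exact inter_mem_nhdsWithin K (hVo.mem_nhds hzV), max (‖p z 1‖ + 1) (‖p z 2‖ + 1), ?_⟩
    rintro y ⟨⟨hyV, hyK⟩, hyS⟩
    have hpV : HasFTaylorSeriesUpToOn 2 U p (S ∩ V) :=
      hp.mono fun y hy => (hV ⟨hy.2, hSK hy.1⟩).2.2
    have heq : ∀ m : ℕ, m ≤ 2 → p y m = iteratedFDerivWithin ℝ m U S y := by
      intro m hm
      rw [hpV.eq_iteratedFDerivWithin_of_uniqueDiffOn (by exact_mod_cast hm) (hS.inter hVo)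
        ⟨hyS, hyV⟩, iteratedFDerivWithin_inter_open hVo hyV]
    have h1 : ‖fderivWithin ℝ U S y‖ = ‖p y 1‖ := by
      rw [heq 1 one_le_two, norm_iteratedFDerivWithin_one _ (hS y hyS)]
    have h2 : ‖fderivWithin ℝ (fderivWithin ℝ U S) S y‖ = ‖p y 2‖ := by
      rw [heq 2 le_rfl, ← norm_iteratedFDerivWithin_one _ (hS y hyS),
        norm_iteratedFDerivWithin_fderivWithin hS hyS]
    obtain ⟨h3, h4, -⟩ := hV ⟨hyV, hyK⟩
    rw [h1, h2]
    exact ⟨h3.le.trans (le_max_left _ _), h4.le.trans (le_max_right _ _)⟩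

end CompactBounds

end Peridynamics

/-! ### Regular motions in space and time -/

namespace Peridynamics

variable {d : ℕ} {D : Set (Vec d)} {T : ℝ}

/-- Motions on `[0, T] × D` with all second derivatives in time and in space bounded by `M`, with
spatial second derivatives continuous in time, and vanishing continuously on the boundary. -/
structure RegularMotion (D : Set (Vec d)) (T M : ℝ) (u : ℝ → Vec d → Vec d) : Prop where
  continuous : ∀ t ∈ Icc 0 T, Continuous (D.indicator (u t))
  contDiffOn : ∀ t ∈ Icc 0 T, ContDiffOn ℝ 2 (u t) D
  norm_le : ∀ t ∈ Icc 0 T, ∀ x ∈ D, ‖u t x‖ ≤ M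
  fderiv_le : ∀ t ∈ Icc 0 T, ∀ x ∈ D, ‖fderiv ℝ (u t) x‖ ≤ M
  fderiv_fderiv_le : ∀ t ∈ Icc 0 T, ∀ x ∈ D, ‖fderiv ℝ (fderiv ℝ (u t)) x‖ ≤ M
  hasDeriv : ∀ t ∈ Icc 0 T, ∀ x ∈ D,
    HasDerivWithinAt (fun s => u s x) (velocity T u t x) (Icc 0 T) t
  hasDeriv_velocity : ∀ t ∈ Icc 0 T, ∀ x ∈ D,
    HasDerivWithinAt (fun s => velocity T u s x) (acceleration T u t x) (Icc 0 T) t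
  velocity_le : ∀ t ∈ Icc 0 T, ∀ x ∈ D, ‖velocity T u t x‖ ≤ M
  acceleration_le : ∀ t ∈ Icc 0 T, ∀ x ∈ D, ‖acceleration T u t x‖ ≤ M
  secondPartial : ∀ x ∈ D, ∀ a b k : Fin d,
    ContinuousOn (fun t => secondPartial a b (u t) x k) (Icc 0 T)

/-- Every derivative concerned is a restriction of the first or second space-time derivative on [0,
T] × D, and these are bounded because the motion is C² on the compact closure. The boundary
condition makes the zero extension continuous. -/
lemma exists_regularMotion_of_contDiffOn (hD : IsOpen D) (hDb : Bornology.IsBounded D)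
    (hT : 0 < T) {u : ℝ → Vec d → Vec d}
    (hu : ContDiffOn ℝ 2 (fun p : ℝ × Vec d => u p.1 p.2) (Icc 0 T ×ˢ closure D))
    (hbdry : ∀ t ∈ Icc 0 T, ∀ x ∈ frontier D, u t x = 0) :
    ∃ M, 0 ≤ M ∧ RegularMotion D T M u := by
  set U : ℝ × Vec d → Vec d := fun p => u p.1 p.2 with hUdef
  set S : Set (ℝ × Vec d) := Icc 0 T ×ˢ D with hSdef
  have hSK : S ⊆ Icc 0 T ×ˢ closure D := prod_mono le_rfl subset_closure
  have hS : UniqueDiffOn ℝ S := (uniqueDiffOn_Icc hT).prod hD.uniqueDiffOn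
  have hK : IsCompact (Icc 0 T ×ˢ closure D) := isCompact_Icc.prod hDb.isCompact_closure
  obtain ⟨M₀, hM₀⟩ := (hK.image_of_continuousOn hu.continuousOn).isBounded.exists_norm_le
  obtain ⟨M₁, hM₁⟩ := exists_bound_fderivWithin hK hSK hS hu
  have hUS : ContDiffOn ℝ 2 U S := hu.mono hSK
  set f₁ := fderivWithin ℝ U S with hf₁
  set f₂ := fderivWithin ℝ f₁ S with hf₂
  have hf₁c : ContDiffOn ℝ 1 f₁ S := hUS.fderivWithin hS (by norm_num)
  have hf₂c : ContinuousOn f₂ S := hf₁c.continuousOn_fderivWithin hS le_rfl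
  have h1 : ∀ z ∈ S, HasFDerivWithinAt U (f₁ z) S z := fun z hz =>
    (hUS.differentiableOn two_ne_zero z hz).hasFDerivWithinAt
  have h2 : ∀ z ∈ S, HasFDerivWithinAt f₁ (f₂ z) S z := fun z hz =>
    (hf₁c.differentiableOn one_ne_zero z hz).hasFDerivWithinAt
  let ι : Vec d →L[ℝ] ℝ × Vec d := ContinuousLinearMap.inr ℝ ℝ (Vec d)
  have hι : ‖ι‖ ≤ 1 := ContinuousLinearMap.opNorm_le_bound _ zero_le_one fun x => by
    simp [ι, Prod.norm_def]
  have hmk : ∀ (t : ℝ) (x : Vec d), HasFDerivAt (fun y : Vec d => (t, y)) ι x := fun t x =>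
    hasFDerivAt_prodMk_right t x
  have hsp : ∀ t ∈ Icc 0 T, ∀ x ∈ D, HasFDerivAt (u t) ((f₁ (t, x)).comp ι) x := by
    intro t ht x hx
    have := (h1 (t, x) ⟨ht, hx⟩).comp x (hmk t x).hasFDerivWithinAt (s := D)
      (fun y hy => ⟨ht, hy⟩)
    exact this.hasFDerivAt (hD.mem_nhds hx)
  -- Restriction to spatial directions as a bounded operator of norm at most one, so that
  -- differentiating the spatial gradient is a chain rule.
  let Λ : (ℝ × Vec d →L[ℝ] Vec d) →L[ℝ] (Vec d →L[ℝ] Vec d) :=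
    (ContinuousLinearMap.compL ℝ (Vec d) (ℝ × Vec d) (Vec d)).flip ι
  have hΛ : ∀ A, ‖Λ A‖ ≤ ‖A‖ := fun A =>
    (ContinuousLinearMap.opNorm_comp_le A ι).trans (mul_le_of_le_one_right (norm_nonneg _) hι)
  have hsp2 : ∀ t ∈ Icc 0 T, ∀ x ∈ D,
      HasFDerivAt (fderiv ℝ (u t)) (Λ.comp ((f₂ (t, x)).comp ι)) x := by
    intro t ht x hx
    have h3 : HasFDerivAt (fun y => f₁ (t, y)) ((f₂ (t, x)).comp ι) x :=
      ((h2 (t, x) ⟨ht, hx⟩).comp x (hmk t x).hasFDerivWithinAt (s := D)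
      (fun y hy => ⟨ht, hy⟩)).hasFDerivAt (hD.mem_nhds hx)
    have h4 := Λ.hasFDerivAt.comp x h3
    refine h4.congr_of_eventuallyEq ?_
    filter_upwards [hD.mem_nhds hx] with y hy
    exact (hsp t ht y hy).fderiv
  have hnorm10 : ‖((1 : ℝ), (0 : Vec d))‖ ≤ 1 := by simp [Prod.norm_def]
  have hmt : ∀ (t : ℝ) (x : Vec d), HasDerivAt (fun s : ℝ => (s, x)) ((1 : ℝ), (0 : Vec d)) t :=
    fun t x => (hasDerivAt_id t).prodMk (hasDerivAt_const t x)
  have htm : ∀ t ∈ Icc 0 T, ∀ x ∈ D,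
      HasDerivWithinAt (fun s => u s x) (f₁ (t, x) (1, 0)) (Icc 0 T) t := by
    intro t ht x hx
    exact (h1 (t, x) ⟨ht, hx⟩).comp_hasDerivWithinAt t (hmt t x).hasDerivWithinAt
      (show MapsTo (fun s : ℝ => (s, x)) (Icc 0 T) S from fun s hs => ⟨hs, hx⟩)
  have hu' := uniqueDiffOn_Icc hT
  have hvel : ∀ t ∈ Icc 0 T, ∀ x ∈ D, velocity T u t x = f₁ (t, x) (1, 0) := fun t ht x hx =>
    (htm t ht x hx).derivWithin (hu' t ht)
  have htm2 : ∀ t ∈ Icc 0 T, ∀ x ∈ D,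
      HasDerivWithinAt (fun s => velocity T u s x) (f₂ (t, x) (1, 0) (1, 0)) (Icc 0 T) t := by
    intro t ht x hx
    have h3 := (h2 (t, x) ⟨ht, hx⟩).comp_hasDerivWithinAt t (hmt t x).hasDerivWithinAt
      (show MapsTo (fun s : ℝ => (s, x)) (Icc 0 T) S from fun s hs => ⟨hs, hx⟩)
    have h4 : HasDerivWithinAt (fun s => f₁ (s, x) (1, 0)) (f₂ (t, x) (1, 0) (1, 0))
        (Icc 0 T) t := by
      have h5 := h3.clm_apply (hasDerivWithinAt_const t (Icc 0 T) ((1 : ℝ), (0 : Vec d)))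
      simpa using h5
    exact h4.congr (fun s hs => hvel s hs x hx) (hvel t ht x hx)
  have hacc : ∀ t ∈ Icc 0 T, ∀ x ∈ D, acceleration T u t x = f₂ (t, x) (1, 0) (1, 0) :=
    fun t ht x hx => (htm2 t ht x hx).derivWithin (hu' t ht)
  have hM₁0 : ∀ t ∈ Icc 0 T, ∀ x ∈ D, 0 ≤ M₁ := fun t ht x hx =>
    (norm_nonneg _).trans (hM₁ (t, x) ⟨ht, hx⟩).1
  refine ⟨max (max M₀ M₁) 0, le_max_right _ _, ?_⟩
  have hle0 : M₀ ≤ max (max M₀ M₁) 0 := (le_max_left _ _).trans (le_max_left _ _)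
  have hle1 : M₁ ≤ max (max M₀ M₁) 0 := (le_max_right _ _).trans (le_max_left _ _)
  constructor
  · intro t ht
    refine continuous_indicator (hbdry t ht) ?_
    exact hu.continuousOn.comp (f := fun y => (t, y)) (by fun_prop) fun y hy => ⟨ht, hy⟩
  · intro t ht
    exact hUS.comp (f := fun y => (t, y)) (by fun_prop) fun y hy => ⟨ht, hy⟩
  · intro t ht x hx
    exact (hM₀ _ ⟨(t, x), hSK ⟨ht, hx⟩, rfl⟩).trans hle0
  · intro t ht x hx
    rw [(hsp t ht x hx).fderiv]
    exact (hΛ _).trans ((hM₁ (t, x) ⟨ht, hx⟩).1.trans hle1)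
  · intro t ht x hx
    rw [(hsp2 t ht x hx).fderiv]
    refine le_trans ?_ ((hM₁ (t, x) ⟨ht, hx⟩).2.trans hle1)
    refine ContinuousLinearMap.opNorm_le_bound _ (norm_nonneg (f₂ (t, x))) fun v => (hΛ _).trans ?_
    refine ((f₂ (t, x)).le_opNorm (ι v)).trans ?_
    refine mul_le_mul_of_nonneg_left ?_ (norm_nonneg (f₂ (t, x)))
    simp [ι, Prod.norm_def]
  · intro t ht x hx
    rw [hvel t ht x hx]
    exact htm t ht x hx
  · intro t ht x hx
    rw [hacc t ht x hx]
    exact htm2 t ht x hx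
  · intro t ht x hx
    rw [hvel t ht x hx]
    refine (ContinuousLinearMap.le_opNorm _ _).trans ?_
    exact (mul_le_of_le_one_right (norm_nonneg _) hnorm10).trans
      ((hM₁ (t, x) ⟨ht, hx⟩).1.trans hle1)
  · intro t ht x hx
    rw [hacc t ht x hx]
    refine (ContinuousLinearMap.le_opNorm₂ _ _ _).trans ?_
    refine le_trans ?_ ((hM₁ (t, x) ⟨ht, hx⟩).2.trans hle1)
    exact (mul_le_of_le_one_right (by positivity) hnorm10).trans
      (mul_le_of_le_one_right (norm_nonneg (f₂ (t, x))) hnorm10)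
  · intro x hx a b k
    have h3 : ContinuousOn (fun t => f₂ (t, x) (0, EuclideanSpace.single a 1)
        (0, EuclideanSpace.single b 1) k) (Icc 0 T) := by
      have h4 : ContinuousOn (fun t => f₂ (t, x)) (Icc 0 T) :=
        hf₂c.comp (f := fun t => (t, x)) (by fun_prop) fun t ht => ⟨ht, hx⟩
      exact (EuclideanSpace.proj k : Vec d →L[ℝ] ℝ).continuous.comp_continuousOn
        ((h4.clm_apply continuousOn_const).clm_apply continuousOn_const)
    refine h3.congr fun t ht => ?_
    simp only [Peridynamics.secondPartial, (hsp2 t ht x hx).fderiv]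
    rfl

lemma RegularMotion.dirichletField {M : ℝ} {u : ℝ → Vec d → Vec d} (hu : RegularMotion D T M u)
    (hD : IsOpen D) {t : ℝ} (ht : t ∈ Icc 0 T) : DirichletField D (D.indicator (u t)) := by
  refine ⟨hu.continuous t ht, fun x hx => indicator_of_notMem hx _,
    (hu.contDiffOn t ht).congr fun x hx => indicator_of_mem hx _, M, fun x hx => ?_⟩
  have h := indicator_eventuallyEq hD (u t) hx
  rw [h.fderiv_eq, h.fderiv.fderiv_eq]
  exact ⟨hu.fderiv_le t ht x hx, hu.fderiv_fderiv_le t ht x hx⟩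

lemma velocity_sub_of_mem (hT : 0 < T) {u v e : ℝ → Vec d → Vec d} {M N : ℝ}
    (hu : RegularMotion D T M u) (hv : RegularMotion D T N v)
    (he : ∀ t x, e t x = u t x - v t x) {t : ℝ} (ht : t ∈ Icc 0 T) {x : Vec d} (hx : x ∈ D) :
    velocity T e t x = velocity T u t x - velocity T v t x := by
  have h : (fun s => e s x) = (fun s => u s x) - fun s => v s x := funext fun s => he s x
  rw [velocity, h]
  exact ((hu.hasDeriv t ht x hx).sub (hv.hasDeriv t ht x hx)).derivWithin
    (uniqueDiffOn_Icc hT t ht)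

lemma hasDerivWithinAt_velocity_sub (hT : 0 < T) {u v e : ℝ → Vec d → Vec d} {M N : ℝ}
    (hu : RegularMotion D T M u) (hv : RegularMotion D T N v)
    (he : ∀ t x, e t x = u t x - v t x) {t : ℝ} (ht : t ∈ Icc 0 T) {x : Vec d} (hx : x ∈ D) :
    HasDerivWithinAt (fun s => velocity T e s x)
      (acceleration T u t x - acceleration T v t x) (Icc 0 T) t :=
  ((hu.hasDeriv_velocity t ht x hx).sub (hv.hasDeriv_velocity t ht x hx)).congr
    (fun _ hs => velocity_sub_of_mem hT hu hv he hs hx) (velocity_sub_of_mem hT hu hv he ht hx)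

lemma acceleration_sub_of_mem (hT : 0 < T) {u v e : ℝ → Vec d → Vec d} {M N : ℝ}
    (hu : RegularMotion D T M u) (hv : RegularMotion D T N v)
    (he : ∀ t x, e t x = u t x - v t x) {t : ℝ} (ht : t ∈ Icc 0 T) {x : Vec d} (hx : x ∈ D) :
    acceleration T e t x = acceleration T u t x - acceleration T v t x :=
  (hasDerivWithinAt_velocity_sub hT hu hv he ht hx).derivWithin (uniqueDiffOn_Icc hT t ht)

section SubPointwise

variable {v w : Vec d → Vec d} {x : Vec d}

lemma fderiv_fderiv_sub (hv : ContDiffAt ℝ 2 v x) (hw : ContDiffAt ℝ 2 w x) :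
    fderiv ℝ (fderiv ℝ (v - w)) x = fderiv ℝ (fderiv ℝ v) x - fderiv ℝ (fderiv ℝ w) x := by
  have h : fderiv ℝ (v - w) =ᶠ[𝓝 x] fderiv ℝ v - fderiv ℝ w := by
    filter_upwards [hv.eventually (by simp), hw.eventually (by simp)] with y hy hy'
    exact fderiv_sub (hy.differentiableAt two_ne_zero) (hy'.differentiableAt two_ne_zero)
  rw [h.fderiv_eq]
  exact fderiv_sub (ContDiffAt.differentiableAt_fderiv hv) (ContDiffAt.differentiableAt_fderiv hw)

lemma secondPartial_sub (hv : ContDiffAt ℝ 2 v x) (hw : ContDiffAt ℝ 2 w x) (a b k : Fin d) :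
    secondPartial a b (v - w) x k = secondPartial a b v x k - secondPartial a b w x k := by
  simp only [secondPartial, fderiv_fderiv_sub hv hw, sub_apply, PiLp.sub_apply]

lemma elasticForce_sub (f J : ℝ → ℝ) (hv : ContDiffAt ℝ 2 v x) (hw : ContDiffAt ℝ 2 w x) :
    elasticForce f J (v - w) x = elasticForce f J v x - elasticForce f J w x := by
  ext i
  rw [PiLp.sub_apply, elasticForce_apply f J hv, elasticForce_apply f J hw,
    elasticForce_apply f J (v := v - w) (hv.sub hw)]
  simp only [secondPartial_sub hv hw, mul_sub, Finset.sum_sub_distrib]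

end SubPointwise

lemma RegularMotion.contDiffAt {M : ℝ} {u : ℝ → Vec d → Vec d} (hu : RegularMotion D T M u)
    (hD : IsOpen D) {t : ℝ} (ht : t ∈ Icc 0 T) {x : Vec d} (hx : x ∈ D) :
    ContDiffAt ℝ 2 (u t) x :=
  (hu.contDiffOn t ht).contDiffAt (hD.mem_nhds hx)

lemma RegularMotion.sub (hD : IsOpen D) (hT : 0 < T) {u v e : ℝ → Vec d → Vec d} {M N : ℝ}
    (hu : RegularMotion D T M u) (hv : RegularMotion D T N v)
    (he : ∀ t x, e t x = u t x - v t x) : RegularMotion D T (M + N) e := by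
  have hed : ∀ t, e t = u t - v t := fun t => funext (he t)
  have hcu := fun t (ht : t ∈ Icc 0 T) x (hx : x ∈ D) => hu.contDiffAt hD ht hx
  have hcv := fun t (ht : t ∈ Icc 0 T) x (hx : x ∈ D) => hv.contDiffAt hD ht hx
  constructor
  · intro t ht
    rw [hed, indicator_sub']
    exact (hu.continuous t ht).sub (hv.continuous t ht)
  · intro t ht
    rw [hed]
    exact (hu.contDiffOn t ht).sub (hv.contDiffOn t ht)
  · intro t ht x hx
    rw [he]
    exact (norm_sub_le _ _).trans (add_le_add (hu.norm_le t ht x hx) (hv.norm_le t ht x hx))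
  · intro t ht x hx
    rw [hed, fderiv_sub ((hcu t ht x hx).differentiableAt two_ne_zero)
      ((hcv t ht x hx).differentiableAt two_ne_zero)]
    exact (norm_sub_le _ _).trans (add_le_add (hu.fderiv_le t ht x hx) (hv.fderiv_le t ht x hx))
  · intro t ht x hx
    rw [hed, fderiv_fderiv_sub (hcu t ht x hx) (hcv t ht x hx)]
    exact (norm_sub_le (fderiv ℝ (fderiv ℝ (u t)) x) (fderiv ℝ (fderiv ℝ (v t)) x)).trans
      (add_le_add (hu.fderiv_fderiv_le t ht x hx) (hv.fderiv_fderiv_le t ht x hx))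
  · intro t ht x hx
    rw [velocity_sub_of_mem hT hu hv he ht hx]
    have h : (fun s => e s x) = (fun s => u s x) - fun s => v s x := funext fun s => he s x
    rw [h]
    exact (hu.hasDeriv t ht x hx).sub (hv.hasDeriv t ht x hx)
  · intro t ht x hx
    rw [acceleration_sub_of_mem hT hu hv he ht hx]
    exact hasDerivWithinAt_velocity_sub hT hu hv he ht hx
  · intro t ht x hx
    rw [velocity_sub_of_mem hT hu hv he ht hx]
    exact (norm_sub_le _ _).trans
      (add_le_add (hu.velocity_le t ht x hx) (hv.velocity_le t ht x hx))
  · intro t ht x hx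
    rw [acceleration_sub_of_mem hT hu hv he ht hx]
    exact (norm_sub_le _ _).trans
      (add_le_add (hu.acceleration_le t ht x hx) (hv.acceleration_le t ht x hx))
  · intro x hx a b k
    refine ((hu.secondPartial x hx a b k).sub (hv.secondPartial x hx a b k)).congr fun t ht => ?_
    simp only [hed]
    exact secondPartial_sub (hcu t ht x hx) (hcv t ht x hx) a b k

end Peridynamics

/-! ### Uniform regularity of peridynamic solutions -/

namespace Peridynamics

variable {d : ℕ} {D : Set (Vec d)} {T : ℝ}

lemma norm_le_sum_abs (v : Vec d) : ‖v‖ ≤ ∑ i, |v i| := by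
  have h : v = ∑ i, v i • (EuclideanSpace.single i (1 : ℝ) : Vec d) := by
    ext i; simp [Finset.sum_apply, Pi.single_apply]
  calc ‖v‖ = ‖∑ i, v i • (EuclideanSpace.single i (1 : ℝ) : Vec d)‖ := by rw [← h]
    _ ≤ ∑ i, ‖v i • (EuclideanSpace.single i (1 : ℝ) : Vec d)‖ := norm_sum_le _ _
    _ = ∑ i, |v i| := by simp [norm_smul]

lemma IsIsotropic.norm_elasticForce_le {f J : ℝ → ℝ} {β : ℝ} (hC : IsIsotropic d f J β)
    (hβ : 0 ≤ β) {v : Vec d → Vec d} {x : Vec d} (hv : ContDiffAt ℝ 2 v x) :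
    ‖elasticForce f J v x‖ ≤ d * (β * (d * 3)) * ‖fderiv ℝ (fderiv ℝ v) x‖ := by
  set H := ‖fderiv ℝ (fderiv ℝ v) x‖
  have h1 : ∀ i, |elasticForce f J v x i| ≤ β * (d * 3) * H := by
    intro i
    rw [hC.elasticForce_apply hv, abs_mul, abs_of_nonneg hβ, mul_assoc]
    refine mul_le_mul_of_nonneg_left ?_ hβ
    refine (Finset.abs_sum_le_sum_abs _ _).trans ?_
    have h2 : ∀ j ∈ (Finset.univ : Finset (Fin d)), |secondPartial i j v x j
        + secondPartial j j v x i + secondPartial j i v x j| ≤ 3 * H := by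
      intro j _
      have a1 := abs_secondPartial_le v x i j j
      have a2 := abs_secondPartial_le v x j j i
      have a3 := abs_secondPartial_le v x j i j
      have a4 := abs_add_three (secondPartial i j v x j) (secondPartial j j v x i)
        (secondPartial j i v x j)
      linarith
    refine (Finset.sum_le_sum h2).trans ?_
    simp [mul_assoc]
  refine (norm_le_sum_abs _).trans ((Finset.sum_le_sum fun i _ => h1 i).trans ?_)
  simp [mul_assoc]

/-- The ball is connected and misses the frontier, so it cannot meet both D and the exterior. -/
lemma ball_subset_of_lt_infDist (hD : IsOpen D) {ε : ℝ} (hε : 0 < ε) {x : Vec d} (hx : x ∈ D)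
    (h : ε < Metric.infDist x (frontier D)) : Metric.ball x ε ⊆ D := by
  have hcov : Metric.ball x ε ⊆ D ∪ (closure D)ᶜ := by
    intro z hz
    by_contra hzc
    simp only [mem_union, mem_compl_iff, not_or, not_not] at hzc
    have hzf : z ∈ frontier D := ⟨hzc.2, by rw [hD.interior_eq]; exact hzc.1⟩
    have h1 := Metric.infDist_le_dist_of_mem (x := x) hzf
    rw [Metric.mem_ball, dist_comm] at hz
    linarith
  intro y hy
  rcases hcov hy with hyD | hyD
  · exact hyD
  · obtain ⟨z, -, hz1, hz2⟩ := (convex_ball x ε).isPreconnected D (closure D)ᶜ hD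
      isClosed_closure.isOpen_compl hcov ⟨x, Metric.mem_ball_self hε, hx⟩ ⟨y, hy, hyD⟩
    exact absurd (subset_closure hz1) hz2

/-- Off the collar the force sees only values inside D, so uε may be replaced by its zero extension,
to which the consistency estimate for globally smooth fields applies. -/
lemma nonlocalForce_indicator (hD : IsOpen D) (f J : ℝ → ℝ) {ε : ℝ} (hε : 0 < ε) {x : Vec d} (hx : x ∈ D)
    (h : ε < Metric.infDist x (frontier D)) (g : Vec d → Vec d) :
    nonlocalForce f J ε (D.indicator g) x = nonlocalForce f J ε g x := by
  unfold nonlocalForce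
  congr 1
  refine setIntegral_congr_fun measurableSet_ball fun y hy => ?_
  have hy' := ball_subset_of_lt_infDist hD hε hx h hy
  simp only [bondStrain, indicator_of_mem hx, indicator_of_mem hy']

/-- Pointwise continuity in time passes to second derivatives under uniform spatial bounds. -/
lemma continuousOn_fderiv_fderiv_diag {B : ℝ} {I : Set ℝ} {w : ℝ → Vec d → Vec d}
    (hw : ∀ s ∈ I, BoundedDerivs B (w s)) (hc : ∀ y, ContinuousOn (fun s => w s y) I)
    (x v : Vec d) : ContinuousOn (fun s => fderiv ℝ (fderiv ℝ (w s)) x v v) I := by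
  intro t ht
  have hB := (hw t ht).nonneg
  rw [ContinuousWithinAt, Metric.tendsto_nhds]
  intro η hη
  -- h is fixed first, making the two Taylor remainders together, divided by h², less than η/2. At
  -- this h the second difference uses three points only, so pointwise continuity in time suffices.
  obtain ⟨h, hh, hhη⟩ : ∃ h : ℝ, 0 < h ∧ 4 * B * ‖v‖ ^ 3 * h < η / 2 := by
    refine ⟨η / 2 / (4 * B * ‖v‖ ^ 3 + 1), by positivity, ?_⟩
    rw [mul_div_assoc', div_lt_iff₀ (by positivity)]
    nlinarith [show 0 ≤ 4 * B * ‖v‖ ^ 3 by positivity]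
  let Δ : ℝ → Vec d := fun s => w s (x + h • v) + w s (x - h • v) - (2 : ℝ) • w s x
  have hΔ : ContinuousWithinAt Δ I t :=
    ((hc _ t ht).add (hc _ t ht)).sub ((hc _ t ht).const_smul (2 : ℝ))
  have hev : ∀ᶠ s in 𝓝[I] t, dist (Δ s) (Δ t) < h ^ 2 * (η / 2) :=
    Metric.tendsto_nhds.1 hΔ _ (by positivity)
  filter_upwards [hev, self_mem_nhdsWithin] with s hs hsI
  have key : ∀ s ∈ I, ‖Δ s - h ^ 2 • fderiv ℝ (fderiv ℝ (w s)) x v v‖ ≤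
      2 * B * (h ^ 3 * ‖v‖ ^ 3) := by
    intro s hsI
    have := norm_second_difference_sub_le (hw s hsI).nonneg (hw s hsI).contDiff
      (hw s hsI).lipschitz x (h • v)
    rw [norm_smul, Real.norm_of_nonneg hh.le, mul_pow] at this
    simpa [Δ, smul_smul, sq] using this
  have k1 := key s hsI
  have k2 := key t ht
  rw [dist_eq_norm] at hs ⊢
  set Hs := fderiv ℝ (fderiv ℝ (w s)) x v v
  set Ht := fderiv ℝ (fderiv ℝ (w t)) x v v
  have e : h ^ 2 • (Hs - Ht) = (Δ s - Δ t) - (Δ s - h ^ 2 • Hs) + (Δ t - h ^ 2 • Ht) := by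
    rw [smul_sub]; abel
  have h2 : h ^ 2 * ‖Hs - Ht‖ ≤ ‖Δ s - Δ t‖ + 4 * B * (h ^ 3 * ‖v‖ ^ 3) := by
    have h3 : h ^ 2 * ‖Hs - Ht‖ = ‖h ^ 2 • (Hs - Ht)‖ := by
      rw [norm_smul, Real.norm_of_nonneg (by positivity)]
    rw [h3, e]
    have a1 := norm_add_le (Δ s - Δ t - (Δ s - h ^ 2 • Hs)) (Δ t - h ^ 2 • Ht)
    have a2 := norm_sub_le (Δ s - Δ t) (Δ s - h ^ 2 • Hs)
    linarith
  have hh2 : 0 < h ^ 2 := by positivity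
  have h4 : h ^ 2 * ‖Hs - Ht‖ < h ^ 2 * η := by
    calc _ ≤ ‖Δ s - Δ t‖ + 4 * B * (h ^ 3 * ‖v‖ ^ 3) := h2
      _ < h ^ 2 * (η / 2) + h ^ 2 * (η / 2) := by
        refine add_lt_add hs ?_
        calc 4 * B * (h ^ 3 * ‖v‖ ^ 3) = h ^ 2 * (4 * B * ‖v‖ ^ 3 * h) := by ring
          _ < _ := mul_lt_mul_of_pos_left hhη hh2
      _ = h ^ 2 * η := by ring
  exact lt_of_mul_lt_mul_left h4 hh2.le

/-- Polarization of the symmetric second derivative H: H(p, p) - H(m, m) = 4 H(a, b). -/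
lemma continuousOn_secondPartial_time {B : ℝ} {I : Set ℝ} {w : ℝ → Vec d → Vec d}
    (hw : ∀ s ∈ I, BoundedDerivs B (w s)) (hc : ∀ y, ContinuousOn (fun s => w s y) I)
    (x : Vec d) (a b k : Fin d) : ContinuousOn (fun s => secondPartial a b (w s) x k) I := by
  let p : Vec d := EuclideanSpace.single a 1 + EuclideanSpace.single b 1
  let m : Vec d := EuclideanSpace.single a 1 - EuclideanSpace.single b 1
  have hp := continuousOn_fderiv_fderiv_diag hw hc x p
  have hm := continuousOn_fderiv_fderiv_diag hw hc x m
  have h := (EuclideanSpace.proj k : Vec d →L[ℝ] ℝ).continuous.comp_continuousOn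
    ((hp.sub hm).const_smul ((4 : ℝ)⁻¹))
  refine h.congr fun s hs => ?_
  have hsym := ((hw s hs).contDiff.contDiffAt (x := x)).isSymmSndFDerivAt (by simp)
  have hsw := hsym (EuclideanSpace.single b 1) (EuclideanSpace.single a 1)
  simp only [secondPartial, Function.comp_apply]
  change _ = ((4 : ℝ)⁻¹ • (fderiv ℝ (fderiv ℝ (w s)) x p p - fderiv ℝ (fderiv ℝ (w s)) x m m)) k
  simp only [p, m, map_add, map_sub, add_apply, sub_apply, hsw, PiLp.smul_apply, PiLp.sub_apply,
    PiLp.add_apply, smul_eq_mul]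
  ring

section Peridynamic

variable {f J : ℝ → ℝ} {β ρ M C : ℝ} {b : ℝ → Vec d → Vec d} {u₀ v₀ : Vec d → Vec d}
  {u : ℝ → Vec d → Vec d}

/-- Peridynamic solutions with uniformly bounded fourth derivatives are regular motions, uniformly
in the horizon, and the nonlocal force is consistent with the elastic force along them. -/
lemma exists_regularMotion_peridynamic (hd : 0 < d) (hf : IsPotential f) (hJ : IsInfluence J)
    (hC : IsIsotropic d f J β) (hβ : 0 ≤ β) (hD : IsOpen D) (hDb : Bornology.IsBounded D)
    (hT : 0 < T) (hρ : 0 < ρ) (hM : 0 ≤ M) (hu : RegularMotion D T M u)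
    (hsol : IsElastodynamicSolution f J D T ρ b u₀ v₀ u) (C : ℝ) :
    ∃ N K, 0 ≤ N ∧ 0 ≤ K ∧ ∀ ε, 0 < ε → ∀ uε : ℝ → Vec d → Vec d,
      IsPeridynamicSolution f J D T ρ ε b u₀ v₀ uε →
      (∀ t ∈ Icc 0 T, CollarField D C ε (uε t)) →
      RegularMotion D T N uε ∧ ∀ t ∈ Icc 0 T, ∀ x ∈ D, ε < Metric.infDist x (frontier D) →
        ‖nonlocalForce f J ε (uε t) x - elasticForce f J (uε t) x‖ ≤ K * ε := by
  obtain ⟨R, hR0, hR⟩ : ∃ R, 0 ≤ R ∧ ∀ x ∈ D, ∀ p ∈ frontier D, ‖x - p‖ ≤ R := by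
    refine ⟨Metric.diam (closure D), Metric.diam_nonneg, fun x hx p hp => ?_⟩
    rw [← dist_eq_norm]
    exact Metric.dist_le_diam_of_mem hDb.closure (subset_closure hx) (frontier_subset_closure hp)
  set B := collarBound C R with hBdef
  have hB : 0 ≤ B := by rw [hBdef, collarBound]; positivity
  obtain ⟨K, hK0, hK⟩ := exists_norm_nonlocalForce_sub_elasticForce_le d hf hJ hB R
  set c : ℝ := d * (β * (d * 3)) with hc
  have hc0 : 0 ≤ c := by positivity
  -- A bounds the acceleration: KR for the consistency gap, cB for the elastic force of uε, and ρM +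
  -- cM for b. The velocity bound M + AT then follows from the common initial velocity.
  set A : ℝ := ρ⁻¹ * (K * R + c * B + (ρ * M + c * M)) with hA
  have hA0 : 0 ≤ A := by positivity
  refine ⟨B + (M + A * T) + A, K, by positivity, hK0, fun ε hε uε hper hcol => ?_⟩
  have hbd := fun t (ht : t ∈ Icc 0 T) => (hcol t ht).boundedDerivs hd hD hDb hε hR0 hR
  have hloc := fun t x (hx : x ∈ D) => indicator_eventuallyEq hD (uε t) hx
  have hcd : ∀ t ∈ Icc 0 T, ∀ x ∈ D, ContDiffAt ℝ 2 (uε t) x := fun t ht x hx =>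
    ((hcol t ht).contDiffOn.contDiffAt (hD.mem_nhds hx)).of_le (by norm_num)
  have hef : ∀ t ∈ Icc 0 T, ∀ x ∈ D,
      elasticForce f J (D.indicator (uε t)) x = elasticForce f J (uε t) x := by
    intro t ht x hx
    ext i
    rw [elasticForce_apply f J (hbd t ht).1.contDiff.contDiffAt,
      elasticForce_apply f J (hcd t ht x hx)]
    simp only [secondPartial, (hloc t x hx).fderiv.fderiv_eq]
  have hεR : ∀ x ∈ D, ε < Metric.infDist x (frontier D) → ε ≤ R := by
    intro x hx h
    obtain ⟨p, hp, he⟩ := exists_frontier_infDist_eq hd hDb hx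
    rw [he] at h
    exact h.le.trans (hR x hx p hp)
  have hcons : ∀ t ∈ Icc 0 T, ∀ x ∈ D, ε < Metric.infDist x (frontier D) →
      ‖nonlocalForce f J ε (uε t) x - elasticForce f J (uε t) x‖ ≤ K * ε := by
    intro t ht x hx h
    rw [← nonlocalForce_indicator hD f J hε hx h, ← hef t ht x hx]
    exact hK ε hε (hεR x hx h) _ (hbd t ht).1 x
  refine ⟨?_, hcons⟩
  have hu' := uniqueDiffOn_Icc hT
  have hvel : ∀ t ∈ Icc 0 T, ∀ x ∈ D,
      HasDerivWithinAt (fun s => uε s x) (velocity T uε t x) (Icc 0 T) t := fun t ht x hx =>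
    ((hper.regular x hx).differentiableOn two_ne_zero t ht).hasDerivWithinAt
  have hacc : ∀ t ∈ Icc 0 T, ∀ x ∈ D,
      HasDerivWithinAt (fun s => velocity T uε s x) (acceleration T uε t x) (Icc 0 T) t :=
    fun t ht x hx => ((((hper.regular x hx).derivWithin hu' (m := 1) (by norm_num)).differentiableOn
      one_ne_zero) t ht).hasDerivWithinAt
  have haccle : ∀ t ∈ Icc 0 T, ∀ x ∈ D, ‖acceleration T uε t x‖ ≤ A := by
    intro t ht x hx
    rcases lt_or_ge ε (Metric.infDist x (frontier D)) with h | h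
    · have e1 := hper.equation t ht x hx h
      have e2 := hsol.equation t ht x hx
      -- No bound on b is assumed; the equation for u supplies one.
      have hb : b t x = ρ • acceleration T u t x - elasticForce f J (u t) x := by
        rw [e2]; abel
      have h1 : ‖ρ • acceleration T uε t x‖ ≤ K * R + c * B + (ρ * M + c * M) := by
        have e3 : ρ • acceleration T uε t x =
            (nonlocalForce f J ε (uε t) x - elasticForce f J (uε t) x)
            + elasticForce f J (uε t) x
            + (ρ • acceleration T u t x - elasticForce f J (u t) x) := by
          rw [e1, hb]; abel
        rw [e3]
        refine (norm_add_le _ _).trans (add_le_add ((norm_add_le _ _).trans (add_le_add ?_ ?_))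
          ((norm_sub_le _ _).trans (add_le_add ?_ ?_)))
        · exact (hcons t ht x hx h).trans (mul_le_mul_of_nonneg_left (hεR x hx h) hK0)
        · rw [← hef t ht x hx]
          exact (hC.norm_elasticForce_le hβ (hbd t ht).1.contDiff.contDiffAt).trans
            (mul_le_mul_of_nonneg_left ((hbd t ht).1.fderiv_fderiv_le x) hc0)
        · rw [norm_smul, Real.norm_of_nonneg hρ.le]
          exact mul_le_mul_of_nonneg_left (hu.acceleration_le t ht x hx) hρ.le
        · exact (hC.norm_elasticForce_le hβ (hu.contDiffAt hD ht hx)).trans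
            (mul_le_mul_of_nonneg_left (hu.fderiv_fderiv_le t ht x hx) hc0)
      rw [norm_smul, Real.norm_of_nonneg hρ.le] at h1
      rw [hA, inv_mul_eq_div, le_div_iff₀ hρ, mul_comm]
      exact h1
    -- In the collar the equation is not available, but uε is zero there at all times.
    · have hz : ∀ s ∈ Icc 0 T, velocity T uε s x = 0 := by
        intro s hs
        have h1 := (hasDerivWithinAt_const s (Icc 0 T) (0 : Vec d)).congr (f₁ := fun s => uε s x)
          (fun r hr => hper.boundary r hr x h) (hper.boundary s hs x h)
        exact h1.derivWithin (hu' s hs)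
      have h2 := (hasDerivWithinAt_const t (Icc 0 T) (0 : Vec d)).congr
        (f₁ := fun s => velocity T uε s x) hz (hz t ht)
      have h3 : acceleration T uε t x = 0 := h2.derivWithin (hu' t ht)
      rw [h3, norm_zero]
      exact hA0
  have h0T : (0 : ℝ) ∈ Icc 0 T := ⟨le_rfl, hT.le⟩
  have hvelle : ∀ t ∈ Icc 0 T, ∀ x ∈ D, ‖velocity T uε t x‖ ≤ M + A * T := by
    intro t ht x hx
    have h1 := (convex_Icc (0 : ℝ) T).norm_image_sub_le_of_norm_hasDerivWithin_le
      (f := fun s => velocity T uε s x) (C := A) (fun s hs => hacc s hs x hx)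
      (fun s hs => haccle s hs x hx) h0T ht
    have h2 : velocity T uε 0 x = velocity T u 0 x := by
      rw [hper.initial_velocity x hx, hsol.initial_velocity x hx]
    have h3 : ‖velocity T uε 0 x‖ ≤ M := by
      rw [h2]; exact hu.velocity_le 0 h0T x hx
    have h4 : ‖velocity T uε t x‖ ≤ ‖velocity T uε t x - velocity T uε 0 x‖
        + ‖velocity T uε 0 x‖ := by
      have := norm_add_le (velocity T uε t x - velocity T uε 0 x) (velocity T uε 0 x)
      simpa using this
    have h5 : A * ‖t - 0‖ ≤ A * T := by
      refine mul_le_mul_of_nonneg_left ?_ hA0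
      rw [sub_zero, Real.norm_of_nonneg ht.1]; exact ht.2
    linarith
  have hMA : 0 ≤ M + A * T := by positivity
  have hwc : ∀ y, ContinuousOn (fun s => D.indicator (uε s) y) (Icc 0 T) := by
    intro y
    by_cases hy : y ∈ D
    · simp only [indicator_of_mem hy]
      exact (hper.regular y hy).continuousOn
    · simp only [indicator_of_notMem hy]
      exact continuousOn_const
  constructor
  · exact fun t ht => (hbd t ht).1.contDiff.continuous
  · exact fun t ht => (hcol t ht).contDiffOn.of_le (by norm_num)
  · intro t ht x hx
    have := (hbd t ht).2 x
    rw [indicator_of_mem hx] at this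
    linarith
  · intro t ht x hx
    have := (hbd t ht).1.fderiv_le x
    rw [(hloc t x hx).fderiv_eq] at this
    linarith
  · intro t ht x hx
    have := (hbd t ht).1.fderiv_fderiv_le x
    rw [(hloc t x hx).fderiv.fderiv_eq] at this
    linarith
  · exact hvel
  · exact hacc
  · intro t ht x hx
    have := hvelle t ht x hx
    linarith
  · intro t ht x hx
    have := haccle t ht x hx
    linarith
  · intro x hx a b k
    refine (continuousOn_secondPartial_time (fun s hs => (hbd s hs).1) hwc x a b k).congr
      fun s hs => ?_
    simp only [secondPartial, (hloc s x hx).fderiv.fderiv_eq]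

end Peridynamic

end Peridynamics

/-! ### The energy and its increments -/

namespace Peridynamics

variable {d : ℕ} {D : Set (Vec d)} {T : ℝ}

lemma slope_filter_neBot (hT : 0 < T) {t : ℝ} (ht : t ∈ Icc 0 T) : (𝓝[Icc 0 T \ {t}] t).NeBot := by
  have h := (uniqueDiffOn_Icc hT t ht).accPt
  rwa [accPt_principal_iff_nhdsWithin] at h

/-- Time derivatives are taken point by point; they are measurable in space as limits of measurable
difference quotients. -/
lemma aestronglyMeasurable_timeDeriv (hD : IsOpen D) (hT : 0 < T) {F : ℝ → Vec d → Vec d}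
    {F' : Vec d → Vec d} {t : ℝ} (ht : t ∈ Icc 0 T)
    (hF : ∀ s ∈ Icc 0 T, AEStronglyMeasurable (F s) (volume.restrict D))
    (hF' : ∀ x ∈ D, HasDerivWithinAt (fun s => F s x) (F' x) (Icc 0 T) t) :
    AEStronglyMeasurable F' (volume.restrict D) := by
  classical
  have := slope_filter_neBot hT ht
  refine aestronglyMeasurable_of_tendsto_ae (𝓝[Icc 0 T \ {t}] t)
    (f := fun s x => if s ∈ Icc 0 T then (s - t)⁻¹ • (F s x - F t x) else 0) (fun s => ?_) ?_
  · by_cases hs : s ∈ Icc 0 T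
    · simp only [hs, if_true]
      exact ((hF s hs).sub (hF t ht)).const_smul ((s - t)⁻¹)
    · simp only [hs, if_false]
      exact aestronglyMeasurable_const
  · refine (ae_restrict_iff' hD.measurableSet).2 (Eventually.of_forall fun x hx => ?_)
    have h := hasDerivWithinAt_iff_tendsto_slope.1 (hF' x hx)
    refine h.congr' ?_
    filter_upwards [self_mem_nhdsWithin] with s hs
    simp [hs.1, slope_def_module]

lemma continuousOn_elasticForce {f J : ℝ → ℝ} (hD : IsOpen D) {v : Vec d → Vec d}
    (hv : ContDiffOn ℝ 2 v D) : ContinuousOn (elasticForce f J v) D := by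
  have h : ContinuousOn (fun x => WithLp.toLp 2 fun i => ∑ j, ∑ k, ∑ l,
      elasticTensor d f J i j k l * secondPartial j l v x k) D := by
    refine (PiLp.continuous_toLp 2 fun _ : Fin d => ℝ).comp_continuousOn ?_
    refine continuousOn_pi.2 fun i => continuousOn_finsetSum _ fun j _ =>
      continuousOn_finsetSum _ fun k _ => continuousOn_finsetSum _ fun l _ => ?_
    exact continuousOn_const.mul (continuousOn_secondPartial hD hv j l k)
  refine h.congr fun x hx => ?_
  ext i
  exact elasticForce_apply f J (hv.contDiffAt (hD.mem_nhds hx)) i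

lemma RegularMotion.continuousOn_elasticForce {f J : ℝ → ℝ} {M : ℝ} {e : ℝ → Vec d → Vec d}
    (he : RegularMotion D T M e) (hD : IsOpen D) {x : Vec d} (hx : x ∈ D) :
    ContinuousOn (fun t => elasticForce f J (e t) x) (Icc 0 T) := by
  have h : ContinuousOn (fun t => WithLp.toLp 2 fun i => ∑ j, ∑ k, ∑ l,
      elasticTensor d f J i j k l * Peridynamics.secondPartial j l (e t) x k) (Icc 0 T) := by
    refine (PiLp.continuous_toLp 2 fun _ : Fin d => ℝ).comp_continuousOn ?_
    refine continuousOn_pi.2 fun i => continuousOn_finsetSum _ fun j _ =>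
      continuousOn_finsetSum _ fun k _ => continuousOn_finsetSum _ fun l _ => ?_
    exact continuousOn_const.mul (he.secondPartial x hx j l k)
  refine h.congr fun t ht => ?_
  ext i
  exact elasticForce_apply f J (he.contDiffAt hD ht hx) i

lemma elasticForce_indicator {f J : ℝ → ℝ} (hD : IsOpen D) {v : Vec d → Vec d} {x : Vec d}
    (hx : x ∈ D) (hv : ContDiffAt ℝ 2 v x) :
    elasticForce f J (D.indicator v) x = elasticForce f J v x := by
  have hloc := indicator_eventuallyEq hD v hx
  ext i
  rw [elasticForce_apply f J (hv.congr_of_eventuallyEq hloc), elasticForce_apply f J hv]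
  simp only [secondPartial, hloc.fderiv.fderiv_eq]

lemma pairing_indicator (hD : IsOpen D) (v w : Vec d → Vec d) {x : Vec d} (hx : x ∈ D) :
    pairing (D.indicator v) (D.indicator w) x = pairing v w x := by
  simp only [pairing, partialDeriv, (indicator_eventuallyEq hD v hx).fderiv_eq,
    (indicator_eventuallyEq hD w hx).fderiv_eq]

section Energy

variable {f J : ℝ → ℝ} {β ρ M : ℝ} {e : ℝ → Vec d → Vec d}

/-- The total energy of a motion, augmented by its mean square displacement. -/
noncomputable def energy (D : Set (Vec d)) (T ρ β : ℝ) (e : ℝ → Vec d → Vec d) (t : ℝ) : ℝ :=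
  (∫ x in D, (ρ * ‖e t x‖ ^ 2 + ρ * ‖velocity T e t x‖ ^ 2)) + β * ∫ x in D, pairing (e t) (e t) x

lemma integrableOn_of_bound (hDb : Bornology.IsBounded D) (hD : IsOpen D)
    {F : Type*} [NormedAddCommGroup F] {g : Vec d → F}
    (hg : AEStronglyMeasurable g (volume.restrict D)) {C : ℝ} (hC : ∀ x ∈ D, ‖g x‖ ≤ C) :
    IntegrableOn g D :=
  IntegrableOn.of_bound hDb.measure_lt_top hg C
    ((ae_restrict_iff' hD.measurableSet).2 (Eventually.of_forall hC))

lemma RegularMotion.aestronglyMeasurable (he : RegularMotion D T M e) (hD : IsOpen D) {t : ℝ}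
    (ht : t ∈ Icc 0 T) : AEStronglyMeasurable (e t) (volume.restrict D) :=
  (he.contDiffOn t ht).continuousOn.aestronglyMeasurable hD.measurableSet

lemma RegularMotion.aestronglyMeasurable_velocity (he : RegularMotion D T M e) (hD : IsOpen D)
    (hT : 0 < T) {t : ℝ} (ht : t ∈ Icc 0 T) :
    AEStronglyMeasurable (velocity T e t) (volume.restrict D) :=
  aestronglyMeasurable_timeDeriv hD hT ht (fun _ hs => he.aestronglyMeasurable hD hs)
    fun x hx => he.hasDeriv t ht x hx

lemma RegularMotion.integrableOn_normSq (he : RegularMotion D T M e) (hD : IsOpen D)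
    (hDb : Bornology.IsBounded D) {t : ℝ} (ht : t ∈ Icc 0 T) :
    IntegrableOn (fun x => ‖e t x‖ ^ 2) D := by
  refine integrableOn_of_bound (C := M ^ 2) hDb hD ((he.aestronglyMeasurable hD ht).norm.pow 2)
    fun x hx => ?_
  rw [norm_pow, norm_norm]
  have := he.norm_le t ht x hx
  gcongr

lemma RegularMotion.integrableOn_velocitySq (he : RegularMotion D T M e) (hD : IsOpen D)
    (hDb : Bornology.IsBounded D) (hT : 0 < T) {t : ℝ} (ht : t ∈ Icc 0 T) :
    IntegrableOn (fun x => ‖velocity T e t x‖ ^ 2) D := by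
  refine integrableOn_of_bound (C := M ^ 2) hDb hD
    ((he.aestronglyMeasurable_velocity hD hT ht).norm.pow 2) fun x hx => ?_
  rw [norm_pow, norm_norm]
  have := he.velocity_le t ht x hx
  gcongr

lemma RegularMotion.integrableOn_pairing (he : RegularMotion D T M e) (hD : IsOpen D)
    (hDb : Bornology.IsBounded D) {t : ℝ} (ht : t ∈ Icc 0 T) :
    IntegrableOn (pairing (e t) (e t)) D :=
  (Peridynamics.integrableOn_pairing hD hDb (he.dirichletField hD ht)
    (he.dirichletField hD ht)).congr_fun (fun _ hx => pairing_indicator hD _ _ hx)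
    hD.measurableSet

lemma RegularMotion.integrableOn_force_inner (he : RegularMotion D T M e)
    (hC : IsIsotropic d f J β) (hβ : 0 ≤ β) (hD : IsOpen D)
    (hDb : Bornology.IsBounded D) {s t r : ℝ} (hs : s ∈ Icc 0 T) (ht : t ∈ Icc 0 T)
    (hr : r ∈ Icc 0 T) :
    IntegrableOn (fun x => inner ℝ (elasticForce f J (e r) x) (e s x - e t x)) D := by
  have hLm : AEStronglyMeasurable (elasticForce f J (e r)) (volume.restrict D) :=
    (Peridynamics.continuousOn_elasticForce hD (he.contDiffOn r hr)).aestronglyMeasurable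
      hD.measurableSet
  refine integrableOn_of_bound (C := (d * (β * (d * 3)) * M) * (M + M)) hDb hD
    (hLm.inner ((he.aestronglyMeasurable hD hs).sub (he.aestronglyMeasurable hD ht)))
    fun x hx => ?_
  have hM : 0 ≤ M := (norm_nonneg _).trans (he.norm_le s hs x hx)
  refine (norm_inner_le_norm _ _).trans (mul_le_mul ?_ ?_ (norm_nonneg _) (by positivity))
  · exact (hC.norm_elasticForce_le hβ (he.contDiffAt hD hr hx)).trans
      (mul_le_mul_of_nonneg_left (he.fderiv_fderiv_le r hr x hx) (by positivity))
  · exact (norm_sub_le _ _).trans (add_le_add (he.norm_le s hs x hx) (he.norm_le t ht x hx))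

/-- A difference of squares for the symmetric form `pairing`. Green's formula puts all spatial
derivatives on the sum e(s) + e(t), so the time increment e(s) - e(t) stays undifferentiated and no
mixed derivative ∇∂ₜe is ever needed. -/
lemma RegularMotion.pairing_sub (he : RegularMotion D T M e) (hC : IsIsotropic d f J β)
    (hβ : 0 ≤ β) (hD : IsOpen D)
    (hDb : Bornology.IsBounded D) {s t : ℝ} (hs : s ∈ Icc 0 T) (ht : t ∈ Icc 0 T) :
    β * (∫ x in D, pairing (e s) (e s) x) - β * ∫ x in D, pairing (e t) (e t) x =
      - ∫ x in D, inner ℝ (elasticForce f J (e s) x + elasticForce f J (e t) x)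
        (e s x - e t x) := by
  have hg : ∀ {r q : ℝ}, r ∈ Icc 0 T → q ∈ Icc 0 T →
      β * ∫ x in D, pairing (e r) (e q) x = - ∫ x in D, inner ℝ (elasticForce f J (e r) x)
        (e q x) := by
    intro r q hr hq
    have h := hC.integral_pairing hD hDb (he.dirichletField hD hr) (he.dirichletField hD hq)
    rw [setIntegral_congr_fun hD.measurableSet
      (fun x hx => pairing_indicator hD (e r) (e q) hx)] at h
    rw [h]
    congr 1
    refine setIntegral_congr_fun hD.measurableSet fun x hx => ?_
    simp only [elasticForce_indicator hD hx (he.contDiffAt hD hr hx), indicator_of_mem hx]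
  have hsym : ∫ x in D, pairing (e s) (e t) x = ∫ x in D, pairing (e t) (e s) x :=
    setIntegral_congr_fun hD.measurableSet fun x _ => pairing_comm _ _ x
  have hI : ∀ {r q : ℝ}, r ∈ Icc 0 T → q ∈ Icc 0 T →
      IntegrableOn (fun x => inner ℝ (elasticForce f J (e r) x) (e q x)) D := by
    intro r q hr hq
    refine integrableOn_of_bound (C := (d * (β * (d * 3)) * M) * M) hDb hD
      (((Peridynamics.continuousOn_elasticForce hD (he.contDiffOn r hr)).aestronglyMeasurable
      hD.measurableSet).inner (he.aestronglyMeasurable hD hq)) fun x hx => ?_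
    have hM : 0 ≤ M := (norm_nonneg _).trans (he.norm_le s hs x hx)
    refine (norm_inner_le_norm _ _).trans (mul_le_mul ?_ (he.norm_le q hq x hx) (norm_nonneg _)
      (by positivity))
    exact (hC.norm_elasticForce_le hβ (he.contDiffAt hD hr hx)).trans
      (mul_le_mul_of_nonneg_left (he.fderiv_fderiv_le r hr x hx) (by positivity))
  have hsplit : ∫ x in D, inner ℝ (elasticForce f J (e s) x + elasticForce f J (e t) x)
        (e s x - e t x) = (∫ x in D, inner ℝ (elasticForce f J (e s) x) (e s x))
        - (∫ x in D, inner ℝ (elasticForce f J (e s) x) (e t x))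
        + ((∫ x in D, inner ℝ (elasticForce f J (e t) x) (e s x))
        - ∫ x in D, inner ℝ (elasticForce f J (e t) x) (e t x)) := by
    have h1 := (hI hs hs).sub (hI hs ht)
    have h2 := (hI ht hs).sub (hI ht ht)
    rw [← integral_sub' (hI hs hs) (hI hs ht), ← integral_sub' (hI ht hs) (hI ht ht),
      ← integral_add h1 h2]
    refine setIntegral_congr_fun hD.measurableSet fun x _ => ?_
    simp only [inner_add_left, inner_sub_right, Pi.sub_apply]
    ring
  have a1 := hg hs hs
  have a2 := hg hs ht
  have a3 := hg ht hs
  have a4 := hg ht ht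
  rw [hsym] at a2
  rw [hsplit]
  linarith

lemma RegularMotion.energy_sub (he : RegularMotion D T M e) (hC : IsIsotropic d f J β)
    (hβ : 0 ≤ β) (hD : IsOpen D)
    (hDb : Bornology.IsBounded D) (hT : 0 < T) {s t : ℝ} (hs : s ∈ Icc 0 T) (ht : t ∈ Icc 0 T) :
    energy D T ρ β e s - energy D T ρ β e t =
      ∫ x in D, (ρ * inner ℝ (e s x - e t x) (e s x + e t x)
        + ρ * inner ℝ (velocity T e s x - velocity T e t x) (velocity T e s x + velocity T e t x)
        - inner ℝ (elasticForce f J (e s) x + elasticForce f J (e t) x) (e s x - e t x)) := by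
  have hI : ∀ {r : ℝ}, r ∈ Icc 0 T →
      IntegrableOn (fun x => ρ * ‖e r x‖ ^ 2 + ρ * ‖velocity T e r x‖ ^ 2) D := fun hr =>
    ((he.integrableOn_normSq hD hDb hr).const_mul ρ).add
      ((he.integrableOn_velocitySq hD hDb hT hr).const_mul ρ)
  have hL : IntegrableOn (fun x => inner ℝ (elasticForce f J (e s) x + elasticForce f J (e t) x)
      (e s x - e t x)) D := by
    have := (he.integrableOn_force_inner hC hβ hD hDb hs ht hs).add
      (he.integrableOn_force_inner hC hβ hD hDb hs ht ht)
    refine this.congr_fun (fun x _ => ?_) hD.measurableSet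
    simp only [inner_add_left, Pi.add_apply]
  have h1 := he.pairing_sub hC hβ hD hDb hs ht
  have h2 : energy D T ρ β e s - energy D T ρ β e t =
      ((∫ x in D, (ρ * ‖e s x‖ ^ 2 + ρ * ‖velocity T e s x‖ ^ 2))
        - ∫ x in D, (ρ * ‖e t x‖ ^ 2 + ρ * ‖velocity T e t x‖ ^ 2))
      - ∫ x in D, inner ℝ (elasticForce f J (e s) x + elasticForce f J (e t) x)
        (e s x - e t x) := by
    unfold energy
    linarith
  have h3 := (hI hs).sub (hI ht)
  rw [h2, ← integral_sub' (hI hs) (hI ht), ← integral_sub h3 hL]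
  refine setIntegral_congr_fun hD.measurableSet fun x _ => ?_
  have hsq : ∀ a c : Vec d, inner ℝ (a - c) (a + c) = ‖a‖ ^ 2 - ‖c‖ ^ 2 := fun a c => by
    rw [inner_sub_left, inner_add_right, inner_add_right, real_inner_comm a c,
      real_inner_self_eq_norm_sq, real_inner_self_eq_norm_sq]
    ring
  simp only [hsq, Pi.sub_apply]
  ring

end Energy

end Peridynamics

/-! ### Differentiation of the energy and Grönwall's inequality -/

namespace Peridynamics

variable {d : ℕ} {D : Set (Vec d)} {T : ℝ} {f J : ℝ → ℝ} {β ρ M : ℝ} {e : ℝ → Vec d → Vec d}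

lemma norm_inv_smul_sub_le {F : ℝ → Vec d} {F' : ℝ → Vec d} {C : ℝ}
    (hF : ∀ t ∈ Icc 0 T, HasDerivWithinAt F (F' t) (Icc 0 T) t)
    (hC : ∀ t ∈ Icc 0 T, ‖F' t‖ ≤ C) {s t : ℝ} (hs : s ∈ Icc 0 T) (ht : t ∈ Icc 0 T)
    (hst : s ≠ t) : ‖(s - t)⁻¹ • (F s - F t)‖ ≤ C := by
  have h := (convex_Icc (0 : ℝ) T).norm_image_sub_le_of_norm_hasDerivWithin_le hF hC ht hs
  have hpos : 0 < ‖s - t‖ := norm_pos_iff.2 (sub_ne_zero.2 hst)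
  rw [norm_smul, norm_inv, inv_mul_le_iff₀ hpos, mul_comm]
  exact h

/-- Dominated convergence in the increment formula: the difference quotients of e and ∂ₜe are
bounded by M through the mean value inequality, and the elastic force is continuous in time at each
point. -/
lemma RegularMotion.hasDerivWithinAt_energy (he : RegularMotion D T M e)
    (hC : IsIsotropic d f J β) (hβ : 0 ≤ β) (hD : IsOpen D) (hDb : Bornology.IsBounded D)
    (hT : 0 < T) (ρ : ℝ) {t : ℝ} (ht : t ∈ Icc 0 T) :
    HasDerivWithinAt (energy D T ρ β e)
      (∫ x in D, (ρ * inner ℝ (velocity T e t x) (e t x + e t x)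
        + ρ * inner ℝ (acceleration T e t x) (velocity T e t x + velocity T e t x)
        - inner ℝ (elasticForce f J (e t) x + elasticForce f J (e t) x) (velocity T e t x)))
      (Icc 0 T) t := by
  rw [hasDerivWithinAt_iff_tendsto_slope]
  set c : ℝ := d * (β * (d * 3)) with hc
  have hc0 : 0 ≤ c := by positivity
  have hLb : ∀ r ∈ Icc 0 T, ∀ x ∈ D, ‖elasticForce f J (e r) x‖ ≤ c * M := fun r hr x hx =>
    (hC.norm_elasticForce_le hβ (he.contDiffAt hD hr hx)).trans
      (mul_le_mul_of_nonneg_left (he.fderiv_fderiv_le r hr x hx) hc0)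
  let q : ℝ → Vec d → Vec d := fun s x => (s - t)⁻¹ • (e s x - e t x)
  let p : ℝ → Vec d → Vec d := fun s x => (s - t)⁻¹ • (velocity T e s x - velocity T e t x)
  let g : ℝ → Vec d → ℝ := fun s x => ρ * inner ℝ (q s x) (e s x + e t x)
    + ρ * inner ℝ (p s x) (velocity T e s x + velocity T e t x)
    - inner ℝ (elasticForce f J (e s) x + elasticForce f J (e t) x) (q s x)
  have hslope : ∀ᶠ s in 𝓝[Icc 0 T \ {t}] t, ∫ x in D, g s x = slope (energy D T ρ β e) t s := by
    filter_upwards [self_mem_nhdsWithin] with s hs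
    rw [slope_def_module, he.energy_sub hC hβ hD hDb hT hs.1 ht, smul_eq_mul,
      ← integral_const_mul]
    refine setIntegral_congr_fun hD.measurableSet fun x _ => ?_
    simp only [g, q, p, inner_smul_left, inner_smul_right, conj_trivial]
    ring
  refine Tendsto.congr' hslope ?_
  have hLm : ∀ r ∈ Icc 0 T, AEStronglyMeasurable (elasticForce f J (e r)) (volume.restrict D) :=
    fun r hr => (Peridynamics.continuousOn_elasticForce hD (he.contDiffOn r hr)).aestronglyMeasurable
      hD.measurableSet
  refine tendsto_integral_filter_of_dominated_convergence
    (fun _ => |ρ| * (M * (M + M)) + |ρ| * (M * (M + M)) + (c * M + c * M) * M) ?_ ?_ ?_ ?_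
  · filter_upwards [self_mem_nhdsWithin] with s hs
    have h1 := he.aestronglyMeasurable hD hs.1
    have h2 := he.aestronglyMeasurable hD ht
    have h3 := he.aestronglyMeasurable_velocity hD hT hs.1
    have h4 := he.aestronglyMeasurable_velocity hD hT ht
    have hq : AEStronglyMeasurable (q s) (volume.restrict D) :=
      (h1.sub h2).const_smul ((s - t)⁻¹)
    have hp : AEStronglyMeasurable (p s) (volume.restrict D) :=
      (h3.sub h4).const_smul ((s - t)⁻¹)
    exact (((hq.inner (h1.add h2)).const_mul ρ).add ((hp.inner (h3.add h4)).const_mul ρ)).sub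
      (((hLm s hs.1).add (hLm t ht)).inner hq)
  · filter_upwards [self_mem_nhdsWithin] with s hs
    refine (ae_restrict_iff' hD.measurableSet).2 (Eventually.of_forall fun x hx => ?_)
    have hM : 0 ≤ M := (norm_nonneg _).trans (he.norm_le t ht x hx)
    have hq : ‖q s x‖ ≤ M := norm_inv_smul_sub_le (fun r hr => he.hasDeriv r hr x hx)
      (fun r hr => he.velocity_le r hr x hx) hs.1 ht hs.2
    have hp : ‖p s x‖ ≤ M := norm_inv_smul_sub_le (fun r hr => he.hasDeriv_velocity r hr x hx)
      (fun r hr => he.acceleration_le r hr x hx) hs.1 ht hs.2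
    have hadd : ∀ {a b : Vec d} {A B : ℝ}, ‖a‖ ≤ A → ‖b‖ ≤ B → ‖a + b‖ ≤ A + B :=
      fun ha hb => (norm_add_le _ _).trans (add_le_add ha hb)
    have hin : ∀ {a b : Vec d} {A B : ℝ}, ‖a‖ ≤ A → ‖b‖ ≤ B → ‖inner ℝ a b‖ ≤ A * B :=
      fun ha hb => (norm_inner_le_norm _ _).trans
        (mul_le_mul ha hb (norm_nonneg _) ((norm_nonneg _).trans ha))
    refine (norm_sub_le _ _).trans (add_le_add ((norm_add_le _ _).trans (add_le_add ?_ ?_)) ?_)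
    · rw [norm_mul, Real.norm_eq_abs]
      exact mul_le_mul_of_nonneg_left (hin hq (hadd (he.norm_le s hs.1 x hx)
        (he.norm_le t ht x hx))) (abs_nonneg _)
    · rw [norm_mul, Real.norm_eq_abs]
      exact mul_le_mul_of_nonneg_left (hin hp (hadd (he.velocity_le s hs.1 x hx)
        (he.velocity_le t ht x hx))) (abs_nonneg _)
    · exact hin (hadd (hLb s hs.1 x hx) (hLb t ht x hx)) hq
  · exact integrableOn_const hDb.measure_lt_top.ne
  · refine (ae_restrict_iff' hD.measurableSet).2 (Eventually.of_forall fun x hx => ?_)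
    have hle : 𝓝[Icc 0 T \ {t}] t ≤ 𝓝[Icc 0 T] t := nhdsWithin_mono _ sdiff_subset
    have hq : Tendsto (fun s => q s x) (𝓝[Icc 0 T \ {t}] t) (𝓝 (velocity T e t x)) :=
      (hasDerivWithinAt_iff_tendsto_slope.1 (he.hasDeriv t ht x hx)).congr fun s => by
        rw [slope_def_module]
    have hp : Tendsto (fun s => p s x) (𝓝[Icc 0 T \ {t}] t) (𝓝 (acceleration T e t x)) :=
      (hasDerivWithinAt_iff_tendsto_slope.1 (he.hasDeriv_velocity t ht x hx)).congr fun s => by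
        rw [slope_def_module]
    have h1 : Tendsto (fun s => e s x) (𝓝[Icc 0 T \ {t}] t) (𝓝 (e t x)) :=
      (he.hasDeriv t ht x hx).continuousWithinAt.mono_left hle
    have h2 : Tendsto (fun s => velocity T e s x) (𝓝[Icc 0 T \ {t}] t)
        (𝓝 (velocity T e t x)) :=
      (he.hasDeriv_velocity t ht x hx).continuousWithinAt.mono_left hle
    have h3 : Tendsto (fun s => elasticForce f J (e s) x) (𝓝[Icc 0 T \ {t}] t)
        (𝓝 (elasticForce f J (e t) x)) :=
      (he.continuousOn_elasticForce hD hx t ht).mono_left hle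
    exact (((hq.inner (h1.add tendsto_const_nhds)).const_mul ρ).add
      ((hp.inner (h2.add tendsto_const_nhds)).const_mul ρ)).sub
      ((h3.add tendsto_const_nhds).inner hq)

/-- Grönwall's estimate for motions starting from rest whose residual force has small power. -/
lemma RegularMotion.energy_le (he : RegularMotion D T M e)
    (hC : IsIsotropic d f J β) (hβ : 0 ≤ β) (hD : IsOpen D) (hDb : Bornology.IsBounded D)
    (hT : 0 < T) (hρ : 0 < ρ) {δ : ℝ} (hδ : 0 ≤ δ) (h0 : ∀ x ∈ D, e 0 x = 0)
    (h0' : ∀ x ∈ D, velocity T e 0 x = 0)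
    (hres : ∀ t ∈ Icc 0 T, ∀ x ∈ D, 2 * inner ℝ (ρ • acceleration T e t x
      - elasticForce f J (e t) x) (velocity T e t x) ≤ ρ * ‖velocity T e t x‖ ^ 2 + δ)
    {t : ℝ} (ht : t ∈ Icc 0 T) :
    energy D T ρ β e t ≤ δ * (volume D).toReal * Real.exp (2 * T) := by
  have hder := fun s (hs : s ∈ Icc 0 T) => he.hasDerivWithinAt_energy hC hβ hD hDb hT ρ hs
  have hstart : energy D T ρ β e 0 ≤ 0 := by
    have h1 : ∫ x in D, (ρ * ‖e 0 x‖ ^ 2 + ρ * ‖velocity T e 0 x‖ ^ 2) = 0 := by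
      rw [setIntegral_congr_fun (g := fun _ => (0 : ℝ)) hD.measurableSet
        (fun x hx => by simp [h0 x hx, h0' x hx])]
      simp
    have h2 : ∫ x in D, pairing (e 0) (e 0) x = 0 := by
      rw [setIntegral_congr_fun (g := fun _ => (0 : ℝ)) hD.measurableSet (fun x hx => ?_)]
      · simp
      · have hz : e 0 =ᶠ[𝓝 x] fun _ => 0 := by
          filter_upwards [hD.mem_nhds hx] with y hy using h0 y hy
        simp [pairing, partialDeriv, hz.fderiv_eq]
    rw [energy, h1, h2]; simp
  set V := (volume D).toReal
  have hV : 0 ≤ V := ENNReal.toReal_nonneg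
  have hgr := le_gronwallBound_of_liminf_deriv_right_le (f := energy D T ρ β e)
    (f' := fun t => ∫ x in D, (ρ * inner ℝ (velocity T e t x) (e t x + e t x)
        + ρ * inner ℝ (acceleration T e t x) (velocity T e t x + velocity T e t x)
        - inner ℝ (elasticForce f J (e t) x + elasticForce f J (e t) x) (velocity T e t x)))
    (δ := 0) (K := 2) (ε := δ * V) (a := 0) (b := T)
    (fun s hs => (hder s hs).continuousWithinAt) ?_ hstart ?_ t ht
  · refine hgr.trans ?_
    rw [gronwallBound_of_K_ne_0 two_ne_zero]
    simp only [zero_mul, zero_add, sub_zero]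
    have h1 : Real.exp (2 * t) ≤ Real.exp (2 * T) := by
      gcongr
      exact ht.2
    have h2 : 0 ≤ δ * V := by positivity
    have h3 := Real.exp_pos (2 * T)
    have h4 : δ * V / 2 * (Real.exp (2 * t) - 1) ≤ δ * V / 2 * Real.exp (2 * T) :=
      mul_le_mul_of_nonneg_left (by linarith) (by positivity)
    have h5 : 0 ≤ δ * V * Real.exp (2 * T) := by positivity
    linarith
  · intro s hs r hr
    have hsub : 𝓝[>] s ≤ 𝓝[Icc 0 T \ {s}] s := by
      have hm : Icc 0 T \ {s} ∈ 𝓝[>] s := by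
        filter_upwards [Ioc_mem_nhdsGT hs.2] with z hz
        exact ⟨⟨hs.1.trans hz.1.le, hz.2⟩, ne_of_gt hz.1⟩
      exact nhdsWithin_le_of_mem hm
    have htend := (hasDerivWithinAt_iff_tendsto_slope.1 (hder s ⟨hs.1, hs.2.le⟩)).mono_left hsub
    refine (htend.eventually_lt_const hr).frequently.mono fun z hz => ?_
    rwa [slope_def_field, div_eq_inv_mul] at hz
  · intro s hs'
    have hs : s ∈ Icc 0 T := ⟨hs'.1, hs'.2.le⟩
    have hsq := he.integrableOn_normSq hD hDb hs
    have hvsq := he.integrableOn_velocitySq hD hDb hT hs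
    have hI : IntegrableOn (fun x => ρ * ‖e s x‖ ^ 2 + ρ * ‖velocity T e s x‖ ^ 2) D :=
      (hsq.const_mul ρ).add (hvsq.const_mul ρ)
    have hJ : IntegrableOn (fun _ : Vec d => δ) D := integrableOn_const hDb.measure_lt_top.ne
    have hup : IntegrableOn (fun x => 2 * (ρ * ‖e s x‖ ^ 2 + ρ * ‖velocity T e s x‖ ^ 2) + δ) D :=
      (hI.const_mul 2).add hJ
    have hpt : ∀ x ∈ D, (ρ * inner ℝ (velocity T e s x) (e s x + e s x)
        + ρ * inner ℝ (acceleration T e s x) (velocity T e s x + velocity T e s x)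
        - inner ℝ (elasticForce f J (e s) x + elasticForce f J (e s) x) (velocity T e s x))
        ≤ 2 * (ρ * ‖e s x‖ ^ 2 + ρ * ‖velocity T e s x‖ ^ 2) + δ := by
      -- The cross term satisfies 2ρ e·ė ≤ ρ(|ė|² + |e|²); with ρ|ė|² + δ from the residual this
      -- gives the growth rate 2.
      intro x hx
      have h1 := hres s hs x hx
      have h2 : ρ * (2 * inner ℝ (velocity T e s x) (e s x)) ≤
          ρ * (‖velocity T e s x‖ ^ 2 + ‖e s x‖ ^ 2) := by
        refine mul_le_mul_of_nonneg_left ?_ hρ.le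
        have h3 := norm_sub_sq_real (velocity T e s x) (e s x)
        nlinarith [sq_nonneg ‖velocity T e s x - e s x‖]
      have h4 : 0 ≤ ρ * ‖e s x‖ ^ 2 := by positivity
      simp only [inner_sub_left, inner_add_left, inner_add_right, inner_smul_left,
        conj_trivial] at h1 ⊢
      linarith
    have hle : (∫ x in D, (ρ * inner ℝ (velocity T e s x) (e s x + e s x)
        + ρ * inner ℝ (acceleration T e s x) (velocity T e s x + velocity T e s x)
        - inner ℝ (elasticForce f J (e s) x + elasticForce f J (e s) x) (velocity T e s x)))
        ≤ ∫ x in D, (2 * (ρ * ‖e s x‖ ^ 2 + ρ * ‖velocity T e s x‖ ^ 2) + δ) := by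
      -- A nonintegrable integrand has integral 0 by convention, and the right-hand side is
      -- nonnegative.
      by_cases hint : IntegrableOn (fun x => (ρ * inner ℝ (velocity T e s x) (e s x + e s x)
        + ρ * inner ℝ (acceleration T e s x) (velocity T e s x + velocity T e s x)
        - inner ℝ (elasticForce f J (e s) x + elasticForce f J (e s) x) (velocity T e s x))) D
      · exact setIntegral_mono_on hint hup hD.measurableSet hpt
      · rw [integral_undef hint]
        exact integral_nonneg fun x => by positivity
    refine hle.trans ?_
    have hJI : ∫ _ in D, δ = δ * V := by
      rw [setIntegral_const, smul_eq_mul, mul_comm]; rfl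
    rw [integral_add (hI.const_mul 2) hJ, integral_const_mul, hJI, energy]
    have := mul_nonneg hβ (integral_nonneg (μ := volume.restrict D)
      fun x => pairing_self_nonneg (e s) x)
    linarith

end Peridynamics

/-! ### Error in the collar and boundary decay of the limit -/

namespace Peridynamics

variable {d : ℕ} {D : Set (Vec d)} {T : ℝ} {f J : ℝ → ℝ} {β ρ M N K C ε : ℝ}
  {b : ℝ → Vec d → Vec d} {u₀ v₀ : Vec d → Vec d} {u uε e : ℝ → Vec d → Vec d}

/-- Landau's interpolation inequality on `[0, T]`. -/
lemma norm_deriv_le_of_norm_le {F F' F'' : ℝ → Vec d} {η h : ℝ}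
    (hF : ∀ t ∈ Icc 0 T, HasDerivWithinAt F (F' t) (Icc 0 T) t)
    (hF' : ∀ t ∈ Icc 0 T, HasDerivWithinAt F' (F'' t) (Icc 0 T) t)
    (hη : ∀ t ∈ Icc 0 T, ‖F t‖ ≤ η) (hM : ∀ t ∈ Icc 0 T, ‖F'' t‖ ≤ M) (hh : 0 < h)
    (hhT : h ≤ T / 2) {t : ℝ} (ht : t ∈ Icc 0 T) : ‖F' t‖ ≤ 2 * η / h + M * h := by
  have hM0 : 0 ≤ M := (norm_nonneg _).trans (hM t ht)
  -- Step forward in the first half of the interval and backward in the second; h ≤ T/2 keeps s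
  -- inside.
  obtain ⟨s, hs, hst⟩ : ∃ s ∈ Icc 0 T, |s - t| = h := by
    rcases le_total t (T / 2) with h1 | h1
    · exact ⟨t + h, ⟨by linarith [ht.1], by linarith⟩, by
        rw [add_sub_cancel_left, abs_of_pos hh]⟩
    · exact ⟨t - h, ⟨by linarith, by linarith [ht.2]⟩, by
        rw [sub_sub_cancel_left, abs_neg, abs_of_pos hh]⟩
  have hsub : uIcc t s ⊆ Icc 0 T := uIcc_subset_Icc ht hs
  have hG : ∀ r ∈ uIcc t s,
      HasDerivWithinAt (fun r => F r - r • F' t) (F' r - F' t) (uIcc t s) r := by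
    intro r hr
    have h1 := ((hasDerivWithinAt_id r (uIcc t s)).smul_const (F' t))
    rw [one_smul] at h1
    exact ((hF r (hsub hr)).mono hsub).sub h1
  have hb : ∀ r ∈ uIcc t s, ‖F' r - F' t‖ ≤ M * h := by
    intro r hr
    have h1 := (convex_Icc (0 : ℝ) T).norm_image_sub_le_of_norm_hasDerivWithin_le hF' hM ht
      (hsub hr)
    refine h1.trans (mul_le_mul_of_nonneg_left ?_ hM0)
    rw [Real.norm_eq_abs, ← hst]
    exact abs_sub_left_of_mem_uIcc hr
  have key := (convex_uIcc t s).norm_image_sub_le_of_norm_hasDerivWithin_le hG hb left_mem_uIcc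
    right_mem_uIcc
  rw [Real.norm_eq_abs, hst] at key
  have e1 : (s - t) • F' t = F s - F t - (F s - s • F' t - (F t - t • F' t)) := by
    rw [sub_smul]; abel
  have h2 : h * ‖F' t‖ ≤ 2 * η + M * h * h := by
    calc h * ‖F' t‖ = ‖(s - t) • F' t‖ := by rw [norm_smul, Real.norm_eq_abs, hst]
      _ ≤ ‖F s - F t‖ + ‖F s - s • F' t - (F t - t • F' t)‖ := by
        rw [e1]; exact norm_sub_le _ _
      _ ≤ (η + η) + M * h * h :=
        add_le_add ((norm_sub_le _ _).trans (add_le_add (hη s hs) (hη t ht))) key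
      _ = _ := by ring
  have e2 : 2 * η / h + M * h = (2 * η + M * h * h) / h := by field_simp
  rw [e2, le_div_iff₀ hh, mul_comm]
  exact h2

lemma RegularMotion.norm_le_infDist (hu : RegularMotion D T M u) (hd : 0 < d) (hD : IsOpen D)
    (hDb : Bornology.IsBounded D) {t : ℝ} (ht : t ∈ Icc 0 T) {x : Vec d} (hx : x ∈ D) :
    ‖u t x‖ ≤ M * Metric.infDist x (frontier D) := by
  obtain ⟨p, hp, hdist⟩ := exists_frontier_infDist_eq hd hDb hx
  have hpD : p ∉ D := fun h => by
    rw [frontier, hD.interior_eq] at hp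
    exact hp.2 h
  have hdf := hu.dirichletField hD ht
  have h := norm_le_mul_norm_sub_of_zero_off (M := M) hD hdf.continuous hdf.zero_off
    (hdf.contDiffOn.differentiableOn two_ne_zero) (fun y hy => by
      rw [(indicator_eventuallyEq hD (u t) hy).fderiv_eq]
      exact hu.fderiv_le t ht y hy) hx hpD
  rwa [indicator_of_mem hx, norm_sub_rev, ← hdist] at h

/-- A solution of the peridynamic problem with fourth spatial derivatives bounded by `C`. -/
structure IsRegularApproximation (f J : ℝ → ℝ) (D : Set (Vec d)) (T ρ : ℝ)
    (b : ℝ → Vec d → Vec d) (u₀ v₀ : Vec d → Vec d) (C ε : ℝ) (w : ℝ → Vec d → Vec d) :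
    Prop where
  pos : 0 < ε
  solution : IsPeridynamicSolution f J D T ρ ε b u₀ v₀ w
  collar : ∀ t ∈ Icc 0 T, CollarField D C ε (w t)

lemma IsPeridynamicSolution.velocity_eq_zero (hper : IsPeridynamicSolution f J D T ρ ε b u₀ v₀ uε)
    (hT : 0 < T) {x : Vec d} (h : Metric.infDist x (frontier D) ≤ ε) {s : ℝ} (hs : s ∈ Icc 0 T) :
    velocity T uε s x = 0 := by
  have h1 := (hasDerivWithinAt_const s (Icc 0 T) (0 : Vec d)).congr (f₁ := fun s => uε s x)
    (fun r hr => hper.boundary r hr x h) (hper.boundary s hs x h)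
  exact h1.derivWithin (uniqueDiffOn_Icc hT s hs)

/-- The energy of the error is controlled by the squared horizon and the velocity of the limit in
the collar. -/
lemma energy_error_le (hC : IsIsotropic d f J β) (hβ : 0 ≤ β) (hD : IsOpen D)
    (hDb : Bornology.IsBounded D) (hT : 0 < T) (hρ : 0 < ρ) (hM : 0 ≤ M) (hN : 0 ≤ N)
    (hu : RegularMotion D T M u)
    (hsol : IsElastodynamicSolution f J D T ρ b u₀ v₀ u)
    (happ : IsRegularApproximation f J D T ρ b u₀ v₀ C ε uε) (huε : RegularMotion D T N uε)
    (hcons : ∀ t ∈ Icc 0 T, ∀ x ∈ D, ε < Metric.infDist x (frontier D) →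
        ‖nonlocalForce f J ε (uε t) x - elasticForce f J (uε t) x‖ ≤ K * ε)
    (he : ∀ t x, e t x = uε t x - u t x) {l : ℝ} (hl : 0 ≤ l)
    (hcol : ∀ t ∈ Icc 0 T, ∀ x ∈ D, Metric.infDist x (frontier D) ≤ ε → ‖velocity T u t x‖ ≤ l)
    {t : ℝ} (ht : t ∈ Icc 0 T) :
    energy D T ρ β e t ≤ (K ^ 2 / ρ + 2 * (ρ * M + d * (β * (d * 3)) * (N + M)))
      * (volume D).toReal * Real.exp (2 * T) * (ε ^ 2 + l) := by
  set c : ℝ := d * (β * (d * 3)) with hc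
  have hc0 : 0 ≤ c := by positivity
  have hreg : RegularMotion D T (N + M) e := huε.sub hD hT hu he
  have hper := happ.solution
  have h0T : (0 : ℝ) ∈ Icc 0 T := ⟨le_rfl, hT.le⟩
  have hed : ∀ t, e t = uε t - u t := fun t => funext (he t)
  set A : ℝ := ρ * M + c * (N + M) with hA
  have hA0 : 0 ≤ A := by positivity
  have key := hreg.energy_le hC hβ hD hDb hT hρ (δ := K ^ 2 / ρ * ε ^ 2 + 2 * A * l)
    (by positivity) ?_ ?_ ?_ ht
  · refine key.trans ?_
    have h1 : K ^ 2 / ρ * ε ^ 2 + 2 * A * l ≤ (K ^ 2 / ρ + 2 * A) * (ε ^ 2 + l) := by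
      have : 0 ≤ K ^ 2 / ρ * l + 2 * A * ε ^ 2 := by positivity
      linarith
    calc _ ≤ (K ^ 2 / ρ + 2 * A) * (ε ^ 2 + l) * (volume D).toReal * Real.exp (2 * T) := by gcongr
      _ = _ := by ring
  · intro x hx
    rw [he, hper.initial x hx, hsol.initial x hx, sub_self]
  · intro x hx
    rw [velocity_sub_of_mem hT huε hu he h0T hx, hper.initial_velocity x hx,
      hsol.initial_velocity x hx, sub_self]
  · intro s hs x hx
    have hcu := hu.contDiffAt hD hs hx
    have hcuε := huε.contDiffAt hD hs hx
    have hr : ρ • acceleration T e s x - elasticForce f J (e s) x =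
        (ρ • acceleration T uε s x - elasticForce f J (uε s) x) -
        (ρ • acceleration T u s x - elasticForce f J (u s) x) := by
      rw [acceleration_sub_of_mem hT huε hu he hs hx, hed, elasticForce_sub f J hcuε hcu, smul_sub]
      abel
    have hbu : ρ • acceleration T u s x - elasticForce f J (u s) x = b s x := by
      rw [hsol.equation s hs x hx]; abel
    -- Off the collar b cancels, the residual is the consistency gap, and Young's inequality absorbs
    -- the velocity. In the collar the residual is only bounded, by A, but the velocity of the error
    -- is minus that of u, hence at most l.
    rcases lt_or_ge ε (Metric.infDist x (frontier D)) with h | h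
    · have hr2 : ρ • acceleration T e s x - elasticForce f J (e s) x =
          nonlocalForce f J ε (uε s) x - elasticForce f J (uε s) x := by
        rw [hr, hbu, hper.equation s hs x hx h]; abel
      have h1 := hcons s hs x hx h
      rw [hr2]
      set n := ‖velocity T e s x‖
      have h2 : inner ℝ (nonlocalForce f J ε (uε s) x - elasticForce f J (uε s) x)
          (velocity T e s x) ≤ K * ε * n :=
        (real_inner_le_norm _ _).trans (mul_le_mul_of_nonneg_right h1 (norm_nonneg _))
      have h3 : 2 * (K * ε * n) ≤ ρ * n ^ 2 + K ^ 2 / ρ * ε ^ 2 := by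
        have h4 : 0 ≤ (ρ * n - K * ε) ^ 2 / ρ := by positivity
        have h5 : (ρ * n - K * ε) ^ 2 / ρ = ρ * n ^ 2 - 2 * (K * ε * n) + K ^ 2 / ρ * ε ^ 2 := by
          field_simp; ring
        linarith
      have h6 : 0 ≤ 2 * A * l := by positivity
      linarith
    · have hz : ∀ r ∈ Icc 0 T, velocity T uε r x = 0 := fun r hr =>
        hper.velocity_eq_zero hT h hr
      have hacc : acceleration T uε s x = 0 :=
        ((hasDerivWithinAt_const s (Icc 0 T) (0 : Vec d)).congr
          (f₁ := fun s => velocity T uε s x) hz (hz s hs)).derivWithin (uniqueDiffOn_Icc hT s hs)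
      have hv : ‖velocity T e s x‖ ≤ l := by
        rw [velocity_sub_of_mem hT huε hu he hs hx, hz s hs, zero_sub, norm_neg]
        exact hcol s hs x hx h
      have h1 : ‖ρ • acceleration T e s x - elasticForce f J (e s) x‖ ≤ A := by
        rw [hr, hacc, smul_zero, zero_sub]
        have a1 : ‖elasticForce f J (uε s) x‖ ≤ c * N := (hC.norm_elasticForce_le hβ hcuε).trans
          (mul_le_mul_of_nonneg_left (huε.fderiv_fderiv_le s hs x hx) hc0)
        have a2 : ‖elasticForce f J (u s) x‖ ≤ c * M := (hC.norm_elasticForce_le hβ hcu).trans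
          (mul_le_mul_of_nonneg_left (hu.fderiv_fderiv_le s hs x hx) hc0)
        have a3 : ‖ρ • acceleration T u s x‖ ≤ ρ * M := by
          rw [norm_smul, Real.norm_of_nonneg hρ.le]
          exact mul_le_mul_of_nonneg_left (hu.acceleration_le s hs x hx) hρ.le
        have a4 := norm_sub_le (-elasticForce f J (uε s) x)
          (ρ • acceleration T u s x - elasticForce f J (u s) x)
        have a5 := norm_sub_le (ρ • acceleration T u s x) (elasticForce f J (u s) x)
        rw [norm_neg] at a4
        rw [hA]; linarith
      have h2 : inner ℝ (ρ • acceleration T e s x - elasticForce f J (e s) x)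
          (velocity T e s x) ≤ A * l :=
        (real_inner_le_norm _ _).trans (mul_le_mul h1 hv (norm_nonneg _) hA0)
      have h3 : 0 ≤ ρ * ‖velocity T e s x‖ ^ 2 := by positivity
      have h4 : 0 ≤ K ^ 2 / ρ * ε ^ 2 := by positivity
      linarith

/-- If admissible approximations exist for arbitrarily small horizons, the limit decays to fourth
order at the boundary. -/
lemma norm_le_infDist_pow_four (hd : 0 < d)
    (hβ : 0 ≤ β) (hD : IsOpen D) (hDb : Bornology.IsBounded D) (hT : 0 < T) (hρ : 0 < ρ)
    (hM : 0 ≤ M) (hu : RegularMotion D T M u) {Q : ℝ}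
    (hreg : ∀ ε w, IsRegularApproximation f J D T ρ b u₀ v₀ C ε w → RegularMotion D T N w)
    (hQ : ∀ ε w, IsRegularApproximation f J D T ρ b u₀ v₀ C ε w → ∀ l, 0 ≤ l →
      (∀ t ∈ Icc 0 T, ∀ x ∈ D, Metric.infDist x (frontier D) ≤ ε → ‖velocity T u t x‖ ≤ l) →
      ∀ t ∈ Icc 0 T, energy D T ρ β (fun t x => w t x - u t x) t ≤ Q * (ε ^ 2 + l))
    (hsmall : ∀ ε₀ > 0, ∃ ε < ε₀, ∃ w, IsRegularApproximation f J D T ρ b u₀ v₀ C ε w)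
    {t : ℝ} (ht : t ∈ Icc 0 T) {x : Vec d} (hx : x ∈ D) :
    ‖u t x‖ ≤ |C| * Metric.infDist x (frontier D) ^ 4 := by
  -- If the bound fails at x, it fails by more than η on a ball. Every approximation obeys it, so
  -- the L² part keeps the error energy above a positive constant for all horizons, whereas the
  -- crude collar estimate sends that energy to 0.
  by_contra hcon
  rw [not_le] at hcon
  let φ : Vec d → ℝ := fun y => ‖u t y‖ - |C| * Metric.infDist y (frontier D) ^ 4
  have hφ : ContinuousAt φ x := by
    have h1 : ContinuousAt (u t) x := (hu.contDiffAt hD ht hx).continuousAt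
    have h2 : Continuous fun y => |C| * Metric.infDist y (frontier D) ^ 4 := by
      have := Metric.continuous_infDist_pt (frontier D)
      fun_prop
    exact h1.norm.sub h2.continuousAt
  set η := φ x / 2 with hη
  have hφx : 0 < φ x := sub_pos.2 hcon
  have hη0 : 0 < η := by positivity
  have hev : ∀ᶠ y in 𝓝 x, η < φ y ∧ y ∈ D :=
    (hφ.eventually_const_lt (by rw [hη]; linarith)).and (hD.mem_nhds hx)
  obtain ⟨r, hr, hball⟩ := Metric.eventually_nhds_iff_ball.1 hev
  set m := (volume (Metric.ball x r)).toReal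
  have hm : 0 < m := ENNReal.toReal_pos (Metric.measure_ball_pos volume x hr).ne'
    measure_ball_lt_top.ne
  have hlow : ∀ ε w, IsRegularApproximation f J D T ρ b u₀ v₀ C ε w →
      ρ * η ^ 2 * m ≤ energy D T ρ β (fun t x => w t x - u t x) t := by
    intro ε w hw
    have hwe := (hreg ε w hw).sub hD hT hu (e := fun t x => w t x - u t x) fun _ _ => rfl
    have hI : IntegrableOn (fun y => ρ * ‖w t y - u t y‖ ^ 2
        + ρ * ‖velocity T (fun t x => w t x - u t x) t y‖ ^ 2) D :=
      ((hwe.integrableOn_normSq hD hDb ht).const_mul ρ).add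
        ((hwe.integrableOn_velocitySq hD hDb hT ht).const_mul ρ)
    have hsub : Metric.ball x r ⊆ D := fun y hy => (hball y hy).2
    have h1 : ∫ _ in Metric.ball x r, ρ * η ^ 2 ≤ ∫ y in Metric.ball x r, (ρ * ‖w t y - u t y‖ ^ 2
        + ρ * ‖velocity T (fun t x => w t x - u t x) t y‖ ^ 2) := by
      refine setIntegral_mono_on (integrableOn_const measure_ball_lt_top.ne) (hI.mono_set hsub)
        measurableSet_ball fun y hy => ?_
      obtain ⟨hy1, hyD⟩ := hball y hy
      obtain ⟨p, hp, hdist⟩ := exists_frontier_infDist_eq hd hDb hyD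
      have h2 := (hw.collar t ht).norm_le hD hw.pos hp y
      rw [indicator_of_mem hyD, ← hdist] at h2
      have h3 : η ≤ ‖w t y - u t y‖ := by
        have h4 := norm_sub_norm_le (u t y) (w t y)
        rw [norm_sub_rev] at h4
        simp only [φ] at hy1
        linarith
      have h5 : 0 ≤ ρ * ‖velocity T (fun t x => w t x - u t x) t y‖ ^ 2 := by positivity
      have h6 : ρ * η ^ 2 ≤ ρ * ‖w t y - u t y‖ ^ 2 := by gcongr
      linarith
    have h2 : ∫ y in Metric.ball x r, (ρ * ‖w t y - u t y‖ ^ 2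
        + ρ * ‖velocity T (fun t x => w t x - u t x) t y‖ ^ 2) ≤
        ∫ y in D, (ρ * ‖w t y - u t y‖ ^ 2
        + ρ * ‖velocity T (fun t x => w t x - u t x) t y‖ ^ 2) :=
      setIntegral_mono_set hI (Eventually.of_forall fun y => by positivity)
        (Eventually.of_forall hsub)
    have h3 : ∫ _ in Metric.ball x r, ρ * η ^ 2 = ρ * η ^ 2 * m := by
      rw [setIntegral_const, smul_eq_mul, mul_comm]; rfl
    have h4 : 0 ≤ β * ∫ y in D, pairing (fun x => w t x - u t x) (fun x => w t x - u t x) y :=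
      mul_nonneg hβ (integral_nonneg fun y => pairing_self_nonneg _ y)
    rw [energy]
    linarith
  -- 3M√ε is Landau's bound 2(Mε)/h + Mh at h = √ε, with |u| ≤ Mε in the collar.
  have hlim : Tendsto (fun ε : ℝ => Q * (ε ^ 2 + 3 * M * √ε)) (𝓝 0) (𝓝 0) := by
    have hc : Continuous fun ε : ℝ => Q * (ε ^ 2 + 3 * M * √ε) := by fun_prop
    have := hc.tendsto 0
    simpa using this
  have hev2 : ∀ᶠ ε : ℝ in 𝓝 0, Q * (ε ^ 2 + 3 * M * √ε) < ρ * η ^ 2 * m ∧ √ε ≤ T / 2 := by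
    refine (hlim.eventually_lt_const (by positivity)).and ?_
    have hs : Tendsto (fun ε : ℝ => √ε) (𝓝 0) (𝓝 0) := by
      have := Real.continuous_sqrt.tendsto 0
      simpa using this
    exact hs.eventually_le_const (by positivity)
  obtain ⟨ε₀, hε₀, hball2⟩ := Metric.eventually_nhds_iff_ball.1 hev2
  obtain ⟨ε, hε, w, hw⟩ := hsmall ε₀ hε₀
  obtain ⟨h1, h2⟩ := hball2 ε (by rw [Metric.mem_ball, dist_zero_right,
    Real.norm_of_nonneg hw.pos.le]; exact hε)
  have hs0 : 0 < √ε := Real.sqrt_pos.2 hw.pos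
  have h3 := hQ ε w hw (3 * M * √ε) (by positivity) ?_ t ht
  · linarith [hlow ε w hw]
  · intro s hs y hy hyε
    have h4 := norm_deriv_le_of_norm_le (F := fun s => u s y) (η := M * ε) (M := M) (h := √ε)
      (fun r hr => hu.hasDeriv r hr y hy) (fun r hr => hu.hasDeriv_velocity r hr y hy)
      (fun r hr => (hu.norm_le_infDist hd hD hDb hr hy).trans
        (mul_le_mul_of_nonneg_left hyε hM))
      (fun r hr => hu.acceleration_le r hr y hy) hs0 h2 hs
    have h5 : 2 * (M * ε) / √ε = 2 * M * √ε := by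
      rw [div_eq_iff hs0.ne']
      have := Real.mul_self_sqrt hw.pos.le
      linear_combination (-2 * M) * this
    rw [h5] at h4
    linarith

/-- Interpolation: fourth order decay at the boundary and a second derivative bound give linear
decay of the gradient. -/
lemma norm_fderiv_le_infDist {v : Vec d → Vec d} (hD : IsOpen D) (hv : ContDiffOn ℝ 2 v D)
    (hM : 0 ≤ M) {c : ℝ} (hc : 0 ≤ c)
    (hv2 : ∀ y ∈ D, ‖fderiv ℝ (fderiv ℝ v) y‖ ≤ M)
    (hdec : ∀ y ∈ D, ‖v y‖ ≤ c * Metric.infDist y (frontier D) ^ 4) {x : Vec d} (hx : x ∈ D)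
    (hpos : 0 < Metric.infDist x (frontier D)) :
    ‖fderiv ℝ v x‖ ≤ 34 * c * Metric.infDist x (frontier D) ^ 3
      + M * Metric.infDist x (frontier D) := by
  set δ := Metric.infDist x (frontier D) with hδ
  -- The closed ball of radius h lies in D and its points are within 2δ of the frontier, so the two
  -- values of v contribute (16 + 1)cδ⁴; division by h = δ/2 turns 17 into 34.
  set h := δ / 2 with hh
  have hh0 : 0 < h := by positivity
  have hsub : Metric.closedBall x h ⊆ D := fun y hy =>
    ball_subset_of_lt_infDist hD (ε := 3 / 4 * δ) (by positivity) hx (by rw [← hδ]; linarith)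
      (Metric.mem_ball.2 ((Metric.mem_closedBall.1 hy).trans_lt (by rw [hh]; linarith)))
  have hlip : ∀ y ∈ Metric.closedBall x h, ‖fderiv ℝ v y - fderiv ℝ v x‖ ≤ M * h := by
    intro y hy
    have h1 := (convex_closedBall x h).norm_image_sub_le_of_norm_fderiv_le (𝕜 := ℝ)
      (f := fderiv ℝ v) (C := M)
      (fun z hz => ContDiffAt.differentiableAt_fderiv (hv.contDiffAt (hD.mem_nhds (hsub hz))))
      (fun z hz => hv2 z (hsub hz)) (Metric.mem_closedBall_self hh0.le) hy
    refine h1.trans (mul_le_mul_of_nonneg_left ?_ hM)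
    rw [← dist_eq_norm]; exact hy
  have hz : ∀ z : Vec d, ‖z‖ = h → ‖fderiv ℝ v x z‖ ≤ 17 * c * δ ^ 4 + M * h * h := by
    intro z hz
    have hmem : x + z ∈ Metric.closedBall x h := by simp [hz]
    have h1 := (convex_closedBall x h).norm_image_sub_le_of_norm_fderiv_le' (𝕜 := ℝ) (f := v)
      (φ := fderiv ℝ v x) (C := M * h)
      (fun y hy => (hv.contDiffAt (hD.mem_nhds (hsub hy))).differentiableAt two_ne_zero)
      hlip (Metric.mem_closedBall_self hh0.le) hmem
    rw [add_sub_cancel_left, hz] at h1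
    have h2 := hdec x hx
    have h3 := hdec (x + z) (hsub hmem)
    have h4 : Metric.infDist (x + z) (frontier D) ≤ 2 * δ := by
      have := Metric.infDist_le_infDist_add_dist (s := frontier D) (x := x + z) (y := x)
      rw [dist_eq_norm, add_sub_cancel_left, hz] at this
      rw [← hδ] at this
      linarith
    have h5 : c * Metric.infDist (x + z) (frontier D) ^ 4 ≤ c * (2 * δ) ^ 4 := by
      have := Metric.infDist_nonneg (x := x + z) (s := frontier D)
      gcongr
    have e1 : fderiv ℝ v x z = v (x + z) - v x - (v (x + z) - v x - fderiv ℝ v x z) := by abel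
    have h6 := norm_sub_le (v (x + z) - v x) (v (x + z) - v x - fderiv ℝ v x z)
    rw [← e1] at h6
    have h7 := norm_sub_le (v (x + z)) (v x)
    rw [← hδ] at h2
    have h8 : c * (2 * δ) ^ 4 = 16 * c * δ ^ 4 := by ring
    linarith
  refine ContinuousLinearMap.opNorm_le_bound _ (by positivity) fun y => ?_
  by_cases hy : y = 0
  · simp [hy]
  have hny : 0 < ‖y‖ := norm_pos_iff.2 hy
  have h1 := hz ((h / ‖y‖) • y) (by
    rw [norm_smul, Real.norm_of_nonneg (by positivity), div_mul_cancel₀ _ hny.ne'])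
  rw [map_smul, norm_smul, Real.norm_of_nonneg (by positivity), div_mul_eq_mul_div,
    div_le_iff₀ hny] at h1
  have e1 : (17 * c * δ ^ 4 + M * h * h) * ‖y‖ ≤ h * ((34 * c * δ ^ 3 + M * δ) * ‖y‖) := by
    have : h * ((34 * c * δ ^ 3 + M * δ) * ‖y‖) - (17 * c * δ ^ 4 + M * h * h) * ‖y‖
        = M * δ ^ 2 / 4 * ‖y‖ := by rw [hh]; ring
    have h2 : 0 ≤ M * δ ^ 2 / 4 * ‖y‖ := by positivity
    linarith
  exact le_of_mul_le_mul_left (h1.trans e1) hh0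

end Peridynamics

/-! ### The dichotomy and the quadratic estimates -/

namespace Peridynamics

variable {d : ℕ} {D : Set (Vec d)} {T : ℝ} {f J : ℝ → ℝ} {β ρ M N K C ε Q : ℝ}
  {b : ℝ → Vec d → Vec d} {u₀ v₀ : Vec d → Vec d} {u uε e : ℝ → Vec d → Vec d}

lemma infDist_frontier_pos (hd : 0 < d) (hD : IsOpen D) (hDb : Bornology.IsBounded D) {x : Vec d}
    (hx : x ∈ D) : 0 < Metric.infDist x (frontier D) := by
  obtain ⟨p, hp, hdist⟩ := exists_frontier_infDist_eq hd hDb hx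
  rw [hdist, norm_pos_iff, sub_ne_zero]
  rintro rfl
  rw [frontier, hD.interior_eq] at hp
  exact hp.2 hx

/-- If admissible approximations exist for some small horizon, the limit is small in the collar of
that width. -/
lemma exists_collar_decay (hd : 0 < d) (hβ : 0 ≤ β) (hD : IsOpen D)
    (hDb : Bornology.IsBounded D) (hT : 0 < T) (hρ : 0 < ρ) (hM : 0 ≤ M)
    (hu : RegularMotion D T M u)
    (hreg : ∀ ε w, IsRegularApproximation f J D T ρ b u₀ v₀ C ε w → RegularMotion D T N w)
    (hQ : ∀ ε w, IsRegularApproximation f J D T ρ b u₀ v₀ C ε w → ∀ l, 0 ≤ l →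
      (∀ t ∈ Icc 0 T, ∀ x ∈ D, Metric.infDist x (frontier D) ≤ ε → ‖velocity T u t x‖ ≤ l) →
      ∀ t ∈ Icc 0 T, energy D T ρ β (fun t x => w t x - u t x) t ≤ Q * (ε ^ 2 + l)) :
    ∃ ε₀ > 0, ε₀ ≤ 1 ∧ ∃ Λ ≥ 0, ∀ ε < ε₀, ∀ w, IsRegularApproximation f J D T ρ b u₀ v₀ C ε w →
      ∀ t ∈ Icc 0 T, ∀ x ∈ D, Metric.infDist x (frontier D) ≤ ε →
        ‖velocity T u t x‖ ≤ Λ * ε ^ 2 ∧ ‖fderiv ℝ (u t) x‖ ≤ Λ * ε := by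
  by_cases hsmall : ∀ ε₀ > 0, ∃ ε < ε₀, ∃ w, IsRegularApproximation f J D T ρ b u₀ v₀ C ε w
  · have hdec : ∀ t ∈ Icc 0 T, ∀ x ∈ D, ‖u t x‖ ≤ |C| * Metric.infDist x (frontier D) ^ 4 :=
      fun t ht x hx => norm_le_infDist_pow_four hd hβ hD hDb hT hρ hM hu hreg hQ hsmall ht hx
    refine ⟨min 1 (T / 2), by positivity, min_le_left _ _, 34 * |C| + M, by positivity,
      fun ε hε w hw t ht x hx hxε => ?_⟩
    have hε0 := hw.pos
    have hε1 : ε ≤ 1 := hε.le.trans (min_le_left _ _)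
    have hεT : ε ≤ T / 2 := hε.le.trans (min_le_right _ _)
    have hδ := infDist_frontier_pos hd hD hDb hx
    have hsq : ε ^ 2 ≤ ε := by nlinarith
    constructor
    -- With fourth order decay the step h = ε² balances Landau's inequality: |C|ε⁴/ε² and Mε² are
    -- both of order ε².
    · have h4 := norm_deriv_le_of_norm_le (F := fun s => u s x) (η := |C| * ε ^ 4) (M := M)
        (h := ε ^ 2) (fun r hr => hu.hasDeriv r hr x hx)
        (fun r hr => hu.hasDeriv_velocity r hr x hx)
        (fun r hr => (hdec r hr x hx).trans (by gcongr))
        (fun r hr => hu.acceleration_le r hr x hx) (by positivity) (hsq.trans hεT) ht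
      have h5 : 2 * (|C| * ε ^ 4) / ε ^ 2 = 2 * |C| * ε ^ 2 := by field_simp
      rw [h5] at h4
      have h6 : 0 ≤ |C| * ε ^ 2 := by positivity
      linarith
    · have h4 := norm_fderiv_le_infDist hD (hu.contDiffOn t ht) hM (abs_nonneg C)
        (fun y hy => hu.fderiv_fderiv_le t ht y hy) (hdec t ht) hx hδ
      have h5 : Metric.infDist x (frontier D) ^ 3 ≤ ε := by
        calc _ ≤ ε ^ 3 := by gcongr
          _ ≤ ε := by
            have : ε ^ 3 = ε * ε ^ 2 := by ring
            nlinarith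
      have h6 : 34 * |C| * Metric.infDist x (frontier D) ^ 3 ≤ 34 * |C| * ε := by gcongr
      have h7 : M * Metric.infDist x (frontier D) ≤ M * ε := by gcongr
      linarith
  -- No approximation exists below ε₀, so the claim is vacuous there.
  · push Not at hsmall
    obtain ⟨ε₀, hε₀, h⟩ := hsmall
    exact ⟨min 1 ε₀, by positivity, min_le_left _ _, 0, le_rfl,
      fun ε hε w hw => absurd hw (h ε (hε.trans_le (min_le_right _ _)) w)⟩

lemma gradSq_le (v : Vec d → Vec d) (x : Vec d) : gradSq v x ≤ d * ‖fderiv ℝ v x‖ ^ 2 := by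
  have h : ∀ j ∈ Finset.univ, ‖partialDeriv j v x‖ ^ 2 ≤ ‖fderiv ℝ v x‖ ^ 2 := fun j _ => by
    have h1 := (fderiv ℝ v x).le_opNorm (EuclideanSpace.single j (1 : ℝ))
    rw [PiLp.norm_single, norm_one, mul_one] at h1
    exact pow_le_pow_left₀ (norm_nonneg _) h1 2
  simpa [gradSq] using Finset.sum_le_card_nsmul _ _ _ h

lemma gradSq_indicator (hD : IsOpen D) (v : Vec d → Vec d) {x : Vec d} (hx : x ∈ D) :
    gradSq (D.indicator v) x = gradSq v x := by
  simp only [gradSq, partialDeriv, (indicator_eventuallyEq hD v hx).fderiv_eq]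

lemma RegularMotion.integrableOn_gradSq (he : RegularMotion D T M e) (hD : IsOpen D)
    (hDb : Bornology.IsBounded D) {t : ℝ} (ht : t ∈ Icc 0 T) : IntegrableOn (gradSq (e t)) D :=
  (Peridynamics.integrableOn_gradSq hD hDb (he.dirichletField hD ht)).congr_fun
    (fun _ hx => gradSq_indicator hD _ hx) hD.measurableSet

lemma RegularMotion.integral_gradSq_le (he : RegularMotion D T M e) (hD : IsOpen D)
    (hDb : Bornology.IsBounded D) {t : ℝ} (ht : t ∈ Icc 0 T) :
    ∫ x in D, gradSq (e t) x ≤ ∫ x in D, pairing (e t) (e t) x := by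
  rw [← setIntegral_congr_fun hD.measurableSet fun x hx => gradSq_indicator hD (e t) hx,
    ← setIntegral_congr_fun hD.measurableSet fun x hx => pairing_indicator hD (e t) (e t) hx]
  exact Peridynamics.integral_gradSq_le hD hDb (he.dirichletField hD ht)

lemma RegularMotion.energy_eq (he : RegularMotion D T M e) (hD : IsOpen D)
    (hDb : Bornology.IsBounded D) (hT : 0 < T) {t : ℝ} (ht : t ∈ Icc 0 T) :
    energy D T ρ β e t = ρ * (∫ x in D, ‖e t x‖ ^ 2) + (∫ x in D, ρ * ‖velocity T e t x‖ ^ 2)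
      + β * ∫ x in D, pairing (e t) (e t) x := by
  rw [energy, integral_add ((he.integrableOn_normSq hD hDb ht).const_mul ρ)
    ((he.integrableOn_velocitySq hD hDb hT ht).const_mul ρ), integral_const_mul]

/-- Without elastic interaction the error vanishes off the collar. -/
lemma error_eq_zero_of_isotropic_zero (hC : IsIsotropic d f J 0)
    (hJ0 : ∀ᵐ ξ : Vec d ∂(volume.restrict (Metric.ball 0 1)), J ‖ξ‖ = 0) (hD : IsOpen D)
    (hT : 0 < T) (hρ : 0 < ρ) (hu : RegularMotion D T M u)
    (hsol : IsElastodynamicSolution f J D T ρ b u₀ v₀ u) (hε : 0 < ε)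
    (hper : IsPeridynamicSolution f J D T ρ ε b u₀ v₀ uε) (huε : RegularMotion D T N uε)
    (he : ∀ t x, e t x = uε t x - u t x) {x : Vec d} (hx : x ∈ D)
    (hxε : ε < Metric.infDist x (frontier D)) {t : ℝ} (ht : t ∈ Icc 0 T) : e t x = 0 := by
  have hreg : RegularMotion D T (N + M) e := huε.sub hD hT hu he
  have h0T : (0 : ℝ) ∈ Icc 0 T := ⟨le_rfl, hT.le⟩
  have hacc : ∀ s ∈ Icc 0 T, acceleration T e s x = 0 := by
    intro s hs
    have h1 := hper.equation s hs x hx hxε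
    rw [nonlocalForce_eq_zero hε hJ0] at h1
    have h2 := hsol.equation s hs x hx
    have h3 : elasticForce f J (u s) x = 0 := by
      ext i
      rw [hC.elasticForce_apply (hu.contDiffAt hD hs hx), zero_mul]
      rfl
    rw [h3, ← h1] at h2
    rw [acceleration_sub_of_mem hT huε hu he hs hx, sub_eq_zero]
    exact (smul_right_injective _ hρ.ne' h2).symm
  have hvel : ∀ s ∈ Icc 0 T, velocity T e s x = 0 := by
    intro s hs
    have h := (convex_Icc (0 : ℝ) T).norm_image_sub_le_of_norm_hasDerivWithin_le (C := 0)
      (fun r hr => hreg.hasDeriv_velocity r hr x hx) (fun r hr => by simp [hacc r hr]) h0T hs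
    rw [zero_mul, norm_le_zero_iff, sub_eq_zero] at h
    rw [h, velocity_sub_of_mem hT huε hu he h0T hx, hper.initial_velocity x hx,
      hsol.initial_velocity x hx, sub_self]
  have h := (convex_Icc (0 : ℝ) T).norm_image_sub_le_of_norm_hasDerivWithin_le (C := 0)
    (fun r hr => hreg.hasDeriv r hr x hx) (fun r hr => by simp [hvel r hr]) h0T ht
  rw [zero_mul, norm_le_zero_iff, sub_eq_zero] at h
  rw [h, he, hper.initial x hx, hsol.initial x hx, sub_self]

/-- Without elastic interaction the gradient of the error is controlled by the decay of the limit
in the collar. -/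
lemma norm_fderiv_error_le_of_isotropic_zero (hd : 0 < d) (hC : IsIsotropic d f J 0)
    (hJ0 : ∀ᵐ ξ : Vec d ∂(volume.restrict (Metric.ball 0 1)), J ‖ξ‖ = 0) (hD : IsOpen D)
    (hDb : Bornology.IsBounded D)
    (hT : 0 < T) (hρ : 0 < ρ) (hu : RegularMotion D T M u)
    (hsol : IsElastodynamicSolution f J D T ρ b u₀ v₀ u)
    (happ : IsRegularApproximation f J D T ρ b u₀ v₀ C ε uε) (huε : RegularMotion D T N uε)
    (he : ∀ t x, e t x = uε t x - u t x) (hε1 : ε ≤ 1) {Λ : ℝ} (hΛ : 0 ≤ Λ) {t : ℝ}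
    (ht : t ∈ Icc 0 T)
    (hcol : ∀ x ∈ D, Metric.infDist x (frontier D) ≤ ε → ‖fderiv ℝ (u t) x‖ ≤ Λ * ε)
    {x : Vec d} (hx : x ∈ D) : ‖fderiv ℝ (e t) x‖ ≤ (|C| + Λ) * ε := by
  have hε := happ.pos
  rcases lt_or_ge ε (Metric.infDist x (frontier D)) with h | h
  · have hev : e t =ᶠ[𝓝 x] fun _ => 0 := by
      filter_upwards [hD.mem_nhds hx, (Metric.continuous_infDist_pt
        (frontier D)).continuousAt.eventually_const_lt h] with y hy hyε
      exact error_eq_zero_of_isotropic_zero hC hJ0 hD hT hρ hu hsol hε happ.solution huε he hy hyε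
        ht
    rw [hev.fderiv_eq]
    simp only [fderiv_fun_const, Pi.zero_apply, norm_zero]
    positivity
  · have hed : e t = uε t - u t := funext (he t)
    rw [hed, fderiv_sub ((huε.contDiffAt hD ht hx).differentiableAt two_ne_zero)
      ((hu.contDiffAt hD ht hx).differentiableAt two_ne_zero)]
    refine (norm_sub_le _ _).trans ?_
    rw [add_mul]
    refine add_le_add ?_ (hcol x hx h)
    obtain ⟨p, hp, hdist⟩ := exists_frontier_infDist_eq hd hDb hx
    have h1 := (happ.collar t ht).norm_fderiv_le hD hε hp x
    rw [(indicator_eventuallyEq hD (uε t) hx).fderiv_eq, ← hdist] at h1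
    refine h1.trans (mul_le_mul_of_nonneg_left ?_ (abs_nonneg C))
    calc _ ≤ ε ^ 3 := by gcongr; exact Metric.infDist_nonneg
      _ ≤ ε ^ 1 := pow_le_pow_of_le_one hε.le hε1 (by norm_num)
      _ = ε := pow_one ε

lemma RegularMotion.integral_gradSq_le_of_norm_fderiv_le (he : RegularMotion D T M e)
    (hD : IsOpen D) (hDb : Bornology.IsBounded D) {t : ℝ} (ht : t ∈ Icc 0 T) {c : ℝ}
    (hc : ∀ x ∈ D, ‖fderiv ℝ (e t) x‖ ≤ c) :
    ∫ x in D, gradSq (e t) x ≤ d * c ^ 2 * (volume D).toReal := by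
  have hI : IntegrableOn (fun _ : Vec d => d * c ^ 2) D :=
    integrableOn_const hDb.measure_lt_top.ne
  have h := setIntegral_mono_on (he.integrableOn_gradSq hD hDb ht) hI hD.measurableSet
    fun x hx => (gradSq_le (e t) x).trans (mul_le_mul_of_nonneg_left
      (pow_le_pow_left₀ (norm_nonneg _) (hc x hx) 2) (Nat.cast_nonneg d))
  rw [setIntegral_const, smul_eq_mul, mul_comm] at h
  exact h

/-- Quadratic estimates for the energy and the gradient of the error. -/
lemma exists_error_estimate (hd : 0 < d) (hf : IsPotential f) (hJ : IsInfluence J)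
    (hC : IsIsotropic d f J β) (hβ : 0 ≤ β)
    (hβ0 : β = 0 → ∀ᵐ ξ : Vec d ∂(volume.restrict (Metric.ball 0 1)), J ‖ξ‖ = 0)
    (hD : IsOpen D) (hDb : Bornology.IsBounded D) (hT : 0 < T) (hρ : 0 < ρ)
    (hsol : IsElastodynamicSolution f J D T ρ b u₀ v₀ u) (C : ℝ) :
    ∃ R P G, 0 ≤ P ∧ 0 ≤ G ∧ ∀ ε uε, IsRegularApproximation f J D T ρ b u₀ v₀ C ε uε →
      ∀ e : ℝ → Vec d → Vec d, (∀ t x, e t x = uε t x - u t x) → RegularMotion D T R e ∧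
      ∀ t ∈ Icc 0 T, energy D T ρ β e t ≤ P * ε ^ 2 ∧ ∫ x in D, gradSq (e t) x ≤ G * ε ^ 2 := by
  obtain ⟨M, hM, hu⟩ := exists_regularMotion_of_contDiffOn hD hDb hT hsol.regular hsol.boundary
  obtain ⟨N, K, hN, hK, hNK⟩ :=
    exists_regularMotion_peridynamic hd hf hJ hC hβ hD hDb hT hρ hM hu hsol C
  obtain ⟨Q, hQ0, hQ⟩ : ∃ Q, 0 ≤ Q ∧ ∀ ε w, IsRegularApproximation f J D T ρ b u₀ v₀ C ε w →
      ∀ l, 0 ≤ l →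
      (∀ t ∈ Icc 0 T, ∀ x ∈ D, Metric.infDist x (frontier D) ≤ ε → ‖velocity T u t x‖ ≤ l) →
      ∀ t ∈ Icc 0 T, energy D T ρ β (fun t x => w t x - u t x) t ≤ Q * (ε ^ 2 + l) := by
    refine ⟨(K ^ 2 / ρ + 2 * (ρ * M + d * (β * (d * 3)) * (N + M)))
      * (volume D).toReal * Real.exp (2 * T), by positivity, fun ε w hw l hl hcol t ht => ?_⟩
    obtain ⟨h1, h2⟩ := hNK ε hw.pos w hw.solution hw.collar
    exact energy_error_le hC hβ hD hDb hT hρ hM hN hu hsol hw h1 h2 (fun _ _ => rfl) hl hcol ht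
  obtain ⟨ε₀, hε₀, hε₀1, Λ, hΛ, hdec⟩ := exists_collar_decay hd hβ hD hDb hT hρ hM hu
    (fun ε w hw => (hNK ε hw.pos w hw.solution hw.collar).1) hQ
  -- The first summand serves ε < ε₀, with l = Λε²; the second serves ε ≥ ε₀, with l = M ≤
  -- (M/ε₀²)ε².
  set P := Q * (1 + Λ) + Q * (1 + M / ε₀ ^ 2) with hP
  have hP0 : 0 ≤ P := by positivity
  set V := (volume D).toReal
  have hV : 0 ≤ V := ENNReal.toReal_nonneg
  -- P/β comes from Korn's inequality when β > 0 and is 0 by convention when β = 0. The other two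
  -- summands cover β = 0 for small and for large horizons.
  set G := P / β + (d * (|C| + Λ) ^ 2 * V + d * ((N + M) / ε₀) ^ 2 * V) with hG
  refine ⟨N + M, P, G, hP0, by positivity, fun ε uε happ e he => ?_⟩
  have hε := happ.pos
  have huε := (hNK ε hε uε happ.solution happ.collar).1
  have hreg : RegularMotion D T (N + M) e := huε.sub hD hT hu he
  have hlarge : ε₀ ≤ ε → 1 ≤ ε / ε₀ := fun h => (one_le_div hε₀).2 h
  have hen : ∀ t ∈ Icc 0 T, energy D T ρ β e t ≤ P * ε ^ 2 := by
    intro t ht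
    have hee : e = fun t x => uε t x - u t x := funext fun t => funext fun x => he t x
    rw [hee]
    rcases lt_or_ge ε ε₀ with h | h
    · refine (hQ ε uε happ (Λ * ε ^ 2) (by positivity)
        (fun s hs x hx hxε => (hdec ε h uε happ s hs x hx hxε).1) t ht).trans ?_
      have : 0 ≤ Q * (1 + M / ε₀ ^ 2) * ε ^ 2 := by positivity
      rw [hP]; linarith
    · refine (hQ ε uε happ M hM (fun s hs x hx _ => hu.velocity_le s hs x hx) t ht).trans ?_
      have h1 : M ≤ M / ε₀ ^ 2 * ε ^ 2 := by
        rw [div_mul_eq_mul_div, mul_div_assoc, ← div_pow]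
        exact le_mul_of_one_le_right hM (one_le_pow₀ (hlarge h))
      have h2 : 0 ≤ Q * (1 + Λ) * ε ^ 2 := by positivity
      have h3 := mul_le_mul_of_nonneg_left h1 hQ0
      rw [hP]; linarith
  refine ⟨hreg, fun t ht => ⟨hen t ht, ?_⟩⟩
  have hrest : 0 ≤ (d * (|C| + Λ) ^ 2 * V + d * ((N + M) / ε₀) ^ 2 * V) * ε ^ 2 := by positivity
  rcases hβ.eq_or_lt with h0 | hpos
  · subst h0
    have hPβ : P / 0 * ε ^ 2 = 0 := by rw [div_zero, zero_mul]
    rcases lt_or_ge ε ε₀ with h | h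
    · have h1 := hreg.integral_gradSq_le_of_norm_fderiv_le hD hDb ht fun x hx =>
        norm_fderiv_error_le_of_isotropic_zero hd hC (hβ0 rfl) hD hDb hT hρ hu hsol happ huε he
          (h.le.trans hε₀1) hΛ ht (fun y hy hyε => (hdec ε h uε happ t ht y hy hyε).2) hx
      have h2 : 0 ≤ d * ((N + M) / ε₀) ^ 2 * V * ε ^ 2 := by positivity
      have h3 : d * ((|C| + Λ) * ε) ^ 2 * V = d * (|C| + Λ) ^ 2 * V * ε ^ 2 := by ring
      rw [hG, add_mul, hPβ]
      linarith
    · have h1 := hreg.integral_gradSq_le_of_norm_fderiv_le hD hDb ht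
        (c := (N + M) / ε₀ * ε) fun x hx => (hreg.fderiv_le t ht x hx).trans (by
          rw [div_mul_eq_mul_div, mul_div_assoc]
          exact le_mul_of_one_le_right (by positivity) (hlarge h))
      have h2 : 0 ≤ d * (|C| + Λ) ^ 2 * V * ε ^ 2 := by positivity
      have h3 : d * ((N + M) / ε₀ * ε) ^ 2 * V = d * ((N + M) / ε₀) ^ 2 * V * ε ^ 2 := by ring
      rw [hG, add_mul, hPβ]
      linarith
  · have h1 := hen t ht
    rw [hreg.energy_eq hD hDb hT ht] at h1
    have h2 : 0 ≤ ρ * ∫ x in D, ‖e t x‖ ^ 2 :=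
      mul_nonneg hρ.le (integral_nonneg fun x => by positivity)
    have h3 : 0 ≤ ∫ x in D, ρ * ‖velocity T e t x‖ ^ 2 :=
      integral_nonneg fun x => by positivity
    have h4 : ∫ x in D, pairing (e t) (e t) x ≤ P / β * ε ^ 2 := by
      rw [div_mul_eq_mul_div, le_div_iff₀ hpos]
      linarith
    have h5 := hreg.integral_gradSq_le hD hDb ht
    rw [hG, add_mul]
    linarith

end Peridynamics

/-! ### The convergence theorem -/

open Peridynamics in
theorem theorem6p2 (d : ℕ) (hd : d = 2 ∨ d = 3)
    (f J : ℝ → ℝ) (hf : IsPotential f) (hJ : IsInfluence J)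
    (D : Set (Vec d)) (hD : IsOpen D) (hDb : Bornology.IsBounded D)
    (T ρ : ℝ) (hT : 0 < T) (hρ : 0 < ρ)
    (b : ℝ → Vec d → Vec d) (u₀ v₀ : Vec d → Vec d)
    (D' : Set (Vec d)) (hD' : D' ⊆ D) (hdist : 0 < setDist (frontier D') (frontier D))
    (hu₀ : ∀ x, x ∉ D' → u₀ x = 0) (hv₀ : ∀ x, x ∉ D' → v₀ x = 0)
    (u : ℝ → Vec d → Vec d) (hu : IsElastodynamicSolution f J D T ρ b u₀ v₀ u)
    (C₁ : ℝ) :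
    ∃ C₂ > 0, ∃ C₃ > 0, ∀ ε : ℝ, 0 < ε →
      ENNReal.ofReal ε < setDist (frontier D') (frontier D) →
      ∀ uε : ℝ → Vec d → Vec d, IsPeridynamicSolution f J D T ρ ε b u₀ v₀ uε →
      (∀ t ∈ Set.Icc 0 T, ContDiffOn ℝ 4 (uε t) D) →
      (∀ t ∈ Set.Icc 0 T, ∀ x ∈ D, ‖iteratedFDeriv ℝ 4 (uε t) x‖ ≤ C₁) →
      ∀ e : ℝ → Vec d → Vec d, (∀ t x, e t x = uε t x - u t x) →
      ∀ t ∈ Set.Icc 0 T,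
        (IntegrableOn (fun x => ρ * ‖velocity T e t x‖ ^ 2) D ∧
          IntegrableOn (elasticDensity f J (e t)) D ∧
          (∫ x in D, ρ * ‖velocity T e t x‖ ^ 2) + (∫ x in D, elasticDensity f J (e t) x)
            ≤ C₂ * ε ^ 2) ∧
        (IntegrableOn (fun x => ‖e t x‖ ^ 2) D ∧ IntegrableOn (gradSq (e t)) D ∧
          hOneNorm D (e t) ≤ C₃ * ε) := by
  have hd0 : 0 < d := by omega
  obtain ⟨β, hβ, hC, hβ0⟩ := exists_elasticTensor_eq hd0 hf hJ
  obtain ⟨R, P, G, hP, hG, hest⟩ :=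
    exists_error_estimate hd0 hf hJ hC hβ hβ0 hD hDb hT hρ hu C₁
  -- P bounds the whole energy, hence P/ρ the L² part, while G bounds the gradient; the added 1 only
  -- makes the constants positive.
  refine ⟨P + 1, by positivity, √(P / ρ + G) + 1, by positivity,
    fun ε hε _ uε hper hc4 hb4 e he t ht => ?_⟩
  obtain ⟨hreg, hbd⟩ := hest ε uε ⟨hε, hper, fun s hs => ⟨hc4 s hs, hb4 s hs, hper.boundary s hs⟩⟩
    e he
  obtain ⟨hen, hgr⟩ := hbd t ht
  rw [hreg.energy_eq hD hDb hT ht] at hen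
  have hdens : elasticDensity f J (e t) = fun x => β * pairing (e t) (e t) x :=
    funext (IsIsotropic.elasticDensity_eq hC (e t))
  have h1 : 0 ≤ ρ * ∫ x in D, ‖e t x‖ ^ 2 :=
    mul_nonneg hρ.le (integral_nonneg fun x => by positivity)
  have h2 : 0 ≤ ∫ x in D, ρ * ‖velocity T e t x‖ ^ 2 := integral_nonneg fun x => by positivity
  have h3 : 0 ≤ β * ∫ x in D, pairing (e t) (e t) x :=
    mul_nonneg hβ (integral_nonneg fun x => pairing_self_nonneg (e t) x)
  refine ⟨⟨(hreg.integrableOn_velocitySq hD hDb hT ht).const_mul ρ, ?_, ?_⟩,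
    hreg.integrableOn_normSq hD hDb ht, hreg.integrableOn_gradSq hD hDb ht, ?_⟩
  · rw [hdens]
    exact (hreg.integrableOn_pairing hD hDb ht).const_mul β
  · have h4 : ∫ x in D, elasticDensity f J (e t) x = β * ∫ x in D, pairing (e t) (e t) x := by
      rw [hdens]
      exact integral_const_mul _ _
    have := sq_nonneg ε
    rw [h4]
    linarith
  · have h4 : ∫ x in D, ‖e t x‖ ^ 2 ≤ P / ρ * ε ^ 2 := by
      rw [div_mul_eq_mul_div, le_div_iff₀ hρ]
      linarith
    calc hOneNorm D (e t) ≤ √((P / ρ + G) * ε ^ 2) := Real.sqrt_le_sqrt (by linarith)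
      _ = √(P / ρ + G) * ε := by rw [Real.sqrt_mul (by positivity), Real.sqrt_sq hε.le]
      _ ≤ (√(P / ρ + G) + 1) * ε := by
        rw [add_mul]
        linarith
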